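/- **Notation.** Let $\mathcal T=\mathbb C^3$ be the space of times $(t_1,t_2,t_5)$ (with $x=t_1$), and let $(Q_U,Q_V,Q_W,P_U,P_V,P_W)\in\mathbb C^6$ be canonical coordinates. Put $$\begin{aligned}H_1={}&P_UQ_W+6P_W^2-\tfrac38Q_UQ_W^2+\tfrac12P_V^2-\tfrac18Q_U^4-\tfrac32Q_UQ_V^2-t_1Q_U+2t_2Q_V\\&+\tfrac18t_5(16Q_UP_W-2Q_U^3+4Q_V^2-Q_W^2)-\tfrac12t_5^2(4P_W-Q_U^2)+\tfrac{19}{27}t_5^3Q_U+\tfrac{41}{54}t_5^4-\tfrac43t_5t_1,\end{aligned}$$ $$\begin{aligned}H_2={}&\tfrac12P_VQ_UQ_W+\tfrac14Q_VQ_W^2-2P_UP_V-6P_WQ_UQ_V+Q_V^3+Q_U^3Q_V+2t_1Q_V+t_2(4P_W-Q_U^2)\\&+\tfrac12t_5(Q_VQ_U^2-P_VQ_W+4Q_VP_W)-2t_5t_2Q_U-\tfrac{65}{27}t_5^3Q_V-\tfrac{22}9t_5^2t_2,\end{aligned}$$ $$\begin{aligned}H_5={}&\tfrac12Q_WP_V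Q_UQ_V-\tfrac34P_UQ_WQ_U^2-P_UP_VQ_V+P_UP_WQ_W+\tfrac38Q_V^4-\tfrac1{128}Q_W^4+4P_W^3-\tfrac1{16}Q_U^6-P_WP_V^2\\&+P_WQ_U^4+P_U^2Q_U-\tfrac92P_W^2Q_U^2-\tfrac18Q_U^3Q_V^2+\tfrac18Q_U^2P_V^2+\tfrac3{32}Q_W^2Q_U^3-\tfrac1{16}Q_W^2Q_V^2\\&+t_1\left(2Q_UP_W-\tfrac18Q_W^2-\tfrac14Q_U^3+\tfrac12Q_V^2\right)+\tfrac12t_2(Q_VQ_U^2-P_VQ_W+4Q_VP_W)\\&+t_5\big(\tfrac3{16}Q_U^5-2P_U^2-\tfrac1{16}Q_U^2Q_W^2-\tfrac14P_WQ_W^2+5P_W^2Q_U-2P_WQ_U^3-5P_WQ_V^2+\tfrac34Q_U^2Q_V^2\\&\qquad-\tfrac14P_V^2Q_U+\tfrac12P_VQ_VQ_W+P_UQ_UQ_W\big)-t_2^2Q_U-t_1t_5(4P_W-Q_U^2)\\&+t_5^2\left(\tfrac{47}{12}Q_UQ_V^2-\tfrac{29}{18}P_UQ_W-\tfrac32P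_WQ_U^2+\tfrac{29}{48}Q_UQ_W^2+\tfrac7{18}Q_U^4-\tfrac{14}9P_V^2-\tfrac{20}3P_W^2\right)\\&-\tfrac1{108}t_5^3(284Q_UP_W-49Q_U^3+152Q_V^2-11Q_W^2)+\tfrac{19}9t_5^2t_1Q_U-\tfrac{65}9t_5^2t_2Q_V+\tfrac1{216}t_5^4(1304P_W-299Q_U^2)\\&-\tfrac{2173}{972}t_5^5Q_U-\tfrac23t_1^2-\tfrac{22}9t_5t_2^2+\tfrac{82}{27}t_5^3t_1-\tfrac{556}{243}t_5^6.\end{aligned}$$ Consider the linear system $\partial_\lambda\Psi=L(\lambda)\Psi$ with $$L=\begin{pmatrix}0&0&1\\0&0&0\\0&0&0\end{pmatrix}\lambda^2+\begin{pmatrix}0&2t_5+\frac14Q_U&-Q_V\\1&0&2t_5+\frac14Q_U\\0&1&0\end{pmatrix}\lambda+\begin{pmatrix}\ell+\frac12P_V&L_{12}&L_{13}\\\frac12Q_V-\frac14Q_W&-2\ell&L_{23}\\t_5-\frac12Q_U&\frac12Q_V+\frac14Q_W&\ell-\frac12P_V\end{pmatrix},$$ $\ell=\frac18Q_U^2-P_W-\frac14t_5Q_U-\frac16t_5^2$,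 $L_{12}=\frac5{16}Q_UQ_W-P_U+\frac14t_5Q_W-\frac38Q_UQ_V-\frac12t_5Q_V+t_2$, $L_{23}=-\frac5{16}Q_UQ_W+P_U-\frac14t_5Q_W-\frac38Q_UQ_V-\frac12t_5Q_V+t_2$, $L_{13}=\frac1{16}Q_W^2+\frac7{32}Q_U^3+\frac34Q_V^2-\frac32P_WQ_U+\frac5{16}t_5Q_U^2-2t_5P_W+\frac14t_5^2Q_U+t_1+\frac8{27}t_5^3$. Let $\omega=e^{2\pi i/3}$, $\Delta_3=\mathrm{diag}(\frac13,0,-\frac13)$, $\mathcal U=\frac{i}{\sqrt3}\begin{pmatrix}1&\omega&\omega^2\\1&1&1\\1&\omega^2&\omega\end{pmatrix}$, $g(\lambda)=\lambda^{\Delta_3}\mathcal U$, and $\Theta=\mathrm{diag}(\vartheta_1,\vartheta_2,\vartheta_3)$, $\vartheta_j=\frac37\omega^{j-1}\lambda^{7/3}+\omega^{1-j}t_5\lambda^{5/3}+\omega^{1-j}t_2\lambda^{2/3}+\omega^{j-1}t_1\lambda^{1/3}$. A *normalized formal solution* is a formal solution $\Psi=\mathfrak G e^{\Theta}$ at $\lambda=\infty$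 with $\mathfrak G=g(\lambda)S$, $S=I+\sum_{k\ge1}\Phi_k\lambda^{-k/3}$. Let $\mathcal M$ be a parameter space (a complex normed space; for instance local coordinates on the monodromy data), $W\subseteq\mathcal T\times\mathcal M$ open, and let $Q_a,P_a:W\to\mathbb C$ ($a\in\{U,V,W\}$) be holomorphic. Let $d=d_{\mathcal T}+d_{\mathcal M}$ be the total differential on $W$. For normalized formal solutions $\mathfrak G$ of the systems with data $(t,Q(t,m),P(t,m))$, $(t,m)\in W$, the *extended $\tau$-differential* is the 1-form on $W$ $$\boldsymbol\omega_0=\operatorname*{Res}_{\lambda=\infty}\operatorname{tr}\Big[\Big(L(\lambda)-\frac{\Delta_3}{\lambda}\Big)\,d\mathfrak G\,\mathfrak G^{-1}\Big]d\lambda ,$$ where $\operatorname{Res}_{\lambda=\infty}f\,d\lambda$ is minus the coefficient of $\lambda^{-1}$ in $f$. **Proposition.** For all $(t,Q,P)\in\mathbb C^9$ there is exactly one normalized formal solution. For $W$ and $Q_a,P_a$ as above its coefficients $\Phi_k$ and the coefficients of $\boldsymbol\omega_0$ are holomorphic on $W$, and $$\boldsymbol\omega_0=\tfrac12\boldsymbol\omega_{cla}+dG\quad\text{on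 }W,$$ where $$\boldsymbol\omega_{cla}=\sum_{a\in\{U,V,W\}}P_a\,dQ_a-\sum_{k\in\{1,2,5\}}H_k\,dt_k,$$ $$G=\tfrac17\left[3t_1H_1+\tfrac52t_2H_2+t_5H_5-P_UQ_U-\tfrac32P_VQ_V-\tfrac32P_WQ_W\right].$$ If moreover the family solves Hamilton's equations $\frac{\partial Q_a}{\partial t_k}=\frac{\partial H_k}{\partial P_a}$, $\frac{\partial P_a}{\partial t_k}=-\frac{\partial H_k}{\partial Q_a}$ on $W$ for all $a\in\{U,V,W\}$ and $k\in\{1,2,5\}$, then $$d\boldsymbol\omega_0=\tfrac12\sum_{a\in\{U,V,W\}}d_{\mathcal M}P_a\wedge d_{\mathcal M}Q_a .$$ Thus the two Its–Prokhorov conjectures hold for this system with constant $\gamma=\frac12$ and $G$ polynomial. -/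

import Mathlib

/-! The `(3,4)` string equation: Hamiltonians, linear system, formal solution at infinity, and the
extended tau-differential.

Index conventions.  Times are `t : Fin 3 → ℂ` with `t 0 = t₁ = x`, `t 1 = t₂`, `t 2 = t₅`.
Canonical coordinates are `Q P : Fin 3 → ℂ`, the indices `0, 1, 2` standing for `U, V, W`.

Formal series.  `LaurentSeries ℂ` is used with the variable `z = 1/ξ`, where `λ = ξ ^ 3`; so its
elements are formal series in `ξ` with finitely many positive powers of `ξ`. -/

noncomputable section

namespace String34

/-! ### Hamiltonians -/

def H1 (t1 t2 t5 QU QV QW PU PV PW : ℂ) : ℂ :=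
  PU * QW + 6 * PW ^ 2 - 3 / 8 * QU * QW ^ 2 + 1 / 2 * PV ^ 2 - 1 / 8 * QU ^ 4
    - 3 / 2 * QU * QV ^ 2 - t1 * QU + 2 * t2 * QV
    + 1 / 8 * t5 * (16 * QU * PW - 2 * QU ^ 3 + 4 * QV ^ 2 - QW ^ 2)
    - 1 / 2 * t5 ^ 2 * (4 * PW - QU ^ 2) + 19 / 27 * t5 ^ 3 * QU + 41 / 54 * t5 ^ 4
    - 4 / 3 * t5 * t1

def H2 (t1 t2 t5 QU QV QW PU PV PW : ℂ) : ℂ :=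
  1 / 2 * PV * QU * QW + 1 / 4 * QV * QW ^ 2 - 2 * PU * PV - 6 * PW * QU * QV + QV ^ 3
    + QU ^ 3 * QV + 2 * t1 * QV + t2 * (4 * PW - QU ^ 2)
    + 1 / 2 * t5 * (QV * QU ^ 2 - PV * QW + 4 * QV * PW) - 2 * t5 * t2 * QU
    - 65 / 27 * t5 ^ 3 * QV - 22 / 9 * t5 ^ 2 * t2

def H5 (t1 t2 t5 QU QV QW PU PV PW : ℂ) : ℂ :=
  1 / 2 * QW * PV * QU * QV - 3 / 4 * PU * QW * QU ^ 2 - PU * PV * QV + PU * PW * QW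
    + 3 / 8 * QV ^ 4 - 1 / 128 * QW ^ 4 + 4 * PW ^ 3
    - 1 / 16 * QU ^ 6 - PW * PV ^ 2 + PW * QU ^ 4 + PU ^ 2 * QU - 9 / 2 * PW ^ 2 * QU ^ 2
    - 1 / 8 * QU ^ 3 * QV ^ 2 + 1 / 8 * QU ^ 2 * PV ^ 2 + 3 / 32 * QW ^ 2 * QU ^ 3
    - 1 / 16 * QW ^ 2 * QV ^ 2
    + t1 * (2 * QU * PW - 1 / 8 * QW ^ 2 - 1 / 4 * QU ^ 3 + 1 / 2 * QV ^ 2)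
    + 1 / 2 * t2 * (QV * QU ^ 2 - PV * QW + 4 * QV * PW)
    + t5 * (3 / 16 * QU ^ 5 - 2 * PU ^ 2 - 1 / 16 * QU ^ 2 * QW ^ 2 - 1 / 4 * PW * QW ^ 2
        + 5 * PW ^ 2 * QU - 2 * PW * QU ^ 3 - 5 * PW * QV ^ 2 + 3 / 4 * QU ^ 2 * QV ^ 2
        - 1 / 4 * PV ^ 2 * QU + 1 / 2 * PV * QV * QW + PU * QU * QW)
    - t2 ^ 2 * QU - t1 * t5 * (4 * PW - QU ^ 2)
    + t5 ^ 2 * (47 / 12 * QU * QV ^ 2 - 29 / 18 * PU * QW - 3 / 2 * PW * QU ^ 2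
        + 29 / 48 * QU * QW ^ 2 + 7 / 18 * QU ^ 4 - 14 / 9 * PV ^ 2 - 20 / 3 * PW ^ 2)
    - 1 / 108 * t5 ^ 3 * (284 * QU * PW - 49 * QU ^ 3 + 152 * QV ^ 2 - 11 * QW ^ 2)
    + 19 / 9 * t5 ^ 2 * t1 * QU - 65 / 9 * t5 ^ 2 * t2 * QV
    + 1 / 216 * t5 ^ 4 * (1304 * PW - 299 * QU ^ 2) - 2173 / 972 * t5 ^ 5 * QU - 2 / 3 * t1 ^ 2
    - 22 / 9 * t5 * t2 ^ 2 + 82 / 27 * t5 ^ 3 * t1 - 556 / 243 * t5 ^ 6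

/-- The three Hamiltonians; `ham 0, ham 1, ham 2` belong to the times `t₁, t₂, t₅`. -/
def ham (k : Fin 3) (t Q P : Fin 3 → ℂ) : ℂ :=
  ![H1 (t 0) (t 1) (t 2) (Q 0) (Q 1) (Q 2) (P 0) (P 1) (P 2),
    H2 (t 0) (t 1) (t 2) (Q 0) (Q 1) (Q 2) (P 0) (P 1) (P 2),
    H5 (t 0) (t 1) (t 2) (Q 0) (Q 1) (Q 2) (P 0) (P 1) (P 2)] k

/-- The polynomial `G`. -/
def polyG (t Q P : Fin 3 → ℂ) : ℂ :=
  1 / 7 * (3 * t 0 * ham 0 t Q P + 5 / 2 * t 1 * ham 1 t Q P + t 2 * ham 2 t Q P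
    - P 0 * Q 0 - 3 / 2 * P 1 * Q 1 - 3 / 2 * P 2 * Q 2)

/-! ### Formal series -/

/-- `3 × 3` matrices of formal series. -/
abbrev Mat : Type := Matrix (Fin 3) (Fin 3) (LaurentSeries ℂ)

/-- The monomial `ξ ^ n`; thus `λ ^ n` is `xi (3 * n)`. -/
def xi (n : ℤ) : LaurentSeries ℂ := HahnSeries.single (-n) 1

/-- A constant, as a formal series. -/
def cst : ℂ →+* LaurentSeries ℂ := HahnSeries.C

/-- `d/dλ`, which is `-(1/3) z ^ 4 d/dz` in the variable `z = λ ^ (-1/3)`. -/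
def dLambda (f : LaurentSeries ℂ) : LaurentSeries ℂ :=
  cst (-(1 / 3)) * xi (-4) * LaurentSeries.derivative ℂ f

/-- The residue at `λ = ∞` of the differential `f dλ`: minus the coefficient of `λ ^ (-1)`. -/
def resInfty (f : LaurentSeries ℂ) : ℂ := -f.coeff 3

/-! ### The linear system `∂Ψ/∂λ = L Ψ` -/

/-- The coefficient of `λ ^ 1` in `L`. -/
def L1 (t Q : Fin 3 → ℂ) : Matrix (Fin 3) (Fin 3) ℂ :=
  !![0, 2 * t 2 + 1 / 4 * Q 0, -Q 1;
     1, 0, 2 * t 2 + 1 / 4 * Q 0;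
     0, 1, 0]

/-- The coefficient of `λ ^ 0` in `L`. -/
def L0 (t Q P : Fin 3 → ℂ) : Matrix (Fin 3) (Fin 3) ℂ :=
  let x := t 0
  let t2 := t 1
  let t5 := t 2
  let QU := Q 0
  let QV := Q 1
  let QW := Q 2
  let PU := P 0
  let PV := P 1
  let PW := P 2
  let L12 := 5 / 16 * QU * QW - PU + 1 / 4 * t5 * QW - 3 / 8 * QU * QV - 1 / 2 * t5 * QV + t2
  let L13 := 1 / 16 * QW ^ 2 + 7 / 32 * QU ^ 3 + 3 / 4 * QV ^ 2 - 3 / 2 * PW * QU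
    + 5 / 16 * t5 * QU ^ 2 - 2 * t5 * PW + 1 / 4 * t5 ^ 2 * QU + x + 8 / 27 * t5 ^ 3
  let L23 := -(5 / 16) * QU * QW + PU - 1 / 4 * t5 * QW - 3 / 8 * QU * QV - 1 / 2 * t5 * QV + t2
  !![1 / 8 * QU ^ 2 - PW + 1 / 2 * PV - 1 / 4 * t5 * QU - 1 / 6 * t5 ^ 2, L12, L13;
     1 / 2 * QV - 1 / 4 * QW, 2 * PW - 1 / 4 * QU ^ 2 + 1 / 2 * t5 * QU + 1 / 3 * t5 ^ 2, L23;
     t5 - 1 / 2 * QU, 1 / 2 * QV + 1 / 4 * QW,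
       1 / 8 * QU ^ 2 - PW - 1 / 2 * PV - 1 / 4 * t5 * QU - 1 / 6 * t5 ^ 2]

/-- The connection matrix `L(λ; t, Q, P)`, with `λ = ξ ^ 3`. -/
def connection (t Q P : Fin 3 → ℂ) : Mat :=
  xi 6 • (!![0, 0, 1; 0, 0, 0; 0, 0, 0] : Matrix (Fin 3) (Fin 3) ℂ).map cst
    + xi 3 • (L1 t Q).map cst + (L0 t Q P).map cst

/-- `ω = exp (2πi/3)`. -/
def omega3 : ℂ := Complex.exp (2 * Real.pi * Complex.I / 3)

/-- The unitary matrix `𝒰`. -/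
def matU : Matrix (Fin 3) (Fin 3) ℂ :=
  (Complex.I / (Real.sqrt 3 : ℂ)) •
    !![1, omega3, omega3 ^ 2;
       1, 1, 1;
       1, omega3 ^ 2, omega3]

/-- `g(λ) = λ ^ Δ₃ 𝒰` with `Δ₃ = diag (1/3, 0, -1/3)`. -/
def gauge : Mat := Matrix.diagonal ![xi 1, 1, xi (-1)] * matU.map cst

/-- `Δ₃ / λ`. -/
def deltaOverLambda : Mat :=
  Matrix.diagonal ![cst (1 / 3) * xi (-3), 0, cst (-(1 / 3)) * xi (-3)]

/-- `Θ = diag (ϑ₁, ϑ₂, ϑ₃)` with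
`ϑⱼ = (3/7) ω^(j-1) ξ^7 + ω^(1-j) t₅ ξ^5 + ω^(1-j) t₂ ξ^2 + ω^(j-1) t₁ ξ`. -/
def theta (t : Fin 3 → ℂ) : Mat :=
  Matrix.diagonal fun j : Fin 3 =>
    cst (3 / 7 * omega3 ^ (j : ℕ)) * xi 7 + cst (omega3⁻¹ ^ (j : ℕ) * t 2) * xi 5
      + cst (omega3⁻¹ ^ (j : ℕ) * t 1) * xi 2 + cst (omega3 ^ (j : ℕ) * t 0) * xi 1

/-- The matrix series `∑ₖ Φₖ ξ ^ (-k)`. -/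
def seriesOf (Φ : ℕ → Matrix (Fin 3) (Fin 3) ℂ) : Mat :=
  Matrix.of fun i j => HahnSeries.ofPowerSeries ℤ ℂ (PowerSeries.mk fun k => Φ k i j)

/-- `Ψ = 𝔊 e^Θ`, with `𝔊 = g(λ) (I + ∑_{k ≥ 1} Φₖ λ ^ (-k/3))`, is a formal solution at `λ = ∞` of
`∂Ψ/∂λ = L(λ; t, Q, P) Ψ`.  Since `Θ` is diagonal, cancelling the factor `e^Θ` turns the equation
into `∂𝔊/∂λ + 𝔊 ∂Θ/∂λ = L 𝔊`. -/
def IsFormalSolution (t Q P : Fin 3 → ℂ) (Φ : ℕ → Matrix (Fin 3) (Fin 3) ℂ) : Prop :=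
  Φ 0 = 1 ∧
    (gauge * seriesOf Φ).map dLambda + (gauge * seriesOf Φ) * (theta t).map dLambda
      = connection t Q P * (gauge * seriesOf Φ)

/-! ### Differential forms on (times) × (parameters) -/

section Forms

variable {M : Type*} [NormedAddCommGroup M] [NormedSpace ℂ M]

/-- The differential, at the point `w` and in the direction `v`, of a matrix depending on a
parameter, computed entrywise. -/
def dMatrix {E : Type*} [NormedAddCommGroup E] [NormedSpace ℂ E]
    (A : E → Matrix (Fin 3) (Fin 3) ℂ) (w v : E) : Matrix (Fin 3) (Fin 3) ℂ :=
  Matrix.of fun i j => fderiv ℂ (fun w' => A w' i j) w v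

/-- The extended tau-differential
`ω₀ = ⟨L d𝔊 𝔊⁻¹⟩ - ⟨(Δ₃/λ) d𝔊 𝔊⁻¹⟩`, with `⟨X⟩ = Res_{λ = ∞} tr X dλ` and `d` the total differential
in all of the variables (times and parameters), evaluated at the point `w = (t, m)` on the tangent
vector `v`.  `Q, P` are the canonical coordinates and `Φ` the coefficients of the formal solution,
as functions on (times) × (parameters); `d𝔊 = g dS` for `𝔊 = g S`. -/
def omega0 (Q P : (Fin 3 → ℂ) × M → Fin 3 → ℂ)
    (Φ : (Fin 3 → ℂ) × M → ℕ → Matrix (Fin 3) (Fin 3) ℂ) (w v : (Fin 3 → ℂ) × M) : ℂ :=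
  let 𝔊 : Mat := gauge * seriesOf (Φ w)
  let d𝔊 : Mat := gauge * seriesOf (fun k => dMatrix (fun w' => Φ w' k) w v)
  resInfty (Matrix.trace (connection w.1 (Q w) (P w) * (d𝔊 * 𝔊⁻¹)))
    - resInfty (Matrix.trace (deltaOverLambda * (d𝔊 * 𝔊⁻¹)))

/-- The classical action differential `∑ₐ Pₐ dQₐ - ∑ₖ Hₖ dtₖ`. -/
def omegaCla (Q P : (Fin 3 → ℂ) × M → Fin 3 → ℂ) (w v : (Fin 3 → ℂ) × M) : ℂ :=
  ∑ a, P w a * fderiv ℂ (fun w' => Q w' a) w v - ∑ k, ham k w.1 (Q w) (P w) * v.1 k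

/-- The exterior derivative of a 1-form `α` on a vector space, at `w`, on the vectors `u, v`. -/
def extD {E : Type*} [NormedAddCommGroup E] [NormedSpace ℂ E] (α : E → E → ℂ) (w u v : E) : ℂ :=
  fderiv ℂ (fun w' => α w' v) w u - fderiv ℂ (fun w' => α w' u) w v

/-- The 2-form `Ω = ∑ₐ d_M Pₐ ∧ d_M Qₐ`, where `d_M` differentiates in the parameters only. -/
def symplecticM (Q P : (Fin 3 → ℂ) × M → Fin 3 → ℂ) (w u v : (Fin 3 → ℂ) × M) : ℂ :=
  ∑ a, (fderiv ℂ (fun w' => P w' a) w (0, u.2) * fderiv ℂ (fun w' => Q w' a) w (0, v.2)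
    - fderiv ℂ (fun w' => P w' a) w (0, v.2) * fderiv ℂ (fun w' => Q w' a) w (0, u.2))

/-- Hamilton's equations in the times, at every point of `W`: the family `(Q, P)` of functions of
the times, depending on parameters, consists of solutions of the isomonodromic system. -/
def SolvesHamilton (W : Set ((Fin 3 → ℂ) × M)) (Q P : (Fin 3 → ℂ) × M → Fin 3 → ℂ) : Prop :=
  ∀ w ∈ W, ∀ k a : Fin 3,
    fderiv ℂ (fun w' => Q w' a) w (Pi.single k 1, 0)
        = fderiv ℂ (fun p => ham k w.1 (Q w) p) (P w) (Pi.single a 1) ∧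
      fderiv ℂ (fun w' => P w' a) w (Pi.single k 1, 0)
        = -fderiv ℂ (fun q => ham k w.1 q (P w)) (Q w) (Pi.single a 1)

end Forms

end String34

end

set_option linter.unusedSimpArgs false
set_option linter.unusedVariables false

noncomputable section

namespace String34

open PowerSeries

/-! Put `λ = ξ ^ 3` and `X = 1 / ξ`. Conjugating by `diag (ξ, 1, ξ⁻¹)` and by `𝒰` turns a normalized
formal solution into a power series `F` with `F(0) = 1` and `α F + X ^ 7 e(F) = F β`, where `e =
(1/3) X d/dX` (`isFormalSolution_iff`). Both `α` and `β` start with the cyclic matrix `cyc`, and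
every coefficient of `β` is a multiple of a power of `cyc`.

Uniqueness: the quotient `R` of two solutions satisfies `[β, R] + X ^ 7 e(R) = 0`. The projection
`piC` onto the commutant of `cyc` kills all commutators with `β`, so the Euler term forces `piC R_n
= 0` for `n ≥ 1`; the equation in degree `n` then puts `R_n` in the commutant, hence `R_n = 0`.
Existence: an explicit polynomial solves the equation modulo `X ^ 8`, and what remains is a
recursion without obstruction (`recSol_spec`). Each degree uses only finitely many ring operations
on polynomials in `(t, Q, P)`, which gives holomorphy.

The residue is `-tr [α dF F⁻¹]` in degree 7. Differentiating the equation for `F` and pairing it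
with the series `θ` of `Θ`, which commutes with `β`, rewrites it as `tr [dα · F θ F⁻¹]` in degree 14
(`residue_eq_dAlpha`). No derivative of `F` is left. Moreover `θ` is a polynomial in `cyc`, so only
the dressed matrix `K = F cyc F⁻¹` and its square enter. The matrix `K` is determined by `[α, K] + X
^ 7 e(K) = 0` and by the traces of `K`, `K ^ 2`, `K ^ 3` (`coeff_eq_of_dressed_eq`), so explicit
polynomials can be certified to be its coefficients (`coeff_dressed`). Since `dα` lives in degrees 2
to 6, degrees up to 12 suffice, and the formula for the tau-differential becomes a polynomial
identity (`trc_dAlpha`).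

For the last claim, `dω₀ = (1/2) dω_cla` because `d dG = 0`. On solutions of Hamilton's equations
the mixed terms of `dω_cla` cancel, and its `dt_k ∧ dt_l` terms vanish because the Hamiltonians are
in involution (`dHam_involution`) and their explicit time derivatives are symmetric
(`dHam_time_symm`). Only the symplectic form in the parameters survives. -/

abbrev M3 : Type := Matrix (Fin 3) (Fin 3) ℂ



/-! ### Power series with matrix coefficients, as matrices of formal series -/

/-- The scalar power series in position `(i, j)`. -/
def entry (i j : Fin 3) (f : M3⟦X⟧) : ℂ⟦X⟧ := PowerSeries.mk fun k => coeff k f i j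

/-- Power series in `X = 1 / ξ` with matrix coefficients, as matrices of formal series. -/
def toMat : M3⟦X⟧ →+* Mat where
  toFun f := Matrix.of fun i j => HahnSeries.ofPowerSeries ℤ ℂ (entry i j f)
  map_one' := by
    ext1 i j
    have : entry i j 1 = if i = j then 1 else 0 := by
      ext n
      by_cases hn : n = 0 <;> by_cases hij : i = j <;>
        simp [entry, coeff_one, hn, hij]
    simp only [Matrix.of_apply, this, Matrix.one_apply]
    split_ifs <;> simp
  map_zero' := by
    ext1 i j
    have : entry i j 0 = 0 := by ext n; simp [entry]
    simp [this]
  map_add' f g := by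
    ext1 i j
    have : entry i j (f + g) = entry i j f + entry i j g := by ext n; simp [entry]
    simp [this]
  map_mul' f g := by
    ext1 i j
    have : entry i j (f * g) = ∑ l, entry i l f * entry l j g := by
      ext n
      simp only [entry, coeff_mk, coeff_mul, Matrix.sum_apply, Matrix.mul_apply, map_sum]
      rw [Finset.sum_comm]
    simp [this, Matrix.mul_apply]

lemma toMat_apply (f : M3⟦X⟧) (i j : Fin 3) :
    toMat f i j = HahnSeries.ofPowerSeries ℤ ℂ (entry i j f) := rfl

lemma toMat_injective : Function.Injective toMat := by
  intro f g h
  ext n i j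
  have h1 : entry i j f = entry i j g :=
    HahnSeries.ofPowerSeries_injective (by rw [← toMat_apply, ← toMat_apply, h])
  simpa [entry] using congrArg (coeff n) h1

lemma seriesOf_eq (Φ : ℕ → M3) : seriesOf Φ = toMat (PowerSeries.mk Φ) := by
  ext1 i j
  simp [seriesOf, toMat_apply, entry]

lemma toMat_C (A : M3) : toMat (C A) = A.map cst := by
  ext1 i j
  have : entry i j (C A) = PowerSeries.C (A i j) := by
    ext n
    simp only [entry, coeff_mk, coeff_C]
    split_ifs <;> simp
  simp [toMat_apply, this, cst]

lemma toMat_X_pow (n : ℕ) : toMat (X ^ n) = Matrix.diagonal fun _ => xi (-n) := by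
  ext1 i j
  have : entry i j (X ^ n) = if i = j then X ^ n else 0 := by
    ext m
    by_cases hn : m = n <;> by_cases hij : i = j <;>
      simp [entry, coeff_X_pow, hn, hij]
  simp only [toMat_apply, this, Matrix.diagonal_apply, xi, neg_neg]
  split_ifs <;> simp

lemma coeff_toMat (f : M3⟦X⟧) (i j : Fin 3) (n : ℕ) :
    (toMat f i j).coeff n = coeff n f i j := by
  rw [toMat_apply, HahnSeries.ofPowerSeries_apply_coeff]
  simp [entry]

lemma coeff_toMat_of_neg (f : M3⟦X⟧) (i j : Fin 3) {n : ℤ} (hn : n < 0) :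
    (toMat f i j).coeff n = 0 := by
  rw [toMat_apply, HahnSeries.ofPowerSeries_apply]
  apply HahnSeries.embDomain_of_notMem_range
  rintro ⟨m, hm⟩
  simp at hm
  omega

/-- The derivation `-ξ ^ (-4) d/dλ · ξ ^ 7`, that is `(1 / 3) X d/dX`. -/
def euler (F : M3⟦X⟧) : M3⟦X⟧ := PowerSeries.mk fun n => ((n : ℂ) / 3) • coeff n F

@[simp] lemma coeff_euler (F : M3⟦X⟧) (n : ℕ) :
    coeff n (euler F) = ((n : ℂ) / 3) • coeff n F := by simp [euler]

lemma euler_mul (F G : M3⟦X⟧) : euler (F * G) = euler F * G + F * euler G := by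
  ext1 n
  simp only [coeff_euler, coeff_mul, map_add, Finset.smul_sum, ← Finset.sum_add_distrib]
  refine Finset.sum_congr rfl fun p hp => ?_
  rw [← Finset.HasAntidiagonal.mem_antidiagonal.1 hp, Matrix.smul_mul, Matrix.mul_smul, ← add_smul]
  push_cast
  congr 1
  ring

@[simp] lemma euler_C (A : M3) : euler (C A) = 0 := by
  ext1 n
  rw [coeff_euler, coeff_C]
  split_ifs with h <;> simp [h]

@[simp] lemma euler_one : euler 1 = 0 := by
  rw [← map_one C, euler_C]

/-! ### The derivative with respect to `λ` -/

/-- This is `d/dλ ξ^(-k) = -(k/3) ξ^(-k-3)` with `k = n - 3`. -/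
lemma coeff_dLambda (f : LaurentSeries ℂ) (n : ℤ) :
    (dLambda f).coeff n = -((n - 3 : ℂ) / 3) * f.coeff (n - 3) := by
  have h : (dLambda f).coeff n = -(1 / 3) * (LaurentSeries.derivative ℂ f).coeff (n - 4) := by
    rw [dLambda, mul_assoc, cst, HahnSeries.C_mul_eq_smul, HahnSeries.coeff_smul, xi, neg_neg,
      HahnSeries.coeff_single_mul, one_mul, smul_eq_mul]
  rw [h, LaurentSeries.derivative_apply, LaurentSeries.hasseDeriv_coeff]
  have : n - 4 + ((1 : ℕ) : ℤ) = n - 3 := by push_cast; ring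
  rw [this, Ring.choose_one_right, zsmul_eq_mul]
  push_cast
  ring

lemma coeff_xi_mul (m n : ℤ) (f : LaurentSeries ℂ) : (xi m * f).coeff n = f.coeff (n + m) := by
  rw [xi, HahnSeries.coeff_single_mul, one_mul, sub_neg_eq_add]

lemma coeff_cst_mul (c : ℂ) (n : ℤ) (f : LaurentSeries ℂ) :
    (cst c * f).coeff n = c * f.coeff n := by
  rw [cst, HahnSeries.C_mul_eq_smul, HahnSeries.coeff_smul, smul_eq_mul]

lemma dLambda_add (f g : LaurentSeries ℂ) : dLambda (f + g) = dLambda f + dLambda g := by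
  ext n
  simp only [coeff_dLambda, HahnSeries.coeff_add, mul_add]

@[simp] lemma dLambda_zero : dLambda 0 = 0 := by
  ext n
  simp [coeff_dLambda]

lemma dLambda_cst_mul (c : ℂ) (f : LaurentSeries ℂ) :
    dLambda (cst c * f) = cst c * dLambda f := by
  ext n
  simp only [coeff_dLambda, coeff_cst_mul]
  ring

lemma dLambda_xi_mul (m : ℤ) (f : LaurentSeries ℂ) :
    dLambda (xi m * f) = cst (m / 3) * xi (-3) * (xi m * f) + xi m * dLambda f := by
  ext n
  rw [mul_assoc]
  simp only [coeff_dLambda, coeff_cst_mul, coeff_xi_mul, HahnSeries.coeff_add]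
  have : n + m - 3 = n - 3 + m := by ring
  have h2 : n + -3 + m = n - 3 + m := by ring
  rw [this, h2]
  push_cast
  ring

lemma xi_mul (m n : ℤ) : xi m * xi n = xi (m + n) := by
  simp [xi, add_comm]

lemma xi_zero : xi 0 = 1 := by simp [xi]

lemma dLambda_xi (m : ℤ) : dLambda (xi m) = cst (m / 3) * xi (m - 3) := by
  have h1 : dLambda 1 = 0 := by
    ext n
    rw [coeff_dLambda, HahnSeries.coeff_one]
    split_ifs with h
    · have : (n : ℂ) - 3 = 0 := by exact_mod_cast h
      simp [this]
    · simp
  have := dLambda_xi_mul m 1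
  rw [h1, mul_zero, add_zero, mul_one, mul_assoc, xi_mul] at this
  rw [this, neg_add_eq_sub]

/-- The factor `ξ ^ 4` is the growth of the connection matrix after conjugation. Dividing by it
turns the shift by 3 degrees in `d/dλ` into a shift by 7, the irregularity seen by the rest of the
argument. -/
lemma map_dLambda_toMat (F : M3⟦X⟧) :
    (toMat F).map dLambda = xi 4 • toMat (-(X ^ 7 * euler F)) := by
  ext1 i j
  simp only [Matrix.map_apply, Matrix.smul_apply, smul_eq_mul]
  ext n
  rw [coeff_dLambda, coeff_xi_mul]
  rcases lt_or_ge n 3 with h | h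
  · rw [coeff_toMat_of_neg _ _ _ (by omega : n - 3 < 0)]
    rcases lt_or_ge (n + 4) 0 with h' | h'
    · rw [coeff_toMat_of_neg _ _ _ h']; simp
    · obtain ⟨m, hm⟩ := Int.eq_ofNat_of_zero_le h'
      -- Here `n < 3`, so the degree `n + 4` is below 7 and the factor `X ^ 7` leaves nothing.
      rw [hm, coeff_toMat, map_neg, coeff_X_pow_mul', if_neg (by omega)]
      simp
  · obtain ⟨m, hm⟩ := Int.eq_ofNat_of_zero_le (by omega : 0 ≤ n - 3)
    obtain rfl : n = m + 3 := by omega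
    have h1 : (m : ℤ) + 3 + 4 = ((m + 7 : ℕ) : ℤ) := by push_cast; ring
    rw [hm, h1, coeff_toMat, coeff_toMat, map_neg, coeff_X_pow_mul]
    simp

/-! ### Graded matrices -/

/-- Diagonal matrices. -/
def g0 (a b c : ℂ) : M3 := !![a, 0, 0; 0, b, 0; 0, 0, c]
/-- Matrices supported where the cyclic permutation matrix is. -/
def g1 (a b c : ℂ) : M3 := !![0, 0, a; b, 0, 0; 0, c, 0]
/-- Matrices supported where the square of the cyclic permutation matrix is. -/
def g2 (a b c : ℂ) : M3 := !![0, a, 0; 0, 0, b; c, 0, 0]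

section graded
variable (a b c a' b' c' s : ℂ)
-- The three supports form a grading by `ℤ/3`, with `g_k` a diagonal matrix times `cyc ^ k`. The
-- connection depends on `λ = ξ ^ 3` only, so the coefficient of degree `n` of `α` has class `1 - n`
-- and that of a solution may be sought in class `-n`. Matrix identities thus reduce to three scalar
-- ones in each degree.
lemma g0_mul_g0 : g0 a b c * g0 a' b' c' = g0 (a * a') (b * b') (c * c') := by
  simp [g0]
lemma g0_mul_g1 : g0 a b c * g1 a' b' c' = g1 (a * a') (b * b') (c * c') := by
  simp [g0, g1]
lemma g0_mul_g2 : g0 a b c * g2 a' b' c' = g2 (a * a') (b * b') (c * c') := by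
  simp [g0, g2]
lemma g1_mul_g0 : g1 a b c * g0 a' b' c' = g1 (a * c') (b * a') (c * b') := by
  simp [g0, g1]
lemma g1_mul_g1 : g1 a b c * g1 a' b' c' = g2 (a * c') (b * a') (c * b') := by
  simp [g2, g1]
lemma g1_mul_g2 : g1 a b c * g2 a' b' c' = g0 (a * c') (b * a') (c * b') := by
  simp [g0, g1, g2]
lemma g2_mul_g0 : g2 a b c * g0 a' b' c' = g2 (a * b') (b * c') (c * a') := by
  simp [g0, g2]
lemma g2_mul_g1 : g2 a b c * g1 a' b' c' = g0 (a * b') (b * c') (c * a') := by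
  simp [g0, g1, g2]
lemma g2_mul_g2 : g2 a b c * g2 a' b' c' = g1 (a * b') (b * c') (c * a') := by
  simp [g1, g2]
lemma g0_add : g0 a b c + g0 a' b' c' = g0 (a + a') (b + b') (c + c') := by simp [g0]
lemma g1_add : g1 a b c + g1 a' b' c' = g1 (a + a') (b + b') (c + c') := by simp [g1]
lemma g2_add : g2 a b c + g2 a' b' c' = g2 (a + a') (b + b') (c + c') := by simp [g2]
lemma g0_sub : g0 a b c - g0 a' b' c' = g0 (a - a') (b - b') (c - c') := by
  ext i j; fin_cases i <;> fin_cases j <;> simp [g0]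
lemma g1_sub : g1 a b c - g1 a' b' c' = g1 (a - a') (b - b') (c - c') := by
  ext i j; fin_cases i <;> fin_cases j <;> simp [g1]
lemma g2_sub : g2 a b c - g2 a' b' c' = g2 (a - a') (b - b') (c - c') := by
  ext i j; fin_cases i <;> fin_cases j <;> simp [g2]
lemma g0_smul : s • g0 a b c = g0 (s * a) (s * b) (s * c) := by simp [g0]
lemma g1_smul : s • g1 a b c = g1 (s * a) (s * b) (s * c) := by simp [g1]
lemma g2_smul : s • g2 a b c = g2 (s * a) (s * b) (s * c) := by simp [g2]
lemma g0_trace : (g0 a b c).trace = a + b + c := by simp [g0, Matrix.trace_fin_three]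
lemma g1_trace : (g1 a b c).trace = 0 := by simp [g1, Matrix.trace_fin_three]
lemma g2_trace : (g2 a b c).trace = 0 := by simp [g2, Matrix.trace_fin_three]
end graded

lemma g0_one : g0 1 1 1 = 1 := by
  rw [g0, Matrix.one_fin_three]

/-- The cyclic permutation matrix. -/
def cyc : M3 := g1 1 1 1

lemma cyc_mul_cyc : cyc * cyc = g2 1 1 1 := by simp [cyc, g1_mul_g1]

/-! ### The system over `ℂ`, in the frame of the cyclic permutation matrix -/

/-- Coefficients of `ξ ^ (-4) (D⁻¹ L D - Δ₃ / λ)`, where `D = diag (ξ, 1, ξ ^ (-1))`. -/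
def alphaCoeff (t Q P : Fin 3 → ℂ) : ℕ → M3
  | 0 => cyc
  | 2 => g2 (2 * t 2 + 1 / 4 * Q 0) (2 * t 2 + 1 / 4 * Q 0) (L0 t Q P 2 0)
  | 3 => g1 (-Q 1) (L0 t Q P 1 0) (L0 t Q P 2 1)
  | 4 => g0 (L0 t Q P 0 0) (L0 t Q P 1 1) (L0 t Q P 2 2)
  | 5 => g2 (L0 t Q P 0 1) (L0 t Q P 1 2) 0
  | 6 => g1 (L0 t Q P 0 2) 0 0
  | 7 => g0 (-(1 / 3)) 0 (1 / 3)
  | _ => 0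

/-- The series `ξ ^ (-4) (D⁻¹ L D - Δ₃ / λ)`. -/
def alpha (t Q P : Fin 3 → ℂ) : M3⟦X⟧ := PowerSeries.mk (alphaCoeff t Q P)

/-- Coefficients of `ξ ^ (-4) 𝒰 (dΘ/dλ) 𝒰⁻¹`. -/
def betaCoeff (t : Fin 3 → ℂ) : ℕ → M3
  | 0 => cyc
  | 2 => (5 / 3 * t 2) • (cyc * cyc)
  | 5 => (2 / 3 * t 1) • (cyc * cyc)
  | 6 => (1 / 3 * t 0) • cyc
  | _ => 0

/-- The series `ξ ^ (-4) 𝒰 (dΘ/dλ) 𝒰⁻¹`. -/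
def beta (t : Fin 3 → ℂ) : M3⟦X⟧ := PowerSeries.mk (betaCoeff t)

lemma alpha_eq (t Q P : Fin 3 → ℂ) : alpha t Q P = C cyc + C (alphaCoeff t Q P 2) * X ^ 2
    + C (alphaCoeff t Q P 3) * X ^ 3 + C (alphaCoeff t Q P 4) * X ^ 4
    + C (alphaCoeff t Q P 5) * X ^ 5 + C (alphaCoeff t Q P 6) * X ^ 6
    + C (alphaCoeff t Q P 7) * X ^ 7 := by
  ext1 n
  simp only [alpha, coeff_mk, map_add, coeff_C_mul, coeff_X_pow, coeff_C]
  match n with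
  | 0 => simp [alphaCoeff]
  | 1 => simp [alphaCoeff]
  | 2 => simp
  | 3 => simp
  | 4 => simp
  | 5 => simp
  | 6 => simp
  | 7 => simp
  | n + 8 => simp [alphaCoeff]

lemma beta_eq (t : Fin 3 → ℂ) : beta t = C cyc + C ((5 / 3 * t 2) • (cyc * cyc)) * X ^ 2
    + C ((2 / 3 * t 1) • (cyc * cyc)) * X ^ 5 + C ((1 / 3 * t 0) • cyc) * X ^ 6 := by
  ext1 n
  simp only [beta, coeff_mk, map_add, coeff_C_mul, coeff_X_pow, coeff_C]
  match n with
  | 0 => simp [betaCoeff]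
  | 1 => simp [betaCoeff]
  | 2 => simp [betaCoeff]
  | 3 => simp [betaCoeff]
  | 4 => simp [betaCoeff]
  | 5 => simp [betaCoeff]
  | 6 => simp [betaCoeff]
  | n + 7 => simp [betaCoeff]

/-- `𝔊 = g S` with `F = 𝒰 S 𝒰⁻¹` is a formal solution. -/
def IsSol (t Q P : Fin 3 → ℂ) (F : M3⟦X⟧) : Prop :=
  coeff 0 F = 1 ∧ alpha t Q P * F + X ^ 7 * euler F = F * beta t

/-! ### Cube roots of unity and the diagonalization of the cyclic matrix -/

lemma omega3_pow_three : omega3 ^ 3 = 1 := by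
  rw [omega3, ← Complex.exp_nat_mul, ← Complex.exp_two_pi_mul_I]
  congr 1
  push_cast
  ring

lemma omega3_inv : omega3⁻¹ = omega3 ^ 2 :=
  inv_eq_of_mul_eq_one_right (by rw [← omega3_pow_three]; ring)

lemma omega3_sum : 1 + omega3 + omega3 ^ 2 = 0 := by
  have h : omega3 ≠ 1 := by
    have := (Complex.isPrimitiveRoot_exp 3 (by norm_num)).ne_one (by norm_num)
    rwa [show ((3 : ℕ) : ℂ) = 3 by norm_num] at this
  have h2 : (omega3 - 1) * (1 + omega3 + omega3 ^ 2) = 0 := by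
    linear_combination omega3_pow_three
  exact (mul_eq_zero.1 h2).resolve_left (sub_ne_zero.2 h)

/-- The inverse of `𝒰`. -/
def matUInv : M3 :=
  (Complex.I / (Real.sqrt 3 : ℂ))⁻¹ • (1 / 3 : ℂ) •
    !![1, 1, 1; omega3 ^ 2, 1, omega3; omega3, 1, omega3 ^ 2]

lemma matU_mul_inv : matU * matUInv = 1 := by
  have hc : Complex.I / (Real.sqrt 3 : ℂ) ≠ 0 := by
    refine div_ne_zero Complex.I_ne_zero ?_
    rw [Complex.ofReal_ne_zero]
    positivity
  rw [matU, matUInv, Matrix.smul_mul, Matrix.mul_smul, smul_smul, mul_inv_cancel₀ hc, one_smul,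
    Matrix.mul_smul, Matrix.mul_fin_three, Matrix.one_fin_three, Matrix.smul_of]
  have h3 := omega3_pow_three
  have h1 := omega3_sum
  ext i j
  fin_cases i <;> fin_cases j <;> simp
  · linear_combination (2 / 3) * h3
  · linear_combination h1
  · linear_combination h1 + omega3 * h3
  · linear_combination h1
  · norm_num
  · linear_combination h1
  · linear_combination h1 + omega3 * h3
  · linear_combination h1
  · linear_combination (2 / 3) * h3

lemma matUInv_mul : matUInv * matU = 1 := mul_eq_one_comm.1 matU_mul_inv

/-- The matrix `diag (1, ω, ω²)`. -/
def matOmega : M3 := g0 1 omega3 (omega3 ^ 2)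

/-- The columns of `𝒰` are eigenvectors of `cyc` for the eigenvalues `1, ω, ω²`. This is what allows
the diagonal exponent `Θ` to be replaced by a polynomial in `cyc`. -/
lemma matU_mul_omega : matU * matOmega = cyc * matU := by
  have h3 := omega3_pow_three
  rw [matU, matOmega, cyc, g0, g1, Matrix.smul_mul, Matrix.mul_smul, Matrix.mul_fin_three,
    Matrix.mul_fin_three]
  congr 1
  ext i j
  fin_cases i <;> fin_cases j <;> simp
  · ring
  · linear_combination omega3 * h3
  · linear_combination h3
  · linear_combination h3

/-! ### Passage from the differential system to an equation for power series -/

/-- `diag (ξ, 1, ξ ^ (-1))`. -/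
def dXi : Mat := Matrix.diagonal ![xi 1, 1, xi (-1)]

lemma mul_smul_mat (c : LaurentSeries ℂ) (A B : Mat) : A * (c • B) = c • (A * B) := by
  ext1 i j
  simp only [Matrix.mul_apply, Matrix.smul_apply, smul_eq_mul, Finset.mul_sum, mul_left_comm]

lemma smul_mul_mat (c : LaurentSeries ℂ) (A B : Mat) : (c • A) * B = c • (A * B) := by
  ext1 i j
  simp only [Matrix.mul_apply, Matrix.smul_apply, smul_eq_mul, Finset.mul_sum, mul_assoc]

lemma smul_add_mat (c : LaurentSeries ℂ) (A B : Mat) : c • (A + B) = c • A + c • B := by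
  ext1 i j
  simp only [Matrix.add_apply, Matrix.smul_apply, smul_eq_mul, mul_add]

lemma xi_one_ne_zero : xi 1 ≠ 0 := by
  simp [xi]

lemma xi_nat (n : ℕ) : xi n = xi 1 ^ n := by
  induction n with
  | zero => simp [xi_zero]
  | succ n ih => rw [pow_succ, ← ih, xi_mul]; push_cast; rfl

lemma xi_neg_nat (n : ℕ) : xi (-n) = (xi 1)⁻¹ ^ n := by
  rw [inv_pow]
  refine eq_inv_of_mul_eq_one_left ?_
  rw [← xi_nat, xi_mul, neg_add_cancel, xi_zero]

lemma dXi_mul_inv : dXi * Matrix.diagonal ![xi (-1), 1, xi 1] = 1 := by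
  rw [dXi, Matrix.diagonal_mul_diagonal, ← Matrix.diagonal_one]
  congr 1
  ext1 i
  fin_cases i <;> simp [xi_mul, xi_zero]

/-- Conjugation by `dXi` shifts the entries so that the nilpotent leading term and the two
subdiagonal entries of the `λ`-coefficient all acquire order `ξ ^ 4` and together form `cyc`. The
summand `Δ₃/λ` is split off because it will cancel the logarithmic derivative of `dXi`. -/
lemma connection_mul_dXi (t Q P : Fin 3 → ℂ) :
    connection t Q P * dXi = dXi * (xi 4 • toMat (alpha t Q P) + deltaOverLambda) := by
  have h := xi_one_ne_zero
  have e1 := xi_neg_nat 1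
  have e2 := xi_neg_nat 2
  have e3 := xi_neg_nat 3
  have e4 := xi_neg_nat 4
  have e5 := xi_neg_nat 5
  have e6 := xi_neg_nat 6
  have e7 := xi_neg_nat 7
  have f3 := xi_nat 3
  have f4 := xi_nat 4
  have f6 := xi_nat 6
  push_cast at e1 e2 e3 e4 e5 e6 e7 f3 f4 f6
  ext1 i j
  simp only [alpha_eq, map_add, map_mul, toMat_C, toMat_X_pow, connection, dXi, deltaOverLambda,
    Matrix.mul_diagonal, Matrix.diagonal_mul, Matrix.add_apply, Matrix.smul_apply,
    Matrix.map_apply, smul_eq_mul, Nat.cast_ofNat, e2, e3, e4, e5, e6, e7, e1, f3, f4, f6,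
    alphaCoeff, cyc, L1]
  -- Only the powers of `ξ` matter here; the entries of the constant term can be arbitrary.
  generalize L0 t Q P = A
  fin_cases i <;> fin_cases j <;> simp [g0, g1, g2] <;> field_simp <;> ring

/-- The matrix of power series `𝒰 S 𝒰⁻¹`. -/
def conjU (Φ : ℕ → M3) : M3⟦X⟧ := C matU * PowerSeries.mk Φ * C matUInv

lemma gauge_mul (Φ : ℕ → M3) :
    gauge * seriesOf Φ = dXi * (toMat (conjU Φ) * matU.map cst) := by
  rw [gauge, seriesOf_eq, ← toMat_C, mul_assoc, ← map_mul, ← map_mul, conjU, mul_assoc _ (C matUInv),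
    ← map_mul, matUInv_mul, map_one, mul_one, dXi]

lemma matU_mul_omega_inv : matU * (matOmega * matOmega) = cyc * cyc * matU := by
  rw [← mul_assoc, matU_mul_omega, mul_assoc, matU_mul_omega, mul_assoc]

/-- Since `ω⁻¹ = ω²`, the terms with `t₅` and `t₂` carry the square of `matOmega`; the exponents 7,
5, 2, 1 of `ξ` become the degrees 0, 2, 5, 6 once `ξ ^ 4` is extracted. -/
lemma map_dLambda_theta (t : Fin 3 → ℂ) :
    (theta t).map dLambda = xi 4 • toMat (C matOmega
      + C ((5 / 3 * t 2) • (matOmega * matOmega)) * X ^ 2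
      + C ((2 / 3 * t 1) • (matOmega * matOmega)) * X ^ 5
      + C ((1 / 3 * t 0) • matOmega) * X ^ 6) := by
  have h := xi_one_ne_zero
  have e1 := xi_neg_nat 1
  have e2 := xi_neg_nat 2
  have e5 := xi_neg_nat 5
  have e6 := xi_neg_nat 6
  have f2 := xi_nat 2
  have f4 := xi_nat 4
  push_cast at e1 e2 e5 e6 f2 f4
  have key (j : ℕ) : dLambda (cst (3 / 7 * omega3 ^ j) * xi 7
      + cst (omega3⁻¹ ^ j * t 2) * xi 5 + cst (omega3⁻¹ ^ j * t 1) * xi 2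
      + cst (omega3 ^ j * t 0) * xi 1) = xi 4 * (cst (omega3 ^ j)
        + cst (5 / 3 * t 2 * omega3⁻¹ ^ j) * xi (-2)
        + cst (2 / 3 * t 1 * omega3⁻¹ ^ j) * xi (-5)
        + cst (1 / 3 * t 0 * omega3 ^ j) * xi (-6)) := by
    have c1 : cst (3 / 7 * omega3 ^ j) * cst (7 / 3) = cst (omega3 ^ j) := by
      rw [← map_mul]; congr 1; ring
    have c2 : cst (5 / 3 * t 2 * omega3⁻¹ ^ j) = cst (omega3⁻¹ ^ j * t 2) * cst (5 / 3) := by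
      rw [← map_mul]; congr 1; ring
    have c3 : cst (2 / 3 * t 1 * omega3⁻¹ ^ j) = cst (omega3⁻¹ ^ j * t 1) * cst (2 / 3) := by
      rw [← map_mul]; congr 1; ring
    have c4 : cst (1 / 3 * t 0 * omega3 ^ j) = cst (omega3 ^ j * t 0) * cst (1 / 3) := by
      rw [← map_mul]; congr 1; ring
    rw [← c1, c2, c3, c4]
    simp only [dLambda_add, dLambda_cst_mul, dLambda_xi]
    norm_num
    rw [e1, e2, e5, e6, f2, f4]
    field_simp
  have h3 := omega3_pow_three
  ext1 i j
  rw [map_add toMat, map_add toMat, map_add toMat, map_mul toMat, map_mul toMat, map_mul toMat]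
  simp only [theta, toMat_C, toMat_X_pow, Matrix.map_apply,
    Matrix.mul_diagonal, Matrix.add_apply, Matrix.smul_apply, smul_eq_mul, Nat.cast_ofNat]
  by_cases hij : i = j
  · subst hij
    rw [Matrix.diagonal_apply_eq, key, omega3_inv, matOmega, g0_mul_g0]
    fin_cases i <;> simp [g0, sq]
  · rw [Matrix.diagonal_apply_ne _ hij, dLambda_zero, matOmega, g0_mul_g0]
    fin_cases i <;> fin_cases j <;> first | exact absurd rfl hij | simp [g0]

lemma matU_mul_dTheta (t : Fin 3 → ℂ) :
    matU.map cst * (theta t).map dLambda = xi 4 • (toMat (beta t) * matU.map cst) := by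
  rw [map_dLambda_theta, mul_smul_mat, ← toMat_C, ← map_mul, ← map_mul, beta_eq]
  congr 2
  simp only [mul_add, add_mul, ← mul_assoc, ← map_mul]
  simp only [mul_assoc _ (X ^ _) (C _), X_pow_mul]
  simp only [← mul_assoc (C _) (C _), ← map_mul, Matrix.smul_mul, Matrix.mul_smul, matU_mul_omega,
    matU_mul_omega_inv]

lemma map_dLambda_mul_cst (A : Mat) (B : M3) :
    (A * B.map cst).map dLambda = A.map dLambda * B.map cst := by
  ext1 i j
  simp only [Matrix.map_apply, Matrix.mul_apply, Fin.sum_univ_three, dLambda_add]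
  simp only [mul_comm _ (cst _), dLambda_cst_mul]

lemma map_dLambda_dXi_mul (A : Mat) :
    (dXi * A).map dLambda = dXi * (deltaOverLambda * A + A.map dLambda) := by
  ext1 i j
  simp only [Matrix.map_apply, dXi, deltaOverLambda, Matrix.diagonal_mul, Matrix.add_apply]
  fin_cases i
  · simp [dLambda_xi_mul]; ring
  · simp
  · simp [dLambda_xi_mul]; ring

/-- Differentiating `dXi` produces `Δ₃/λ`, which cancels the same term in `connection_mul_dXi`. The
invertible factors `dXi`, `𝒰` and `ξ ^ 4` can then be removed from both sides. -/
lemma isFormalSolution_iff (t Q P : Fin 3 → ℂ) (Φ : ℕ → M3) :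
    IsFormalSolution t Q P Φ ↔ IsSol t Q P (conjU Φ) := by
  have h0 : coeff 0 (conjU Φ) = matU * Φ 0 * matUInv := by
    simp [conjU]
  have h0' : Φ 0 = 1 ↔ coeff 0 (conjU Φ) = 1 := by
    rw [h0]
    constructor
    · intro h; rw [h, mul_one, matU_mul_inv]
    · intro h
      calc Φ 0 = matUInv * matU * Φ 0 * (matUInv * matU) := by rw [matUInv_mul]; simp
        _ = matUInv * (matU * Φ 0 * matUInv) * matU := by noncomm_ring
        _ = 1 := by rw [h, mul_one, matUInv_mul]
  rw [IsFormalSolution, IsSol, h0']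
  refine and_congr_right fun _ => ?_
  set F := conjU Φ
  rw [gauge_mul, map_dLambda_dXi_mul, map_dLambda_mul_cst, map_dLambda_toMat, ← mul_assoc (connection t Q P),
    connection_mul_dXi, mul_assoc dXi, mul_assoc (toMat F), matU_mul_dTheta, mul_assoc dXi, ← mul_add]
  have hD : ∀ A B : Mat, dXi * A = dXi * B ↔ A = B := fun A B =>
    ⟨fun h => by
      have := congrArg (Matrix.diagonal ![xi (-1), 1, xi 1] * ·) h
      simpa only [← mul_assoc, mul_eq_one_comm.1 dXi_mul_inv, one_mul] using this, fun h => by rw [h]⟩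
  have hU : ∀ A B : Mat, A * matU.map cst = B * matU.map cst ↔ A = B := fun A B =>
    ⟨fun h => by
      have := congrArg (· * matUInv.map cst) h
      simpa only [mul_assoc, ← toMat_C, ← map_mul, matU_mul_inv, map_one, mul_one] using this,
      fun h => by rw [h]⟩
  have hx : ∀ A B : Mat, xi 4 • A = xi 4 • B ↔ A = B := fun A B =>
    ⟨fun h => by
      have := congrArg (xi (-4) • ·) h
      simpa only [smul_smul, xi_mul, neg_add_cancel, xi_zero, one_smul] using this,
      fun h => by rw [h]⟩
  rw [hD]
  have e : deltaOverLambda * (toMat F * matU.map cst)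
      + xi 4 • toMat (-(X ^ 7 * euler F)) * matU.map cst
      + toMat F * xi 4 • (toMat (beta t) * matU.map cst)
      = (deltaOverLambda * toMat F + xi 4 • (toMat (F * beta t - X ^ 7 * euler F))) * matU.map cst := by
    rw [mul_smul_mat, ← mul_assoc, ← mul_assoc, ← smul_mul_mat, ← add_mul, ← add_mul, add_assoc,
      ← smul_add_mat, ← map_mul, ← map_add, neg_add_eq_sub]
  rw [e, ← mul_assoc, hU, add_mul, add_comm, add_left_inj, smul_mul_mat, hx, ← map_mul,
    toMat_injective.eq_iff, sub_eq_iff_eq_add, eq_comm]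

lemma deltaOverLambda_mul_dXi : deltaOverLambda * dXi = dXi * deltaOverLambda := by
  rw [deltaOverLambda, dXi, Matrix.diagonal_mul_diagonal, Matrix.diagonal_mul_diagonal]
  simp only [mul_comm]

lemma resInfty_trace_xi (Y : M3⟦X⟧) :
    resInfty (Matrix.trace (xi 4 • toMat Y)) = -(coeff 7 Y).trace := by
  have : ((3 : ℤ) + 4) = ((7 : ℕ) : ℤ) := by norm_num
  simp only [resInfty, Matrix.trace_fin_three, Matrix.smul_apply, smul_eq_mul,
    HahnSeries.coeff_add, coeff_xi_mul, this, coeff_toMat]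

/-- The residue in the definition of the extended tau-differential, in the constant frame. -/
lemma residue_eq (t Q P : Fin 3 → ℂ) (Φ dΦ : ℕ → M3) (G : M3⟦X⟧) (hG : conjU Φ * G = 1) :
    resInfty (Matrix.trace (connection t Q P *
        (gauge * seriesOf dΦ * (gauge * seriesOf Φ)⁻¹)))
      - resInfty (Matrix.trace (deltaOverLambda *
        (gauge * seriesOf dΦ * (gauge * seriesOf Φ)⁻¹)))
      = -(coeff 7 (alpha t Q P * (conjU dΦ * G))).trace := by
  set D' : Mat := Matrix.diagonal ![xi (-1), 1, xi 1]
  have hDD : dXi * D' = 1 := dXi_mul_inv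
  have hU : matU.map cst * matUInv.map cst = (1 : Mat) := by
    rw [← toMat_C, ← toMat_C, ← map_mul, ← map_mul, matU_mul_inv, map_one, map_one]
  have hFG : toMat (conjU Φ) * toMat G = 1 := by rw [← map_mul, hG, map_one]
  have hinv : (gauge * seriesOf Φ)⁻¹ = matUInv.map cst * (toMat G * D') := by
    apply Matrix.inv_eq_right_inv
    rw [gauge_mul]
    calc dXi * (toMat (conjU Φ) * matU.map cst) * (matUInv.map cst * (toMat G * D'))
        = dXi * (toMat (conjU Φ) * (matU.map cst * matUInv.map cst) * toMat G) * D' := by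
          noncomm_ring
      _ = 1 := by rw [hU, mul_one, hFG, mul_one, hDD]
  have h1 : gauge * seriesOf dΦ * (gauge * seriesOf Φ)⁻¹
      = dXi * toMat (conjU dΦ * G) * D' := by
    rw [hinv, gauge_mul, map_mul]
    calc dXi * (toMat (conjU dΦ) * matU.map cst) * (matUInv.map cst * (toMat G * D'))
        = dXi * (toMat (conjU dΦ) * (matU.map cst * matUInv.map cst) * toMat G) * D' := by
          noncomm_ring
      _ = _ := by rw [hU, mul_one]
  set Y := conjU dΦ * G
  have htr (A : Mat) : Matrix.trace (dXi * A * D') = Matrix.trace A := by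
    rw [Matrix.trace_mul_comm, ← mul_assoc, mul_eq_one_comm.1 hDD, one_mul]
  have h2 : connection t Q P * (dXi * toMat Y * D')
      = dXi * (xi 4 • toMat (alpha t Q P * Y) + deltaOverLambda * toMat Y) * D' := by
    rw [← mul_assoc, ← mul_assoc, connection_mul_dXi, mul_assoc dXi, add_mul, smul_mul_mat,
      ← map_mul]
  have h3 : deltaOverLambda * (dXi * toMat Y * D') = dXi * (deltaOverLambda * toMat Y) * D' := by
    rw [← mul_assoc, ← mul_assoc, deltaOverLambda_mul_dXi, mul_assoc dXi]
  have hres (f g : LaurentSeries ℂ) : resInfty (f + g) = resInfty f + resInfty g := by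
    simp [resInfty, add_comm]
  -- The two traces containing `Δ₃/λ` cancel, which is the purpose of the correction term in the
  -- tau-differential.
  rw [h1, h2, h3, htr, htr, Matrix.trace_add, hres, add_sub_cancel_right, resInfty_trace_xi]

/-! ### Projection onto the commutant of the cyclic matrix -/

lemma cyc_pow_three : cyc * cyc * cyc = 1 := by
  simp [cyc, g1_mul_g1, g2_mul_g1, g0_one]

lemma cyc_pow_three' : cyc * (cyc * cyc) = 1 := by
  rw [← mul_assoc, cyc_pow_three]

/-- The projection onto the commutant of `cyc` along the image of `[cyc, ·]`. -/
def piC (A : M3) : M3 := (1 / 3 : ℂ) • (A + cyc * A * (cyc * cyc) + cyc * cyc * A * cyc)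

/-- A right inverse of `[cyc, ·]` on the kernel of `piC`. -/
def adInv (A : M3) : M3 := (1 / 3 : ℂ) • (cyc * cyc * A - A * cyc * cyc)

lemma piC_add (A B : M3) : piC (A + B) = piC A + piC B := by
  simp only [piC, mul_add, add_mul, smul_add]
  abel

lemma piC_smul (s : ℂ) (A : M3) : piC (s • A) = s • piC A := by
  simp only [piC, Matrix.mul_smul, Matrix.smul_mul, ← smul_add]
  rw [smul_comm]

lemma piC_zero : piC 0 = 0 := by simp [piC]

lemma piC_sum {ι : Type*} (s : Finset ι) (f : ι → M3) : piC (∑ i ∈ s, f i) = ∑ i ∈ s, piC (f i) :=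
  map_sum (AddMonoidHom.mk' piC piC_add) f s

/-- As `cyc³ = 1`, `piC` is the average over conjugation by the cyclic group that `cyc` generates.
-/
lemma cyc_commutes_piC (A : M3) : cyc * piC A = piC A * cyc := by
  have h := cyc_pow_three
  simp only [piC, Matrix.mul_smul, Matrix.smul_mul]
  congr 1
  simp only [mul_add, add_mul, mul_assoc, cyc_pow_three', mul_one]
  simp only [← mul_assoc, h, one_mul]
  abel

lemma piC_of_commutes {A : M3} (hA : cyc * A = A * cyc) : piC A = A := by
  have h1 : cyc * A * (cyc * cyc) = A := by rw [hA, mul_assoc, cyc_pow_three', mul_one]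
  have h2 : cyc * cyc * A * cyc = A := by
    rw [mul_assoc cyc, hA, ← mul_assoc, hA, mul_assoc, mul_assoc, cyc_pow_three', mul_one]
  rw [piC, h1, h2, ← two_smul ℂ A]
  module

lemma piC_piC (A : M3) : piC (piC A) = piC A := piC_of_commutes (cyc_commutes_piC A)

/-- Averaging is linear over the commutant on both sides, so `B` can be pulled out of `piC`, and
what is left is the commutator of `B` with `piC A`, an element of the commutant. -/
lemma piC_commutator (A B : M3) (hB : cyc * B = B * cyc)
    (h : ∀ N : M3, cyc * N = N * cyc → B * N = N * B) : piC (B * A - A * B) = 0 := by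
  have h1 : piC (B * A) = B * piC A := by
    simp only [piC, Matrix.mul_smul, mul_add]
    congr 2
    · rw [← mul_assoc cyc, hB]
      simp only [mul_assoc]
    · have : cyc * cyc * B = B * (cyc * cyc) := by rw [mul_assoc, hB, ← mul_assoc, hB, mul_assoc]
      rw [← mul_assoc, this]
      simp only [mul_assoc]
  have h2 : piC (A * B) = piC A * B := by
    simp only [piC, Matrix.smul_mul, add_mul]
    congr 2
    · have : B * (cyc * cyc) = cyc * cyc * B := by rw [← mul_assoc, ← hB, mul_assoc, ← hB, mul_assoc]
      simp only [mul_assoc] at this ⊢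
      rw [this]
    · simp only [mul_assoc, hB]
  have h3 : piC (B * A - A * B) = piC (B * A) - piC (A * B) := by
    rw [sub_eq_add_neg, piC_add, ← neg_one_smul ℂ, piC_smul, neg_one_smul, sub_eq_add_neg]
  rw [h3, h1, h2, h _ (cyc_commutes_piC A), sub_self]

/-- By `cyc³ = 1`, the commutator of `cyc` with `cyc² A - A cyc²` is `2 A - cyc A cyc² - cyc² A cyc
= 3 A - 3 piC A`. -/
lemma commutator_adInv (A : M3) : cyc * adInv A - adInv A * cyc = A - piC A := by
  have h := cyc_pow_three
  simp only [adInv, piC, Matrix.mul_smul, Matrix.smul_mul]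
  simp only [mul_sub, sub_mul, mul_assoc, cyc_pow_three', mul_one]
  simp only [← mul_assoc, h, one_mul]
  module

lemma piC_adInv (A : M3) : piC (adInv A) = 0 := by
  have h := cyc_pow_three
  simp only [adInv, piC, Matrix.mul_smul, Matrix.smul_mul]
  simp only [mul_sub, sub_mul, mul_assoc, cyc_pow_three', mul_one]
  simp only [← mul_assoc, h, one_mul]
  module

lemma betaCoeff_commutes (t : Fin 3 → ℂ) (n : ℕ) {N : M3} (hN : cyc * N = N * cyc) :
    betaCoeff t n * N = N * betaCoeff t n := by
  have h2 : cyc * cyc * N = N * (cyc * cyc) := by rw [mul_assoc, hN, ← mul_assoc, hN, mul_assoc]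
  unfold betaCoeff
  split <;> simp [hN, h2]

lemma piC_commutator_beta (t : Fin 3 → ℂ) (n : ℕ) (A : M3) :
    piC (betaCoeff t n * A - A * betaCoeff t n) = 0 :=
  piC_commutator A _ (betaCoeff_commutes t n rfl).symm fun _ => betaCoeff_commutes t n

lemma piC_coeff_commutator (t : Fin 3 → ℂ) (N : M3⟦X⟧) (n : ℕ) :
    piC (coeff n (beta t * N - N * beta t)) = 0 := by
  have h : coeff n (N * beta t) = ∑ p ∈ Finset.HasAntidiagonal.antidiagonal n, coeff p.2 N * betaCoeff t p.1 := by
    rw [coeff_mul, ← Finset.Nat.sum_antidiagonal_swap]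
    simp [beta]
  rw [map_sub, h, coeff_mul, ← Finset.sum_sub_distrib, piC_sum]
  exact Finset.sum_eq_zero fun p _ => by rw [beta, coeff_mk, piC_commutator_beta]

/-! ### Uniqueness -/

/-- Each coefficient is controlled twice: its commutant component in degree `n + 7`, through the
Euler term, and the rest of it in degree `n`, through the commutator with the leading term `cyc`. -/
lemma eq_zero_of_commutator {t : Fin 3 → ℂ} {N : M3⟦X⟧} (h0 : coeff 0 N = 0)
    (h : beta t * N - N * beta t + X ^ 7 * euler N = 0) : N = 0 := by
  have hpi (n : ℕ) : piC (coeff n N) = 0 := by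
    have h1 := congrArg piC (congrArg (coeff (n + 7)) h)
    -- Applying `piC` in degree `n + 7` leaves `(n/3) piC N_n = 0`. This says nothing for `n = 0`,
    -- where the normalization is used instead.
    rw [map_add, piC_add, piC_coeff_commutator, zero_add, coeff_X_pow_mul, coeff_euler, piC_smul,
      map_zero, piC_zero] at h1
    rcases smul_eq_zero.1 h1 with h2 | h2
    · have : n = 0 := by simpa using h2
      rw [this, h0, piC_zero]
    · exact h2
  ext1 n
  rw [map_zero]
  induction n using Nat.strong_induction_on with
  | _ n ih =>
    have h1 := congrArg (coeff n) h
    have h2 : coeff n (X ^ 7 * euler N) = 0 := by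
      rw [coeff_X_pow_mul']
      split_ifs with h7
      · rw [coeff_euler, ih _ (by omega), smul_zero]
      · rfl
    have h3 : coeff n (beta t * N) = cyc * coeff n N := by
      rw [coeff_mul, Finset.sum_eq_single (0, n)]
      · simp [beta, betaCoeff]
      · rintro ⟨i, j⟩ hij hne
        have hij := Finset.HasAntidiagonal.mem_antidiagonal.1 hij
        rw [ih j (by rcases Nat.eq_zero_or_pos i with rfl | hi; · simp_all
                     · simp at hij; omega), mul_zero]
      · simp
    have h4 : coeff n (N * beta t) = coeff n N * cyc := by
      rw [coeff_mul, Finset.sum_eq_single (n, 0)]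
      · simp [beta, betaCoeff]
      · rintro ⟨j, i⟩ hij hne
        have hij := Finset.HasAntidiagonal.mem_antidiagonal.1 hij
        rw [ih j (by rcases Nat.eq_zero_or_pos i with rfl | hi; · simp_all
                     · simp at hij; omega), zero_mul]
      · simp
    rw [map_add, h2, add_zero, map_sub, h3, h4, map_zero, sub_eq_zero] at h1
    rw [← piC_of_commutes h1, hpi]

/-- The inverse of a series with constant coefficient `1`. -/
def sInv (F : M3⟦X⟧) : M3⟦X⟧ := invOfUnit F 1

lemma mul_sInv {F : M3⟦X⟧} (h : coeff 0 F = 1) : F * sInv F = 1 :=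
  mul_invOfUnit F 1 (by simpa using h)

lemma sInv_mul {F : M3⟦X⟧} (h : coeff 0 F = 1) : sInv F * F = 1 :=
  invOfUnit_mul F 1 (by simpa using h)

lemma coeff_zero_sInv (F : M3⟦X⟧) : coeff 0 (sInv F) = 1 := by
  rw [sInv, coeff_invOfUnit, if_pos rfl, inv_one, Units.val_one]

lemma coeff_zero_mul (F G : M3⟦X⟧) : coeff 0 (F * G) = coeff 0 F * coeff 0 G := by
  simp [coeff_mul]

/-- The quotient `R = F⁻¹ G` satisfies a homogeneous equation in which `α` no longer appears, and so
does `R - 1`, because constants commute with `β` and are killed by `euler`. -/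
lemma IsSol.unique {t Q P : Fin 3 → ℂ} {F G : M3⟦X⟧} (hF : IsSol t Q P F) (hG : IsSol t Q P G) :
    F = G := by
  set R := sInv F * G
  have hR : F * R = G := by rw [← mul_assoc, mul_sInv hF.1, one_mul]
  have h1 : F * (beta t * R - R * beta t + X ^ 7 * euler R) = 0 := by
    have e1 := hG.2
    rw [← hR, euler_mul] at e1
    have e2 : F * beta t * R = alpha t Q P * F * R + X ^ 7 * euler F * R := by
      rw [← add_mul, hF.2]
    have e3 : X ^ 7 * (F * euler R) = F * (X ^ 7 * euler R) := by
      rw [← mul_assoc, ← mul_assoc, X_pow_mul]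
    calc _ = F * beta t * R + F * (X ^ 7 * euler R) - F * R * beta t := by noncomm_ring
      _ = 0 := by rw [← e1, e2, ← e3]; noncomm_ring
  have h2 : beta t * R - R * beta t + X ^ 7 * euler R = 0 := by
    have := congrArg (sInv F * ·) h1
    simpa only [← mul_assoc, sInv_mul hF.1, one_mul, mul_zero] using this
  have h3 : R - 1 = 0 := by
    apply eq_zero_of_commutator (t := t)
    · rw [map_sub, coeff_zero_mul, coeff_zero_sInv, hG.1, mul_one, coeff_one, if_pos rfl, sub_self]
    · have : euler (R - 1) = euler R := by
        ext1 n
        rcases n with _ | n <;> simp [coeff_one]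
      rw [this, ← h2]
      noncomm_ring
  rw [← hR, sub_eq_zero.1 h3, mul_one]

/-! ### Solving the equation from an approximate solution -/

/-- The contribution of the `p`-th coefficient to the `n`-th one, in the recursion for the solutions
of `[β, R] + X ^ 7 * euler R + X ^ 8 * E * R = 0`. -/
def recStep (b E : ℕ → M3) (n p : ℕ) (A : M3) : M3 :=
  -((3 / n : ℂ) • piC (E (n - 1 - p) * A))
    - adInv (b (n - p) * A - A * b (n - p) + (if p + 7 = n then ((p : ℂ) / 3) • A else 0)
      + if p + 8 ≤ n then E (n - 8 - p) * A else 0)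

/-- The recursive solution of `[β, R] + X ^ 7 * euler R + X ^ 8 * E * R = 0`. -/
def recSol (b E : ℕ → M3) : ℕ → M3
  | 0 => 1
  | n + 1 => ∑ p : Fin (n + 1), recStep b E (n + 1) p (recSol b E p)

lemma coeff_mul_range (F G : M3⟦X⟧) (n : ℕ) :
    coeff n (F * G) = ∑ p ∈ Finset.range (n + 1), coeff (n - p) F * coeff p G := by
  rw [coeff_mul, ← Finset.Nat.sum_antidiagonal_swap, Finset.Nat.sum_antidiagonal_eq_sum_range_succ_mk]
  rfl

lemma coeff_mul_range' (F G : M3⟦X⟧) (n : ℕ) :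
    coeff n (F * G) = ∑ p ∈ Finset.range (n + 1), coeff p F * coeff (n - p) G := by
  rw [coeff_mul, Finset.Nat.sum_antidiagonal_eq_sum_range_succ_mk]

lemma recSol_succ (b E : ℕ → M3) (n : ℕ) : recSol b E (n + 1)
    = ∑ p ∈ Finset.range (n + 1), recStep b E (n + 1) p (recSol b E p) := by
  rw [recSol, Finset.sum_range]

lemma piC_recStep (b E : ℕ → M3) (n p : ℕ) (A : M3) :
    piC (recStep b E n p A) = -((3 / n : ℂ) • piC (E (n - 1 - p) * A)) := by
  rw [recStep, sub_eq_add_neg, ← neg_one_smul ℂ (adInv _), ← neg_one_smul ℂ ((3 / n : ℂ) • _), piC_add, piC_smul,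
    piC_smul, piC_smul, piC_adInv, smul_zero, add_zero, piC_piC]

lemma commutator_recStep (b E : ℕ → M3) (n p : ℕ) (A : M3) :
    cyc * recStep b E n p A - recStep b E n p A * cyc
      = -((b (n - p) * A - A * b (n - p) + (if p + 7 = n then ((p : ℂ) / 3) • A else 0)
      + if p + 8 ≤ n then E (n - 8 - p) * A else 0)
        - piC (b (n - p) * A - A * b (n - p) + (if p + 7 = n then ((p : ℂ) / 3) • A else 0)
      + if p + 8 ≤ n then E (n - 8 - p) * A else 0)) := by
  rw [← commutator_adInv, recStep]
  generalize adInv _ = B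
  rw [mul_sub, sub_mul, mul_neg, neg_mul, Matrix.mul_smul, Matrix.smul_mul, cyc_commutes_piC]
  abel

/-- In degree `n` the equation prescribes `[cyc, r_n]`, which is possible exactly when `piC` of the
terms from earlier coefficients vanishes; it leaves `piC r_n` free. The projected equation in degree
`n + 7` reads `(n/3) piC r_n = -piC (E R)_(n-1)` for `n ≥ 1`, and its right side involves earlier
coefficients only. This is why the perturbation must start at `X ^ 8`: with `X ^ 7` there would be
an obstruction at `n = 0`. -/
lemma recSol_spec (t : Fin 3 → ℂ) (E : M3⟦X⟧) :
    let R : M3⟦X⟧ := PowerSeries.mk (recSol (betaCoeff t) fun n => coeff n E)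
    beta t * R - R * beta t + X ^ 7 * euler R + X ^ 8 * (E * R) = 0 := by
  intro R
  set e : ℕ → M3 := fun n => coeff n E
  set r := recSol (betaCoeff t) e
  have hr : r = recSol (betaCoeff t) e := rfl
  have hRn (p : ℕ) : coeff p R = r p := coeff_mk _ _
  have hb (p : ℕ) : coeff p (beta t) = betaCoeff t p := coeff_mk _ _
  have hb0 : betaCoeff t 0 = cyc := rfl
  -- The factor `3 / n` in `recStep` is chosen for this relation, the projected equation in degree
  -- `n + 7`.
  have hpi (n : ℕ) : ((n : ℂ) / 3) • piC (r n)
      = -if 1 ≤ n then piC (coeff (n - 1) (E * R)) else 0 := by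
    rcases n with _ | n
    · simp
    · rw [hr, recSol_succ, piC_sum, if_pos (by omega), Nat.add_sub_cancel, coeff_mul_range, piC_sum]
      simp only [piC_recStep]
      rw [Finset.sum_neg_distrib, smul_neg, ← Finset.smul_sum, smul_smul]
      have : ((n + 1 : ℕ) : ℂ) / 3 * (3 / ((n + 1 : ℕ) : ℂ)) = 1 := by
        have : ((n + 1 : ℕ) : ℂ) ≠ 0 := by exact_mod_cast n.succ_ne_zero
        field_simp
      rw [this, one_smul]
      simp only [hRn, Nat.add_sub_cancel, e, hr]
  -- the part of the `n`-th coefficient that involves earlier coefficients only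
  have hco (n : ℕ) : coeff n (beta t * R - R * beta t + X ^ 7 * euler R + X ^ 8 * (E * R))
      = (cyc * r n - r n * cyc) + ∑ p ∈ Finset.range n, (betaCoeff t (n - p) * r p
        - r p * betaCoeff t (n - p) + (if p + 7 = n then ((p : ℂ) / 3) • r p else 0)
        + if p + 8 ≤ n then e (n - 8 - p) * r p else 0) := by
    have h1 : coeff n (beta t * R) = (∑ p ∈ Finset.range n, betaCoeff t (n - p) * r p)
        + cyc * r n := by
      rw [coeff_mul_range, Finset.sum_range_succ]
      simp only [hRn, hb, Nat.sub_self, hb0]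
    have h2 : coeff n (R * beta t) = (∑ p ∈ Finset.range n, r p * betaCoeff t (n - p))
        + r n * cyc := by
      rw [coeff_mul_range', Finset.sum_range_succ]
      simp only [hRn, hb, Nat.sub_self, hb0]
    have h3 : coeff n (X ^ 7 * euler R)
        = ∑ p ∈ Finset.range n, if p + 7 = n then ((p : ℂ) / 3) • r p else 0 := by
      rw [coeff_X_pow_mul']
      split_ifs with h
      · rw [Finset.sum_eq_single (n - 7)]
        · rw [if_pos (by omega)]
          rw [coeff_euler, hRn]
        · intro p _ hp
          rw [if_neg (by omega)]
        · intro hp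
          exact absurd (Finset.mem_range.2 (by omega)) hp
      · exact (Finset.sum_eq_zero fun p _ => if_neg (by omega)).symm
    have h4 : coeff n (X ^ 8 * (E * R))
        = ∑ p ∈ Finset.range n, if p + 8 ≤ n then e (n - 8 - p) * r p else 0 := by
      rw [coeff_X_pow_mul']
      split_ifs with h
      · rw [coeff_mul_range, ← Finset.sum_filter]
        refine Finset.sum_congr ?_ fun p _ => by rw [hRn]
        ext p
        simp only [Finset.mem_range, Finset.mem_filter]
        omega
      · exact (Finset.sum_eq_zero fun p _ => if_neg (by omega)).symm
    simp only [map_add, map_sub, h1, h2, h3, h4, Finset.sum_add_distrib, Finset.sum_sub_distrib]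
    abel
  ext1 n
  -- The projected equation holds in every degree, so it remains to see that each coefficient of the
  -- left side lies in the commutant of `cyc`.
  have hz : piC (coeff n (beta t * R - R * beta t + X ^ 7 * euler R + X ^ 8 * (E * R))) = 0 := by
    rw [map_add, map_add, piC_add, piC_add, piC_coeff_commutator, zero_add, coeff_X_pow_mul',
      coeff_X_pow_mul']
    by_cases h7 : 7 ≤ n
    · rw [if_pos h7, coeff_euler, piC_smul, coeff_mk, hpi]
      by_cases h8 : 8 ≤ n
      · rw [if_pos h8, if_pos (by omega), Nat.sub_sub, neg_add_cancel]
      · rw [if_neg h8, if_neg (by omega), piC_zero, neg_zero, zero_add]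
    · rw [if_neg h7, if_neg (by omega), piC_zero, zero_add]
  rw [hco] at hz ⊢
  rcases n with _ | n
  · simp [hr, recSol]
  · have hc : cyc * r (n + 1) - r (n + 1) * cyc = -(∑ p ∈ Finset.range (n + 1),
        (betaCoeff t (n + 1 - p) * r p - r p * betaCoeff t (n + 1 - p)
        + (if p + 7 = n + 1 then ((p : ℂ) / 3) • r p else 0)
        + if p + 8 ≤ n + 1 then e (n + 1 - 8 - p) * r p else 0)
        - piC (∑ p ∈ Finset.range (n + 1),
        (betaCoeff t (n + 1 - p) * r p - r p * betaCoeff t (n + 1 - p)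
        + (if p + 7 = n + 1 then ((p : ℂ) / 3) • r p else 0)
        + if p + 8 ≤ n + 1 then e (n + 1 - 8 - p) * r p else 0))) := by
      rw [piC_sum, ← Finset.sum_sub_distrib, ← Finset.sum_neg_distrib, hr, recSol_succ,
        Finset.mul_sum, Finset.sum_mul, ← Finset.sum_sub_distrib]
      exact Finset.sum_congr rfl fun p _ => commutator_recStep _ _ _ _ _
    rw [hc] at hz ⊢
    generalize (∑ p ∈ Finset.range (n + 1), _ : M3) = Y at hz ⊢
    -- With `Y` the sum of the earlier contributions, the coefficient is `-(Y - piC Y) + Y = piC Y`,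
    -- and this is already known to be annihilated by `piC`.
    rw [neg_sub, sub_add_cancel] at hz ⊢
    rw [piC_piC] at hz
    rw [hz, map_zero]

/-- An approximate solution, up to `X ^ 8`, can be corrected to a solution. -/
lemma isSol_of_approx {t Q P : Fin 3 → ℂ} {T E : M3⟦X⟧} (h0 : coeff 0 T = 1)
    (hT : alpha t Q P * T + X ^ 7 * euler T = T * beta t + X ^ 8 * E) :
    IsSol t Q P (T * PowerSeries.mk (recSol (betaCoeff t) fun n => coeff n (sInv T * E))) := by
  have h := recSol_spec t (sInv T * E)
  set R : M3⟦X⟧ := PowerSeries.mk (recSol (betaCoeff t) fun n => coeff n (sInv T * E))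
  refine ⟨?_, ?_⟩
  · rw [coeff_zero_mul, h0, one_mul]
    simp [R, recSol]
  · have e1 : X ^ 7 * (T * euler R) = T * (X ^ 7 * euler R) := by
      rw [← mul_assoc, ← mul_assoc, X_pow_mul]
    have e2 : X ^ 8 * E * R = T * (X ^ 8 * (sInv T * E * R)) := by
      rw [← mul_assoc T, ← X_pow_mul, mul_assoc, mul_assoc, mul_assoc, ← mul_assoc T,
        mul_sInv h0, one_mul]
    calc alpha t Q P * (T * R) + X ^ 7 * euler (T * R)
        = (alpha t Q P * T + X ^ 7 * euler T) * R + X ^ 7 * (T * euler R) := by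
          rw [euler_mul]; noncomm_ring
      _ = T * R * beta t + T * (beta t * R - R * beta t + X ^ 7 * euler R
            + X ^ 8 * (sInv T * E * R)) := by
          rw [hT, e1, add_mul, e2]; noncomm_ring
      _ = T * R * beta t := by rw [h, mul_zero, add_zero]

/-! ### An approximate solution -/

/-- The first coefficients of an approximate solution. -/
def approxCoeff (t Q P : Fin 3 → ℂ) : ℕ → M3
  | 0 => 1
  | 2 => g1 0 (1 / 3 * t 2 + 1 / 4 * Q 0) (-1 / 3 * t 2 - 1 / 4 * Q 0)
  | 3 => g0 (-1 / 2 * Q 1 + 1 / 12 * Q 2) (-1 / 6 * Q 2) (1 / 2 * Q 1 + 1 / 12 * Q 2)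
  | 4 => g2
      (25 / 54 * t 2 ^ 2 + 5 / 18 * t 2 * Q 0 + 1 / 6 * Q 0 ^ 2 + 1 / 6 * P 1 - P 2)
      (-23 / 54 * t 2 ^ 2 - 2 / 9 * t 2 * Q 0 - 7 / 48 * Q 0 ^ 2 + 1 / 6 * P 1 + P 2)
      (-1 / 27 * t 2 ^ 2 - 1 / 18 * t 2 * Q 0 - 1 / 48 * Q 0 ^ 2 - 1 / 3 * P 1)
  | 5 => g1
      (1 / 18 * t 2 * Q 1 - 5 / 36 * t 2 * Q 2 + 1 / 24 * Q 0 * Q 1 + 3 / 16 * Q 0 * Q 2 - 2 / 3 * P 0)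
      (1 / 3 * t 1 + 5 / 9 * t 2 * Q 1 + 1 / 18 * t 2 * Q 2 - 5 / 24 * Q 0 * Q 1 - 5 / 48 * Q 0 * Q 2
        + 1 / 3 * P 0)
      (-1 / 3 * t 1 - 11 / 18 * t 2 * Q 1 + 1 / 12 * t 2 * Q 2 + 1 / 6 * Q 0 * Q 1 - 1 / 12 * Q 0 * Q 2
        + 1 / 3 * P 0)
  | 6 => g0
      (1 / 3 * t 0 - 56 / 81 * t 2 ^ 3 - 91 / 216 * t 2 ^ 2 * Q 0 - 13 / 72 * t 2 * Q 0 ^ 2 + 1 / 3 * t 2 * P 1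
        + 8 / 9 * t 2 * P 2 + 1 / 12 * Q 0 ^ 3 + 1 / 24 * Q 0 * P 1 - 7 / 12 * Q 0 * P 2 + 1 / 6 * Q 1 ^ 2
        - 1 / 12 * Q 1 * Q 2 + 1 / 36 * Q 2 ^ 2)
      (1 / 18 * t 2 ^ 3 + 17 / 216 * t 2 ^ 2 * Q 0 + 7 / 144 * t 2 * Q 0 ^ 2 - 11 / 18 * t 2 * P 1
        - 1 / 9 * t 2 * P 2 + 1 / 64 * Q 0 ^ 3 - 1 / 24 * Q 0 * P 1 - 1 / 12 * Q 0 * P 2 - 1 / 12 * Q 1 ^ 2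
        + 1 / 12 * Q 1 * Q 2 + 1 / 144 * Q 2 ^ 2)
      (-1 / 3 * t 0 + 103 / 162 * t 2 ^ 3 + 37 / 108 * t 2 ^ 2 * Q 0 + 19 / 144 * t 2 * Q 0 ^ 2 + 5 / 18 * t 2 * P 1
        - 7 / 9 * t 2 * P 2 - 19 / 192 * Q 0 ^ 3 + 2 / 3 * Q 0 * P 2 - 1 / 12 * Q 1 ^ 2 - 5 / 144 * Q 2 ^ 2)
  | 7 => g2
      (25 / 27 * t 1 * t 2 + 5 / 18 * t 1 * Q 0 + 49 / 54 * t 2 ^ 2 * Q 1 + 23 / 162 * t 2 ^ 2 * Q 2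
        - 4 / 9 * t 2 * Q 0 * Q 1 - 29 / 216 * t 2 * Q 0 * Q 2 + 5 / 9 * t 2 * P 0 - 13 / 96 * Q 0 ^ 2 * Q 1
        + 1 / 576 * Q 0 ^ 2 * Q 2 + 1 / 3 * Q 1 * P 2 + 1 / 36 * Q 2 * P 1 - 1 / 9)
      (-23 / 27 * t 1 * t 2 - 2 / 9 * t 1 * Q 0 - 91 / 108 * t 2 ^ 2 * Q 1 + 83 / 648 * t 2 ^ 2 * Q 2
        + 17 / 36 * t 2 * Q 0 * Q 1 - 5 / 54 * t 2 * Q 0 * Q 2 + 1 / 3 * t 2 * P 0 + 1 / 12 * Q 0 ^ 2 * Q 1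
        + 17 / 288 * Q 0 ^ 2 * Q 2 - 1 / 6 * Q 0 * P 0 + 1 / 12 * Q 1 * P 1 - 1 / 6 * Q 1 * P 2 - 1 / 72 * Q 2 * P 1
        - 1 / 12 * Q 2 * P 2 - 1 / 9)
      (-2 / 27 * t 1 * t 2 - 1 / 18 * t 1 * Q 0 - 7 / 108 * t 2 ^ 2 * Q 1 - 175 / 648 * t 2 ^ 2 * Q 2
        - 1 / 36 * t 2 * Q 0 * Q 1 + 49 / 216 * t 2 * Q 0 * Q 2 - 8 / 9 * t 2 * P 0 + 5 / 96 * Q 0 ^ 2 * Q 1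
        - 35 / 576 * Q 0 ^ 2 * Q 2 + 1 / 6 * Q 0 * P 0 - 1 / 12 * Q 1 * P 1 - 1 / 6 * Q 1 * P 2 - 1 / 72 * Q 2 * P 1
        + 1 / 12 * Q 2 * P 2 + 2 / 9)
  | _ => 0

section alphaCoeff
variable (t Q P : Fin 3 → ℂ)
lemma alphaCoeff_zero : alphaCoeff t Q P 0 = g1 1 1 1 := rfl
lemma alphaCoeff_one : alphaCoeff t Q P 1 = 0 := rfl
lemma alphaCoeff_two : alphaCoeff t Q P 2
    = g2 (2 * t 2 + 1 / 4 * Q 0) (2 * t 2 + 1 / 4 * Q 0) (t 2 - 1 / 2 * Q 0) := rfl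
lemma alphaCoeff_three : alphaCoeff t Q P 3
    = g1 (-Q 1) (1 / 2 * Q 1 - 1 / 4 * Q 2) (1 / 2 * Q 1 + 1 / 4 * Q 2) := rfl
lemma alphaCoeff_four : alphaCoeff t Q P 4 = g0
    (1 / 8 * Q 0 ^ 2 - P 2 + 1 / 2 * P 1 - 1 / 4 * t 2 * Q 0 - 1 / 6 * t 2 ^ 2)
    (2 * P 2 - 1 / 4 * Q 0 ^ 2 + 1 / 2 * t 2 * Q 0 + 1 / 3 * t 2 ^ 2)
    (1 / 8 * Q 0 ^ 2 - P 2 - 1 / 2 * P 1 - 1 / 4 * t 2 * Q 0 - 1 / 6 * t 2 ^ 2) := rfl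
lemma alphaCoeff_five : alphaCoeff t Q P 5 = g2
    (5 / 16 * Q 0 * Q 2 - P 0 + 1 / 4 * t 2 * Q 2 - 3 / 8 * Q 0 * Q 1 - 1 / 2 * t 2 * Q 1 + t 1)
    (-(5 / 16) * Q 0 * Q 2 + P 0 - 1 / 4 * t 2 * Q 2 - 3 / 8 * Q 0 * Q 1 - 1 / 2 * t 2 * Q 1 + t 1)
    0 := rfl
lemma alphaCoeff_six : alphaCoeff t Q P 6 = g1
    (1 / 16 * Q 2 ^ 2 + 7 / 32 * Q 0 ^ 3 + 3 / 4 * Q 1 ^ 2 - 3 / 2 * P 2 * Q 0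
      + 5 / 16 * t 2 * Q 0 ^ 2 - 2 * t 2 * P 2 + 1 / 4 * t 2 ^ 2 * Q 0 + t 0 + 8 / 27 * t 2 ^ 3)
    0 0 := rfl
lemma alphaCoeff_seven : alphaCoeff t Q P 7 = g0 (-(1 / 3)) 0 (1 / 3) := rfl
end alphaCoeff

/-- An approximate solution. -/
def approx (t Q P : Fin 3 → ℂ) : M3⟦X⟧ := PowerSeries.mk (approxCoeff t Q P)

lemma betaCoeff_two (t : Fin 3 → ℂ) :
    betaCoeff t 2 = g2 (5 / 3 * t 2) (5 / 3 * t 2) (5 / 3 * t 2) := by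
  simp [betaCoeff, cyc_mul_cyc, g2_smul]

lemma betaCoeff_five (t : Fin 3 → ℂ) :
    betaCoeff t 5 = g2 (2 / 3 * t 1) (2 / 3 * t 1) (2 / 3 * t 1) := by
  simp [betaCoeff, cyc_mul_cyc, g2_smul]

lemma betaCoeff_six (t : Fin 3 → ℂ) :
    betaCoeff t 6 = g1 (1 / 3 * t 0) (1 / 3 * t 0) (1 / 3 * t 0) := by
  simp [betaCoeff, cyc, g1_smul]

/-- The defect of the approximate solution. -/
def defect (t Q P : Fin 3 → ℂ) : M3⟦X⟧ :=
  alpha t Q P * approx t Q P + X ^ 7 * euler (approx t Q P) - approx t Q P * beta t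

lemma g0_zero : g0 0 0 0 = 0 := by ext i j; fin_cases i <;> fin_cases j <;> rfl
lemma g1_zero : g1 0 0 0 = 0 := by ext i j; fin_cases i <;> fin_cases j <;> rfl
lemma g2_zero : g2 0 0 0 = 0 := by ext i j; fin_cases i <;> fin_cases j <;> rfl

lemma g0_eq_zero {a b c : ℂ} (ha : a = 0) (hb : b = 0) (hc : c = 0) : g0 a b c = 0 := by
  rw [ha, hb, hc, g0_zero]
lemma g1_eq_zero {a b c : ℂ} (ha : a = 0) (hb : b = 0) (hc : c = 0) : g1 a b c = 0 := by
  rw [ha, hb, hc, g1_zero]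
lemma g2_eq_zero {a b c : ℂ} (ha : a = 0) (hb : b = 0) (hc : c = 0) : g2 a b c = 0 := by
  rw [ha, hb, hc, g2_zero]

/-- The coefficients in `approxCoeff` are obtained by inverting `[cyc, ·]` degree by degree, with
commutant component zero in positive degrees. Solvability up to degree 7 expresses that the
commutant part is exactly `betaCoeff`; its vanishing in degree 7 means that `Θ` needs no logarithmic
term. -/
lemma coeff_defect (t Q P : Fin 3 → ℂ) {n : ℕ} (hn : n ≤ 7) : coeff n (defect t Q P) = 0 := by
  have h7 : coeff n (X ^ 7 * euler (approx t Q P)) = 0 := by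
    rw [coeff_X_pow_mul']
    split_ifs with h
    -- Only the constant coefficient can contribute, and `euler` annihilates it.
    · obtain rfl : n = 7 := by omega
      simp
    · rfl
  have hb0 : betaCoeff t 0 = g1 1 1 1 := rfl
  have hb1 : betaCoeff t 1 = 0 := rfl
  have hb3 : betaCoeff t 3 = 0 := rfl
  have hb4 : betaCoeff t 4 = 0 := rfl
  have hb7 : betaCoeff t 7 = 0 := rfl
  rw [defect, map_sub, map_add, h7, add_zero, coeff_mul_range, coeff_mul_range', sub_eq_zero]
  simp only [alpha, beta, approx, coeff_mk]
  interval_cases n <;>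
  · simp only [Finset.sum_range_succ, Finset.sum_range_zero, Nat.reduceSub, Nat.sub_zero,
      approxCoeff, ← g0_one, alphaCoeff_zero, alphaCoeff_one, alphaCoeff_two, alphaCoeff_three,
      alphaCoeff_four, alphaCoeff_five, alphaCoeff_six, alphaCoeff_seven, hb0, hb1, betaCoeff_two,
      hb3, hb4, betaCoeff_five, betaCoeff_six, hb7, zero_mul, mul_zero, zero_add, add_zero,
      g0_mul_g0, g0_mul_g1, g0_mul_g2, g1_mul_g0, g1_mul_g1, g1_mul_g2, g2_mul_g0, g2_mul_g1,
      g2_mul_g2, g0_add, g1_add, g2_add]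
    try (congr 1 <;> ring)

/-- The formal solution, in the constant frame. -/
def sol (t Q P : Fin 3 → ℂ) : M3⟦X⟧ :=
  approx t Q P * PowerSeries.mk (recSol (betaCoeff t) fun n => coeff n
    (sInv (approx t Q P) * PowerSeries.mk fun n => coeff (n + 8) (defect t Q P)))

lemma isSol_sol (t Q P : Fin 3 → ℂ) : IsSol t Q P (sol t Q P) := by
  refine isSol_of_approx (by simp [approx, approxCoeff]) ?_
  rw [← sub_eq_iff_eq_add', ← defect]
  ext1 n
  rw [coeff_X_pow_mul']
  split_ifs with h
  · rw [coeff_mk, Nat.sub_add_cancel h]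
  · exact coeff_defect t Q P (by omega)

lemma conjU_injective : Function.Injective conjU := by
  intro Φ Ψ h
  have h1 : PowerSeries.mk Φ = PowerSeries.mk Ψ := by
    have e (Φ : ℕ → M3) : C matUInv * conjU Φ * C matU = PowerSeries.mk Φ := by
      calc C matUInv * conjU Φ * C matU
          = C matUInv * C matU * PowerSeries.mk Φ * (C matUInv * C matU) := by
            rw [conjU]; noncomm_ring
        _ = _ := by rw [← map_mul, matUInv_mul, map_one, one_mul, mul_one]
    rw [← e Φ, h, e Ψ]
  ext1 n
  simpa using congrArg (coeff n) h1

/-- The coefficients of the formal solution. -/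
def solCoeff (t Q P : Fin 3 → ℂ) (n : ℕ) : M3 := matUInv * coeff n (sol t Q P) * matU

lemma conjU_solCoeff (t Q P : Fin 3 → ℂ) : conjU (solCoeff t Q P) = sol t Q P := by
  ext1 n
  rw [conjU, coeff_mul_C, coeff_C_mul, coeff_mk, solCoeff]
  calc matU * (matUInv * coeff n (sol t Q P) * matU) * matUInv
      = matU * matUInv * coeff n (sol t Q P) * (matU * matUInv) := by noncomm_ring
    _ = _ := by rw [matU_mul_inv, one_mul, mul_one]

lemma isFormalSolution_iff_eq (t Q P : Fin 3 → ℂ) (Φ : ℕ → M3) :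
    IsFormalSolution t Q P Φ ↔ Φ = solCoeff t Q P := by
  rw [isFormalSolution_iff]
  constructor
  · intro h
    exact conjU_injective ((h.unique (isSol_sol t Q P)).trans (conjU_solCoeff t Q P).symm)
  · rintro rfl
    rw [conjU_solCoeff]
    exact isSol_sol t Q P

/-! ### Holomorphic dependence on parameters -/

section Smooth

variable {E : Type*} [NormedAddCommGroup E] [NormedSpace ℂ E] {W : Set E}

/-- Entrywise differentiability of a matrix. -/
def DiffM (A : E → M3) (W : Set E) : Prop :=
  ∀ i j, DifferentiableOn ℂ (fun w => A w i j) W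

/-- Coefficientwise differentiability of a series. -/
def DiffS (F : E → M3⟦X⟧) (W : Set E) : Prop :=
  ∀ n, DiffM (fun w => coeff n (F w)) W

lemma diffM_const (A : M3) : DiffM (fun _ => A) W := fun _ _ => differentiableOn_const _

lemma DiffM.add {A B : E → M3} (hA : DiffM A W) (hB : DiffM B W) :
    DiffM (fun w => A w + B w) W := fun i j => (hA i j).add (hB i j)

lemma DiffM.sub {A B : E → M3} (hA : DiffM A W) (hB : DiffM B W) :
    DiffM (fun w => A w - B w) W := fun i j => (hA i j).sub (hB i j)

lemma DiffM.neg {A : E → M3} (hA : DiffM A W) :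
    DiffM (fun w => -A w) W := fun i j => (hA i j).neg

lemma DiffM.sum {ι : Type*} {s : Finset ι} {A : ι → E → M3} (hA : ∀ l ∈ s, DiffM (A l) W) :
    DiffM (fun w => ∑ l ∈ s, A l w) W := fun i j => by
  simp only [Matrix.sum_apply]
  exact DifferentiableOn.fun_sum fun l hl => hA l hl i j

lemma DiffM.mul {A B : E → M3} (hA : DiffM A W) (hB : DiffM B W) :
    DiffM (fun w => A w * B w) W := fun i j => by
  simp only [Matrix.mul_apply]
  exact DifferentiableOn.fun_sum fun l _ => (hA i l).mul (hB l j)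

lemma DiffM.smul {A : E → M3} {s : E → ℂ} (hs : DifferentiableOn ℂ s W) (hA : DiffM A W) :
    DiffM (fun w => s w • A w) W := fun i j => hs.mul (hA i j)

lemma DiffM.g0 {a b c : E → ℂ} (ha : DifferentiableOn ℂ a W) (hb : DifferentiableOn ℂ b W)
    (hc : DifferentiableOn ℂ c W) : DiffM (fun w => g0 (a w) (b w) (c w)) W := fun i j => by
  fin_cases i <;> fin_cases j <;>
    first | exact ha | exact hb | exact hc | exact differentiableOn_const _

lemma DiffM.g1 {a b c : E → ℂ} (ha : DifferentiableOn ℂ a W) (hb : DifferentiableOn ℂ b W)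
    (hc : DifferentiableOn ℂ c W) : DiffM (fun w => g1 (a w) (b w) (c w)) W := fun i j => by
  fin_cases i <;> fin_cases j <;>
    first | exact ha | exact hb | exact hc | exact differentiableOn_const _

lemma DiffM.g2 {a b c : E → ℂ} (ha : DifferentiableOn ℂ a W) (hb : DifferentiableOn ℂ b W)
    (hc : DifferentiableOn ℂ c W) : DiffM (fun w => g2 (a w) (b w) (c w)) W := fun i j => by
  fin_cases i <;> fin_cases j <;>
    first | exact ha | exact hb | exact hc | exact differentiableOn_const _

lemma DiffS.add {F G : E → M3⟦X⟧} (hF : DiffS F W) (hG : DiffS G W) :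
    DiffS (fun w => F w + G w) W := fun n => by
  simpa only [map_add] using (hF n).add (hG n)

lemma DiffS.sub {F G : E → M3⟦X⟧} (hF : DiffS F W) (hG : DiffS G W) :
    DiffS (fun w => F w - G w) W := fun n => by
  simpa only [map_sub] using (hF n).sub (hG n)

lemma DiffS.mul {F G : E → M3⟦X⟧} (hF : DiffS F W) (hG : DiffS G W) :
    DiffS (fun w => F w * G w) W := fun n => by
  simpa only [coeff_mul] using DiffM.sum fun p _ => (hF p.1).mul (hG p.2)

lemma diffS_const (F : M3⟦X⟧) : DiffS (fun _ : E => F) W := fun _ => diffM_const _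

lemma DiffS.euler {F : E → M3⟦X⟧} (hF : DiffS F W) : DiffS (fun w => euler (F w)) W := fun n => by
  simpa only [coeff_euler] using (hF n).smul (differentiableOn_const _)

lemma diffS_mk {A : E → ℕ → M3} (hA : ∀ n, DiffM (fun w => A w n) W) :
    DiffS (fun w => PowerSeries.mk (A w)) W := fun n => by
  simpa only [coeff_mk] using hA n

/-- The inverse is taken with the unit `1` prescribed, so its recursion involves sums and products
only and no division by a coefficient of `F`. -/
lemma DiffS.sInv {F : E → M3⟦X⟧} (hF : DiffS F W) : DiffS (fun w => sInv (F w)) W := fun n => by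
  induction n using Nat.strong_induction_on with
  | _ n ih =>
    have e (w : E) := coeff_invOfUnit n (F w) 1
    rw [show (fun w => coeff n (String34.sInv (F w))) = _ from funext e]
    by_cases h : n = 0
    · simp only [if_pos h]
      exact diffM_const _
    simp only [if_neg h]
    refine DiffM.mul (diffM_const _) (DiffM.sum fun p _ => ?_)
    split_ifs with hp
    · exact (hF _).mul (ih _ hp)
    · exact diffM_const _

lemma DiffM.piC {A : E → M3} (hA : DiffM A W) : DiffM (fun w => piC (A w)) W :=
  DiffM.smul (differentiableOn_const _) ((hA.add (((diffM_const _).mul hA).mul (diffM_const _))).add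
    (((diffM_const _).mul hA).mul (diffM_const _)))

lemma DiffM.adInv {A : E → M3} (hA : DiffM A W) : DiffM (fun w => adInv (A w)) W :=
  DiffM.smul (differentiableOn_const _) (((diffM_const _).mul hA).sub
    ((hA.mul (diffM_const _)).mul (diffM_const _)))

lemma diffM_recSol {b e : E → ℕ → M3} (hb : ∀ n, DiffM (fun w => b w n) W)
    (he : ∀ n, DiffM (fun w => e w n) W) (n : ℕ) : DiffM (fun w => recSol (b w) (e w) n) W := by
  induction n using Nat.strong_induction_on with
  | _ n ih =>
    rcases n with _ | n
    · simpa only [recSol] using diffM_const _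
    · simp only [recSol_succ]
      refine DiffM.sum fun p hp => ?_
      have hp := ih p (Finset.mem_range.1 hp)
      refine DiffM.sub (DiffM.neg (DiffM.smul (differentiableOn_const _) ((he _).mul hp).piC))
        (DiffM.adInv (DiffM.add (DiffM.add (((hb _).mul hp).sub (hp.mul (hb _))) ?_) ?_))
      · split_ifs
        · exact DiffM.smul (differentiableOn_const _) hp
        · exact diffM_const _
      · split_ifs
        · exact (he _).mul hp
        · exact diffM_const _

variable {t Q P : E → Fin 3 → ℂ}

lemma diffS_alpha (ht : ∀ i, DifferentiableOn ℂ (fun w => t w i) W)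
    (hQ : ∀ i, DifferentiableOn ℂ (fun w => Q w i) W)
    (hP : ∀ i, DifferentiableOn ℂ (fun w => P w i) W) :
    DiffS (fun w => alpha (t w) (Q w) (P w)) W := by
  refine diffS_mk fun n => ?_
  match n with
  | 0 => exact diffM_const _
  | 1 => exact diffM_const _
  | 2 => simp only [alphaCoeff_two]; exact DiffM.g2 (by fun_prop) (by fun_prop) (by fun_prop)
  | 3 => simp only [alphaCoeff_three]; exact DiffM.g1 (by fun_prop) (by fun_prop) (by fun_prop)
  | 4 => simp only [alphaCoeff_four]; exact DiffM.g0 (by fun_prop) (by fun_prop) (by fun_prop)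
  | 5 => simp only [alphaCoeff_five]; exact DiffM.g2 (by fun_prop) (by fun_prop) (by fun_prop)
  | 6 => simp only [alphaCoeff_six]; exact DiffM.g1 (by fun_prop) (by fun_prop) (by fun_prop)
  | 7 => exact diffM_const _
  | n + 8 => exact diffM_const _

lemma diffM_betaCoeff (ht : ∀ i, DifferentiableOn ℂ (fun w => t w i) W) (n : ℕ) :
    DiffM (fun w => betaCoeff (t w) n) W := by
  unfold betaCoeff
  split
  · exact diffM_const _
  · exact DiffM.smul (by fun_prop) (diffM_const _)
  · exact DiffM.smul (by fun_prop) (diffM_const _)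
  · exact DiffM.smul (by fun_prop) (diffM_const _)
  · exact diffM_const _

lemma diffS_approx (ht : ∀ i, DifferentiableOn ℂ (fun w => t w i) W)
    (hQ : ∀ i, DifferentiableOn ℂ (fun w => Q w i) W)
    (hP : ∀ i, DifferentiableOn ℂ (fun w => P w i) W) :
    DiffS (fun w => approx (t w) (Q w) (P w)) W := by
  refine diffS_mk fun n => ?_
  unfold approxCoeff
  split
  · exact diffM_const _
  · exact DiffM.g1 (by fun_prop) (by fun_prop) (by fun_prop)
  · exact DiffM.g0 (by fun_prop) (by fun_prop) (by fun_prop)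
  · exact DiffM.g2 (by fun_prop) (by fun_prop) (by fun_prop)
  · exact DiffM.g1 (by fun_prop) (by fun_prop) (by fun_prop)
  · exact DiffM.g0 (by fun_prop) (by fun_prop) (by fun_prop)
  · exact DiffM.g2 (by fun_prop) (by fun_prop) (by fun_prop)
  · exact diffM_const _

lemma diffS_sol (ht : ∀ i, DifferentiableOn ℂ (fun w => t w i) W)
    (hQ : ∀ i, DifferentiableOn ℂ (fun w => Q w i) W)
    (hP : ∀ i, DifferentiableOn ℂ (fun w => P w i) W) :
    DiffS (fun w => sol (t w) (Q w) (P w)) W := by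
  have h1 := diffS_approx ht hQ hP
  have h2 : DiffS (fun w => defect (t w) (Q w) (P w)) W :=
    (((diffS_alpha ht hQ hP).mul h1).add ((diffS_const _).mul h1.euler)).sub
      (h1.mul (diffS_mk (diffM_betaCoeff ht)))
  exact h1.mul (diffS_mk fun n => diffM_recSol (diffM_betaCoeff ht)
    (h1.sInv.mul (diffS_mk fun n => h2 (n + 8))) n)

lemma diffM_solCoeff (ht : ∀ i, DifferentiableOn ℂ (fun w => t w i) W)
    (hQ : ∀ i, DifferentiableOn ℂ (fun w => Q w i) W)
    (hP : ∀ i, DifferentiableOn ℂ (fun w => P w i) W) (n : ℕ) :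
    DiffM (fun w => solCoeff (t w) (Q w) (P w) n) W :=
  ((diffM_const _).mul (diffS_sol ht hQ hP n)).mul (diffM_const _)

end Smooth

/-! ### The residue in terms of the dressed cyclic matrix -/

/-- The trace of the `n`-th coefficient. -/
def trc (n : ℕ) (F : M3⟦X⟧) : ℂ := (coeff n F).trace

lemma trc_add (n : ℕ) (F G : M3⟦X⟧) : trc n (F + G) = trc n F + trc n G := by
  rw [trc, map_add, Matrix.trace_add, trc, trc]

lemma trc_sub (n : ℕ) (F G : M3⟦X⟧) : trc n (F - G) = trc n F - trc n G := by
  rw [trc, map_sub, Matrix.trace_sub, trc, trc]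

lemma trc_mul (n : ℕ) (F G : M3⟦X⟧) :
    trc n (F * G) = ∑ p ∈ Finset.range (n + 1), (coeff p F * coeff (n - p) G).trace := by
  rw [trc, coeff_mul_range', Matrix.trace_sum]

lemma trc_mul_comm (n : ℕ) (F G : M3⟦X⟧) : trc n (F * G) = trc n (G * F) := by
  rw [trc_mul, trc, coeff_mul_range, Matrix.trace_sum]
  exact Finset.sum_congr rfl fun p _ => Matrix.trace_mul_comm _ _

lemma trc_X_pow_mul (n d : ℕ) (F : M3⟦X⟧) : trc (d + n) (X ^ n * F) = trc d F := by
  rw [trc, coeff_X_pow_mul, trc]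

/-- Coefficients of `ξ ^ (-7) 𝒰 Θ 𝒰⁻¹`. -/
def thetaCoeff (t : Fin 3 → ℂ) : ℕ → M3
  | 0 => (3 / 7 : ℂ) • cyc
  | 2 => t 2 • (cyc * cyc)
  | 5 => t 1 • (cyc * cyc)
  | 6 => t 0 • cyc
  | _ => 0

/-- The series `ξ ^ (-7) 𝒰 Θ 𝒰⁻¹`. -/
def thetaS (t : Fin 3 → ℂ) : M3⟦X⟧ := PowerSeries.mk (thetaCoeff t)

lemma thetaCoeff_commutes (t : Fin 3 → ℂ) (n : ℕ) : cyc * thetaCoeff t n = thetaCoeff t n * cyc := by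
  unfold thetaCoeff
  split <;> simp [mul_assoc]

lemma beta_mul_thetaS (s t : Fin 3 → ℂ) : beta s * thetaS t = thetaS t * beta s := by
  ext1 n
  rw [coeff_mul_range, coeff_mul_range']
  refine Finset.sum_congr rfl fun p _ => ?_
  rw [beta, thetaS, coeff_mk, coeff_mk]
  exact betaCoeff_commutes s _ (thetaCoeff_commutes t p)

/-- The coefficient of degree `n` in `thetaS` belongs to `ξ^(7-n)`, whose derivative in `λ` carries
the factor `(7 - n)/3`. -/
lemma betaCoeff_eq (t : Fin 3 → ℂ) {n : ℕ} (hn : n ≤ 7) :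
    betaCoeff t n = (((7 - n : ℕ) : ℂ) / 3) • thetaCoeff t n := by
  interval_cases n <;> simp [betaCoeff, thetaCoeff, smul_smul]

/-- Integration by parts: in total degree 7 the coefficient `x_p` meets `θ_(7-p)`, and the Euler
weight `p/3` is the factor that turns `θ_(7-p)` into `β_(7-p)`. -/
lemma trc_euler_mul_thetaS (t : Fin 3 → ℂ) (x : M3⟦X⟧) :
    trc 7 (euler x * thetaS t) = trc 7 (beta t * x) := by
  rw [trc_mul_comm, trc_mul, trc_mul]
  refine Finset.sum_congr rfl fun p hp => ?_
  have hp : p ≤ 7 := by simpa [Nat.lt_succ_iff] using hp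
  rw [beta, thetaS, coeff_mk, coeff_mk, coeff_euler, betaCoeff_eq t hp, Matrix.mul_smul,
    Matrix.smul_mul]

/-- Both factors stop at degree 6, so their product has no term of degree 14. -/
lemma trc_dBeta_mul_thetaS (t : Fin 3 → ℂ) {b : ℕ → M3} (hb : ∀ n, 7 ≤ n → b n = 0) :
    trc 14 (PowerSeries.mk b * thetaS t) = 0 := by
  rw [trc_mul]
  refine Finset.sum_eq_zero fun p hp => ?_
  rw [thetaS, coeff_mk, coeff_mk]
  rcases le_or_gt 7 p with h | h
  · rw [hb p h, zero_mul, Matrix.trace_zero]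
  · obtain ⟨m, hm⟩ : ∃ m, 14 - p = m + 7 := ⟨7 - p, by omega⟩
    rw [hm]
    simp [thetaCoeff]

lemma euler_sInv {F : M3⟦X⟧} (h : coeff 0 F = 1) :
    euler (sInv F) = -(sInv F * euler F * sInv F) := by
  have h1 := congrArg euler (sInv_mul h)
  rw [euler_mul, euler_one] at h1
  have h2 := congrArg (· * sInv F) h1
  simp only [add_mul, zero_mul, mul_assoc, mul_sInv h, mul_one] at h2
  rw [mul_assoc]
  exact eq_neg_of_add_eq_zero_left h2

/-- With `x = F⁻¹ dF`, the linearized equation becomes `F⁻¹ dα F = [x, β] + dβ - X ^ 7 e(x)`. After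
multiplication by `θ` and a trace in degree 14, the commutator disappears since `β` and `θ` commute,
the `dβ` term disappears by degree, and the last term gives the residue by integration by parts. -/
lemma residue_eq_dAlpha {t Q P : Fin 3 → ℂ} {F dF dα : M3⟦X⟧} {b : ℕ → M3} (hF : IsSol t Q P F)
    (hb : ∀ n, 7 ≤ n → b n = 0)
    (hd : dα * F + alpha t Q P * dF + X ^ 7 * euler dF
      = dF * beta t + F * PowerSeries.mk b) :
    -trc 7 (alpha t Q P * (dF * sInv F)) = trc 14 (dα * (F * thetaS t * sInv F)) := by
  set α := alpha t Q P
  set β := beta t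
  set G := sInv F
  have hFG : F * G = 1 := mul_sInv hF.1
  have hGF : G * F = 1 := sInv_mul hF.1
  set x := G * dF
  have hx : F * x = dF := by rw [← mul_assoc, hFG, one_mul]
  have hα : α = F * β * G - X ^ 7 * (euler F * G) := by
    rw [← hF.2, ← mul_assoc, ← sub_mul, add_sub_cancel_right, mul_assoc, hFG, mul_one]
  -- Replacing `α` by `F β F⁻¹` costs a term `X ^ 7 e(F) ...`, whose trace in degree 7 sees only the
  -- constant coefficient of `e(F)`, which is zero.
  have h1 : trc 7 (α * (dF * G)) = trc 7 (β * x) := by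
    have e1 : α * (dF * G) = F * (β * x * G) - X ^ 7 * (euler F * (x * G)) := by
      calc α * (dF * G) = F * β * G * (dF * G) - X ^ 7 * (euler F * G) * (dF * G) := by
            rw [hα, sub_mul]
        _ = F * (β * (G * dF) * G) - X ^ 7 * (euler F * (G * dF * G)) := by
            simp only [mul_assoc]
    have e2 : trc 0 (euler F * (x * G)) = 0 := by
      simp [trc, coeff_zero_mul]
    rw [e1, trc_sub, trc_mul_comm 7 F, mul_assoc (β * x), hGF, mul_one,
      trc_X_pow_mul 7 0, e2, sub_zero]
  have h2 : G * dα * F = x * β - β * x + PowerSeries.mk b - X ^ 7 * euler x := by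
    have e1 : dα * F = F * (x * β - β * x + PowerSeries.mk b - X ^ 7 * euler x) := by
      have e3 : X ^ 7 * (F * euler x) = F * (X ^ 7 * euler x) := by
        rw [← mul_assoc, ← mul_assoc, X_pow_mul]
      have e4 : α * dF = F * β * x - X ^ 7 * euler F * x := by
        rw [← hx, ← mul_assoc, ← sub_mul, ← hF.2, add_sub_cancel_right]
      have e5 : X ^ 7 * euler dF = X ^ 7 * euler F * x + F * (X ^ 7 * euler x) := by
        rw [← hx, euler_mul, mul_add, e3, mul_assoc]
      rw [add_assoc, e4, e5] at hd
      calc dα * F = dα * F + (F * β * x - X ^ 7 * euler F * x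
              + (X ^ 7 * euler F * x + F * (X ^ 7 * euler x)))
              - F * β * x - F * (X ^ 7 * euler x) := by abel
        _ = F * x * β + F * PowerSeries.mk b - F * β * x - F * (X ^ 7 * euler x) := by
              rw [hd, hx]
        _ = _ := by noncomm_ring
    rw [mul_assoc, e1, ← mul_assoc, hGF, one_mul]
  have h3 : trc 14 (dα * (F * thetaS t * G)) = trc 14 (G * dα * F * thetaS t) := by
    rw [trc_mul_comm]
    simp only [mul_assoc]
    rw [trc_mul_comm 14 F]
    simp only [mul_assoc]
    rw [trc_mul_comm 14 (thetaS t)]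
    simp only [mul_assoc]
  have h4 : trc 14 ((x * β - β * x) * thetaS t) = 0 := by
    rw [sub_mul, trc_sub, mul_assoc, beta_mul_thetaS, mul_assoc β, trc_mul_comm 14 β, ← mul_assoc,
      sub_self]
  rw [h1, h3, h2, sub_mul, add_mul, trc_sub, trc_add, h4, trc_dBeta_mul_thetaS t hb, mul_assoc,
    trc_X_pow_mul 7 7, trc_euler_mul_thetaS, zero_add, zero_sub]

/-! ### The dressed cyclic matrix: its equation, powers and traces -/

/-- The cyclic matrix, dressed by a formal solution. -/
def dressed (F : M3⟦X⟧) : M3⟦X⟧ := F * C cyc * sInv F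

lemma C_cyc_mul_beta (t : Fin 3 → ℂ) : C cyc * beta t = beta t * C cyc := by
  ext1 n
  rw [coeff_C_mul, coeff_mul_C, beta, coeff_mk, betaCoeff_commutes t n rfl]

/-- The gauge transformation `F` carries `β` to `α`, and the constant matrix `cyc` commutes with
`β`; hence its conjugate is covariantly constant for `α`. -/
lemma dressed_eq {t Q P : Fin 3 → ℂ} {F : M3⟦X⟧} (hF : IsSol t Q P F) :
    alpha t Q P * dressed F - dressed F * alpha t Q P + X ^ 7 * euler (dressed F) = 0 := by
  have hFG : F * sInv F = 1 := mul_sInv hF.1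
  have e1 : X ^ 7 * euler F = F * beta t - alpha t Q P * F := by
    rw [← hF.2, add_sub_cancel_left]
  have e2 : X ^ 7 * euler (dressed F) = X ^ 7 * euler F * (C cyc * sInv F)
      - dressed F * (X ^ 7 * euler F * sInv F) := by
    rw [dressed, euler_mul, euler_mul, euler_C, mul_zero, add_zero, euler_sInv hF.1,
      mul_neg, mul_add, mul_neg, ← sub_eq_add_neg]
    have hX (A B : M3⟦X⟧) : X ^ 7 * (A * B) = A * (X ^ 7 * B) := by
      rw [← mul_assoc, X_pow_mul, mul_assoc]
    have e3 : F * C cyc * (sInv F * euler F * sInv F) = dressed F * (euler F * sInv F) := by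
      simp only [dressed, mul_assoc]
    rw [e3, hX (dressed F), dressed]
    simp only [mul_assoc]
  rw [e2, e1, dressed]
  have e3 : F * beta t * (C cyc * sInv F) = F * C cyc * (beta t * sInv F) := by
    rw [mul_assoc, ← mul_assoc (beta t), ← C_cyc_mul_beta]
    simp only [mul_assoc]
  have e4 : (F * beta t - alpha t Q P * F) * sInv F = F * beta t * sInv F - alpha t Q P := by
    rw [sub_mul, mul_assoc (alpha t Q P), hFG, mul_one]
  have e5 : F * C cyc * sInv F * (F * beta t * sInv F) = F * C cyc * (beta t * sInv F) := by
    calc _ = F * C cyc * (sInv F * F) * (beta t * sInv F) := by simp only [mul_assoc]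
      _ = _ := by rw [sInv_mul hF.1, mul_one]
  rw [e4, mul_sub, sub_mul, e3, e5]
  noncomm_ring

lemma dressed_sq {F : M3⟦X⟧} (h : coeff 0 F = 1) :
    dressed F * dressed F = F * C (cyc * cyc) * sInv F := by
  calc dressed F * dressed F = F * C cyc * (sInv F * F) * C cyc * sInv F := by
        simp only [dressed, mul_assoc]
    _ = _ := by rw [sInv_mul h, mul_one, map_mul]; simp only [mul_assoc]

lemma dressed_cube {F : M3⟦X⟧} (h : coeff 0 F = 1) :
    dressed F * (dressed F * dressed F) = 1 := by
  rw [dressed_sq h]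
  calc dressed F * (F * C (cyc * cyc) * sInv F)
      = F * C cyc * (sInv F * F) * C (cyc * cyc) * sInv F := by simp only [dressed, mul_assoc]
    _ = 1 := by
      rw [sInv_mul h, mul_one, mul_assoc F, ← map_mul, cyc_pow_three', map_one, mul_one,
        mul_sInv h]

lemma trc_conj {F : M3⟦X⟧} (h : coeff 0 F = 1) (A : M3) {n : ℕ} (hn : n ≠ 0) :
    trc n (F * C A * sInv F) = 0 := by
  rw [trc_mul_comm, ← mul_assoc, sInv_mul h, one_mul, trc, coeff_C, if_neg hn, Matrix.trace_zero]

lemma coeff_zero_dressed {F : M3⟦X⟧} (h : coeff 0 F = 1) : coeff 0 (dressed F) = cyc := by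
  rw [dressed, coeff_zero_mul, coeff_zero_mul, h, coeff_zero_sInv]
  simp

/-- The series `thetaS` is a polynomial in `cyc` with scalar coefficients, so conjugation replaces
`cyc` by the dressed matrix. The bound `6 ≤ n` keeps the natural subtractions exact. -/
lemma conj_thetaS (t : Fin 3 → ℂ) {F : M3⟦X⟧} (h : coeff 0 F = 1) {n : ℕ} (hn : 6 ≤ n) :
    coeff n (F * thetaS t * sInv F) = (3 / 7 : ℂ) • coeff n (dressed F)
      + t 2 • coeff (n - 2) (dressed F * dressed F) + t 1 • coeff (n - 5) (dressed F * dressed F)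
      + t 0 • coeff (n - 6) (dressed F) := by
  have hθ : thetaS t = C ((3 / 7 : ℂ) • cyc) + X ^ 2 * C (t 2 • (cyc * cyc))
      + X ^ 5 * C (t 1 • (cyc * cyc)) + X ^ 6 * C (t 0 • cyc) := by
    ext1 n
    simp only [thetaS, coeff_mk, map_add, coeff_C, coeff_X_pow_mul']
    match n with
    | 0 => simp [thetaCoeff]
    | 1 => simp [thetaCoeff]
    | 2 => simp [thetaCoeff]
    | 3 => simp [thetaCoeff]
    | 4 => simp [thetaCoeff]
    | 5 => simp [thetaCoeff]
    | 6 => simp [thetaCoeff]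
    | n + 7 =>
      simp [thetaCoeff]
  have e1 (s : ℂ) (A : M3) (m : ℕ) :
      coeff m (F * C (s • A) * sInv F) = s • coeff m (F * C A * sInv F) := by
    rw [mul_assoc, mul_assoc, coeff_mul, coeff_mul, Finset.smul_sum]
    simp only [coeff_C_mul, Matrix.smul_mul, Matrix.mul_smul]
  have e2 (m : ℕ) (G : M3⟦X⟧) (hm : m ≤ n) :
      coeff n (F * (X ^ m * G) * sInv F) = coeff (n - m) (F * G * sInv F) := by
    have : F * (X ^ m * G) * sInv F = X ^ m * (F * G * sInv F) := by
      rw [← mul_assoc F, ← X_pow_mul]; simp only [mul_assoc]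
    rw [this, coeff_X_pow_mul', if_pos hm]
  rw [dressed_sq h, hθ, mul_add, mul_add, mul_add, add_mul, add_mul, add_mul, map_add, map_add,
    map_add, e2 2 _ (by omega), e2 5 _ (by omega), e2 6 _ (by omega), e1, e1, e1, e1, dressed]

/-! ### The dressed cyclic matrix is determined by its equation and its traces -/

/-- The commutant of `cyc` is spanned by `1, cyc, cyc²`, and the trace form is nondegenerate on it.
-/
lemma eq_zero_of_commutes_of_trace {A : M3} (h : cyc * A = A * cyc) (h0 : A.trace = 0)
    (h1 : (cyc * A).trace = 0) (h2 : (cyc * cyc * A).trace = 0) : A = 0 := by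
  have hA : A = !![A 0 0, A 0 1, A 0 2; A 1 0, A 1 1, A 1 2; A 2 0, A 2 1, A 2 2] :=
    Matrix.eta_fin_three A
  generalize A 0 0 = a00, A 0 1 = a01, A 0 2 = a02, A 1 0 = a10, A 1 1 = a11, A 1 2 = a12,
    A 2 0 = a20, A 2 1 = a21, A 2 2 = a22 at hA
  subst hA
  have hij := fun i j => congrFun (congrFun h i) j
  have q := fun i j => hij i j
  simp only [cyc_mul_cyc] at h2
  simp only [cyc, g1, g2, Matrix.mul_fin_three, Matrix.trace_fin_three] at h0 h1 h2 q
  have q00 := q 0 0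
  have q01 := q 0 1
  have q02 := q 0 2
  have q10 := q 1 0
  have q11 := q 1 1
  have q12 := q 1 2
  have q20 := q 2 0
  have q21 := q 2 1
  have q22 := q 2 2
  simp at q00 q01 q02 q10 q11 q12 q20 q21 q22 h0 h1 h2
  ext i j
  fin_cases i <;> fin_cases j <;> simp <;> grind

/-- In degree `n > 0` the top coefficients of the factors enter linearly, each multiplied by a
constant term; everything else is equal on the two sides. -/
lemma coeff_mul_sub {F G F' G' : M3⟦X⟧} {n : ℕ} (hn : n ≠ 0)
    (hF : ∀ m < n, coeff m F = coeff m F') (hG : ∀ m < n, coeff m G = coeff m G') :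
    coeff n (F * G) - coeff n (F' * G')
      = coeff 0 F * (coeff n G - coeff n G') + (coeff n F - coeff n F') * coeff 0 G := by
  obtain ⟨m, rfl⟩ := Nat.exists_eq_succ_of_ne_zero hn
  have e (F G : M3⟦X⟧) : coeff m.succ (F * G) = ∑ k ∈ Finset.range m,
      coeff (k + 1) F * coeff (m.succ - (k + 1)) G + coeff 0 F * coeff m.succ G
        + coeff m.succ F * coeff 0 G := by
    rw [coeff_mul_range', Finset.sum_range_succ, Finset.sum_range_succ', Nat.sub_self, Nat.sub_zero]
  have : ∑ k ∈ Finset.range m, coeff (k + 1) F * coeff (m.succ - (k + 1)) G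
      = ∑ k ∈ Finset.range m, coeff (k + 1) F' * coeff (m.succ - (k + 1)) G' := by
    refine Finset.sum_congr rfl fun k hk => ?_
    have := Finset.mem_range.1 hk
    rw [hF _ (by omega), hG _ (by omega)]
  rw [e, e, this, ← hF 0 (by omega), ← hG 0 (by omega)]
  noncomm_ring

/-- By induction, the difference `δ` of the coefficients of degree `n` commutes with `cyc`, since
the Euler term involves degree `n - 7` only. The equation alone leaves this commutant part
undetermined; the traces of the first three powers fix it. -/
lemma coeff_eq_of_dressed_eq {α K K' : M3⟦X⟧} {N : ℕ} (hα : coeff 0 α = cyc)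
    (h0 : coeff 0 K = cyc) (h0' : coeff 0 K' = cyc)
    (h : ∀ n ≤ N, coeff n (α * K - K * α + X ^ 7 * euler K) = 0)
    (h' : ∀ n ≤ N, coeff n (α * K' - K' * α + X ^ 7 * euler K') = 0)
    (h1 : ∀ n ≤ N, n ≠ 0 → trc n K = trc n K')
    (h2 : ∀ n ≤ N, n ≠ 0 → trc n (K * K) = trc n (K' * K'))
    (h3 : ∀ n ≤ N, n ≠ 0 → trc n (K * (K * K)) = trc n (K' * (K' * K'))) :
    ∀ n ≤ N, coeff n K = coeff n K' := by
  intro n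
  induction n using Nat.strong_induction_on with
  | _ n ih =>
    intro hn
    rcases eq_or_ne n 0 with rfl | hne
    · rw [h0, h0']
    have ih' : ∀ m < n, coeff m K = coeff m K' := fun m hm => ih m hm (by omega)
    set δ := coeff n K - coeff n K'
    have ihsq : ∀ m < n, coeff m (K * K) = coeff m (K' * K') := by
      intro m hm
      rw [coeff_mul_range', coeff_mul_range']
      refine Finset.sum_congr rfl fun k hk => ?_
      have := Finset.mem_range.1 hk
      rw [ih' _ (by omega), ih' _ (by omega)]
    have hc : cyc * δ = δ * cyc := by
      have e1 := coeff_mul_sub (F := α) (F' := α) hne (fun _ _ => rfl) ih'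
      have e2 := coeff_mul_sub (G := α) (G' := α) hne ih' (fun _ _ => rfl)
      have e3 : coeff n (X ^ 7 * euler K) = coeff n (X ^ 7 * euler K') := by
        rw [coeff_X_pow_mul', coeff_X_pow_mul']
        split_ifs with h7
        · rw [coeff_euler, coeff_euler, ih' _ (by omega)]
        · rfl
      have e4 := h n hn
      have e5 := h' n hn
      rw [map_add, map_sub] at e4 e5
      rw [sub_self, zero_mul, add_zero, hα] at e1
      rw [sub_self, mul_zero, zero_add, hα] at e2
      rw [← sub_eq_zero, ← e1, ← e2]
      calc _ = (coeff n (α * K) - coeff n (K * α) + coeff n (X ^ 7 * euler K))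
              - (coeff n (α * K') - coeff n (K' * α) + coeff n (X ^ 7 * euler K)) := by abel
        _ = 0 := by rw [e4, e3, e5, sub_zero]
    have s2 := coeff_mul_sub hne ih' ih'
    have s3 := coeff_mul_sub hne ih' ihsq
    have t1 : δ.trace = 0 := by
      rw [Matrix.trace_sub, sub_eq_zero]
      exact h1 n hn hne
    have t2 : (cyc * δ).trace = 0 := by
      have e := congrArg Matrix.trace s2
      have e' := h2 n hn hne
      rw [trc, trc] at e'
      rw [Matrix.trace_sub, e', sub_self, h0, ← hc, Matrix.trace_add] at e
      -- The linearization of `tr K²` at `cyc` is `2 tr (cyc δ)`; for `tr K³` below it is `3 tr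
      -- (cyc² δ)`.
      linear_combination -(1 / 2) * e
    have t3 : (cyc * cyc * δ).trace = 0 := by
      have e := congrArg Matrix.trace s3
      have e' := h3 n hn hne
      rw [trc, trc] at e'
      rw [s2, Matrix.trace_sub, e', sub_self, h0, coeff_zero_mul, h0, ← hc, ← mul_assoc δ, ← hc,
        mul_assoc, ← hc, mul_add, ← mul_assoc, Matrix.trace_add, Matrix.trace_add] at e
      linear_combination -(1 / 3) * e
    exact sub_eq_zero.1 (eq_zero_of_commutes_of_trace hc t1 t2 t3)

/-! ### The dressed cyclic matrix, explicitly -/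

/-! Entries of the first coefficients of the dressed cyclic matrix and of its square, as polynomials in
the times `x, y, s` and the canonical coordinates `u, v, w` and `p, q, r`. -/

def kap2 (x y s u v w p q r : ℂ) : ℂ :=
  1 / 3 * s + 1 / 4 * u

/-- Reflection of a matrix in its antidiagonal reverses products, and together with the sign change
of `w, p, q` it fixes the coefficients of `α` below degree 7. It therefore exchanges two entries of
each coefficient up to these signs; only one of the two is recorded. The `Mid` entries are those on
the antidiagonal. -/
def kapMid2 (x y s u v w p q r : ℂ) : ℂ :=
  -2 / 3 * s - 1 / 2 * u

def kap3 (x y s u v w p q r : ℂ) : ℂ :=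
  1 / 2 * v - 1 / 4 * w

def kapMid3 (x y s u v w p q r : ℂ) : ℂ :=
  -v

def kap4 (x y s u v w p q r : ℂ) : ℂ :=
  7 / 18 * s ^ 2 + 1 / 6 * s * u + 1 / 8 * u ^ 2 + 1 / 2 * q - r

def kapMid4 (x y s u v w p q r : ℂ) : ℂ :=
  -7 / 9 * s ^ 2 - 1 / 3 * s * u - 1 / 4 * u ^ 2 + 2 * r

def kap5 (x y s u v w p q r : ℂ) : ℂ :=
  1 / 3 * y + 1 / 3 * s * v - 1 / 6 * s * w - 3 / 8 * u * v + 5 / 16 * u * w - p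

def kapMid5 (x y s u v w p q r : ℂ) : ℂ :=
  -2 / 3 * y - 5 / 3 * s * v

def kap6 (x y s u v w p q r : ℂ) : ℂ :=
  -1 / 3 * x + 55 / 54 * s ^ 3 + 5 / 6 * s ^ 2 * u + 5 / 12 * s * u ^ 2 - 5 / 6 * s * q - 5 / 3 * s * r

def kapMid6 (x y s u v w p q r : ℂ) : ℂ :=
  2 / 3 * x - 32 / 27 * s ^ 3 - 7 / 12 * s ^ 2 * u - 5 / 24 * s * u ^ 2 + 4 / 3 * s * r + 7 / 32 * u ^ 3
    - 3 / 2 * u * r + 3 / 4 * v ^ 2 + 1 / 16 * w ^ 2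

/-- The argument `h` marks the terms caused by the Euler term and by the degree 7 coefficient of
`α`. The reflection in the antidiagonal reverses the sign of both relative to the commutator, so `h`
is `1` for an entry and `-1` for its mirror image. -/
def kap7 (x y s u v w p q r h : ℂ) : ℂ :=
  7 / 9 * y * s + 1 / 6 * y * u + 5 / 6 * s ^ 2 * v + 5 / 12 * s ^ 2 * w - 5 / 12 * s * u * v - 5 / 12 * s * u * w
    + 5 / 3 * s * p - h * (1 / 3)

def kapMid7 (x y s u v w p q r : ℂ) : ℂ :=
  -14 / 9 * y * s - 1 / 3 * y * u - 5 / 3 * s ^ 2 * v + 5 / 6 * s * u * v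

def kap8 (x y s u v w p q r : ℂ) : ℂ :=
  -4 / 9 * x * s + 1 / 12 * x * u - 1 / 6 * y * w + 119 / 324 * s ^ 4 - 181 / 648 * s ^ 3 * u - 7 / 24 * s ^ 2 * u ^ 2
    - 5 / 3 * s ^ 2 * q + 1 / 3 * s ^ 2 * r - 13 / 48 * s * u ^ 3 - 5 / 24 * s * u * q + 7 / 4 * s * u * r
    - 1 / 2 * s * v ^ 2 + 5 / 12 * s * v * w - 1 / 12 * s * w ^ 2 + 1 / 48 * u ^ 4 + 1 / 4 * u * v ^ 2
    + 1 / 16 * u * w ^ 2 - 1 / 6 * w * p - 1 / 12 * q ^ 2 - r ^ 2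

def kapMid8 (x y s u v w p q r : ℂ) : ℂ :=
  14 / 9 * x * s + 1 / 3 * x * u - y * v - 287 / 108 * s ^ 4 - 152 / 81 * s ^ 3 * u - 11 / 12 * s ^ 2 * u ^ 2
    + 11 / 3 * s ^ 2 * r + 1 / 4 * s * u ^ 3 - 2 * s * u * r - 1 / 2 * s * v ^ 2 + 1 / 8 * s * w ^ 2
    + 1 / 48 * u ^ 4 + 1 / 4 * u * v ^ 2 + 1 / 16 * u * w ^ 2 - 1 / 6 * w * p - 1 / 12 * q ^ 2 - r ^ 2

def kap9 (x y s u v w p q r h : ℂ) : ℂ :=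
  -1 / 2 * x * v + 1 / 12 * x * w + 77 / 27 * y * s ^ 2 + 3 / 2 * y * s * u + 1 / 3 * y * u ^ 2 - 1 / 3 * y * q
    - 4 / 3 * y * r + 1105 / 324 * s ^ 3 * v - 145 / 216 * s ^ 3 * w + 5 / 12 * s ^ 2 * u * w - 5 / 3 * s ^ 2 * p
    - 7 / 24 * s * u ^ 2 * v - 5 / 16 * s * u ^ 2 * w + 5 / 6 * s * u * p - 5 / 12 * s * v * q - 7 / 6 * s * v * r
    + 7 / 24 * s * w * q + 5 / 12 * s * w * r - 1 / 6 * u ^ 3 * v + u * v * r - 1 / 12 * u * w * q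
    - 1 / 6 * v ^ 3 - 1 / 24 * v * w ^ 2 + 1 / 3 * p * q + h * (7 / 9 * s + 1 / 6 * u)

def kapMid9 (x y s u v w p q r : ℂ) : ℂ :=
  -85 / 27 * y * s ^ 2 - 5 / 6 * y * s * u - 1 / 24 * y * u ^ 2 + 2 / 3 * y * r - 235 / 162 * s ^ 3 * v
    + 25 / 12 * s ^ 2 * u * v + 31 / 48 * s * u ^ 2 * v - 11 / 3 * s * v * r + 1 / 12 * s * w * q
    - 1 / 6 * u ^ 3 * v + u * v * r - 1 / 12 * u * w * q - 1 / 6 * v ^ 3 - 1 / 24 * v * w ^ 2 + 1 / 3 * p * q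

def kap10 (x y s u v w p q r h : ℂ) : ℂ :=
  -61 / 54 * x * s ^ 2 - 1 / 6 * x * s * u - 1 / 12 * x * u ^ 2 - 1 / 6 * x * q + 1 / 3 * x * r + 2 / 9 * y ^ 2
    + 13 / 18 * y * s * v + 7 / 12 * y * s * w - 1 / 12 * y * u * v - 1 / 6 * y * u * w + 2 / 3 * y * p
    + 419 / 243 * s ^ 5 + 3595 / 3888 * s ^ 4 * u + 367 / 648 * s ^ 3 * u ^ 2 + 70 / 27 * s ^ 3 * q
    - 83 / 27 * s ^ 3 * r - 19 / 144 * s ^ 2 * u ^ 3 + 5 / 12 * s ^ 2 * u * q + 41 / 36 * s ^ 2 * u * r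
    - 19 / 36 * s ^ 2 * v ^ 2 - 5 / 12 * s ^ 2 * v * w - 11 / 144 * s ^ 2 * w ^ 2 + 5 / 72 * s * u ^ 4
    - 5 / 24 * s * u ^ 2 * q - 3 / 4 * s * u ^ 2 * r + 1 / 24 * s * u * v ^ 2 - 5 / 12 * s * u * v * w
    - 5 / 96 * s * u * w ^ 2 + 5 / 6 * s * v * p + 7 / 36 * s * w * p - 1 / 9 * s * q ^ 2 + 5 / 3 * s * q * r
    + 2 * s * r ^ 2 - 1 / 192 * u ^ 5 - 1 / 16 * u ^ 2 * v ^ 2 - 1 / 64 * u ^ 2 * w ^ 2 + 1 / 24 * u * w * p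
    + 1 / 48 * u * q ^ 2 + 1 / 4 * u * r ^ 2 + h * (-1 / 2 * v + 1 / 12 * w)

def kapMid10 (x y s u v w p q r : ℂ) : ℂ :=
  61 / 27 * x * s ^ 2 + 1 / 3 * x * s * u + 1 / 6 * x * u ^ 2 - 2 / 3 * x * r - 4 / 9 * y ^ 2 - 13 / 9 * y * s * v
    + 1 / 6 * y * u * v - 838 / 243 * s ^ 5 - 3595 / 1944 * s ^ 4 * u - 367 / 324 * s ^ 3 * u ^ 2
    + 166 / 27 * s ^ 3 * r + 19 / 72 * s ^ 2 * u ^ 3 - 41 / 18 * s ^ 2 * u * r + 19 / 18 * s ^ 2 * v ^ 2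
    + 11 / 72 * s ^ 2 * w ^ 2 - 5 / 36 * s * u ^ 4 + 3 / 2 * s * u ^ 2 * r - 1 / 12 * s * u * v ^ 2
    + 5 / 48 * s * u * w ^ 2 - 7 / 18 * s * w * p + 2 / 9 * s * q ^ 2 - 4 * s * r ^ 2 + 1 / 96 * u ^ 5
    + 1 / 8 * u ^ 2 * v ^ 2 + 1 / 32 * u ^ 2 * w ^ 2 - 1 / 12 * u * w * p - 1 / 24 * u * q ^ 2 - 1 / 2 * u * r ^ 2
    - 1 / 6 * w

def kap11 (x y s u v w p q r h : ℂ) : ℂ :=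
  -1 / 9 * x * y - 1 / 18 * x * s * v - 1 / 36 * x * s * w - 1 / 24 * x * u * v - 1 / 16 * x * u * w
    + 1 / 3 * x * p + 43 / 54 * y * s ^ 3 - 109 / 108 * y * s ^ 2 * u - 41 / 72 * y * s * u ^ 2 - 3 / 2 * y * s * q
    + 13 / 9 * y * s * r - 1 / 12 * y * u ^ 3 - 1 / 12 * y * u * q + 2 / 3 * y * u * r + 1 / 12 * y * v * w
    - 1 / 24 * y * w ^ 2 - 727 / 1944 * s ^ 4 * v - 1291 / 1296 * s ^ 4 * w - 1909 / 1296 * s ^ 3 * u * v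
    + 2909 / 2592 * s ^ 3 * u * w - 235 / 54 * s ^ 3 * p + 2 / 9 * s ^ 2 * u ^ 2 * v - 11 / 48 * s ^ 2 * u ^ 2 * w
    + 5 / 12 * s ^ 2 * u * p + 5 / 12 * s ^ 2 * v * q + 35 / 9 * s ^ 2 * v * r - 43 / 72 * s ^ 2 * w * q
    + 1 / 2 * s ^ 2 * w * r + 137 / 288 * s * u ^ 3 * v - 1 / 64 * s * u ^ 3 * w - 5 / 24 * s * u ^ 2 * p
    + 5 / 16 * s * u * v * q - 65 / 24 * s * u * v * r + 43 / 288 * s * u * w * q + 1 / 48 * s * u * w * r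
    + 7 / 36 * s * v ^ 3 - 1 / 3 * s * v ^ 2 * w + 19 / 144 * s * v * w ^ 2 - 1 / 48 * s * w ^ 3
    - 13 / 18 * s * p * q + 5 / 3 * s * p * r - 5 / 96 * u ^ 4 * v + 1 / 192 * u ^ 4 * w + 1 / 4 * u ^ 2 * v * r
    - 1 / 48 * u ^ 2 * w * q - 1 / 6 * u * v ^ 3 + 1 / 16 * u * v ^ 2 * w - 1 / 24 * u * v * w ^ 2
    + 1 / 64 * u * w ^ 3 + 1 / 12 * u * p * q + 1 / 12 * v * w * p + 1 / 24 * v * q ^ 2 + 1 / 2 * v * r ^ 2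
    - 1 / 24 * w ^ 2 * p - 1 / 48 * w * q ^ 2 - 1 / 4 * w * r ^ 2 + h * (56 / 27 * s ^ 2 + 3 / 4 * s * u
    + 5 / 24 * u ^ 2 + 1 / 3 * q - 4 / 3 * r)

def kapMid11 (x y s u v w p q r : ℂ) : ℂ :=
  8 / 9 * x * y + 34 / 9 * x * s * v + 1 / 3 * x * u * v - 719 / 81 * y * s ^ 3 - 251 / 54 * y * s ^ 2 * u
    - 13 / 9 * y * s * u ^ 2 + 46 / 9 * y * s * r - 1 / 3 * y * u * r - 1 / 2 * y * v ^ 2 + 1 / 24 * y * w ^ 2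
    - 9833 / 972 * s ^ 4 * v - 103 / 324 * s ^ 3 * u * v + 7 / 18 * s ^ 2 * u ^ 2 * v + 20 / 9 * s ^ 2 * v * r
    - 17 / 36 * s ^ 2 * w * q + 37 / 36 * s * u ^ 3 * v - 35 / 6 * s * u * v * r + 31 / 72 * s * u * w * q
    + 31 / 36 * s * v ^ 3 + 37 / 144 * s * v * w ^ 2 - 17 / 9 * s * p * q + 5 / 48 * u ^ 4 * v - 1 / 2 * u ^ 2 * v * r
    + 1 / 24 * u ^ 2 * w * q + 1 / 3 * u * v ^ 3 + 1 / 12 * u * v * w ^ 2 - 1 / 6 * u * p * q - 1 / 6 * v * w * p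
    - 1 / 12 * v * q ^ 2 - v * r ^ 2 - 1 / 3 * q

def kap12 (x y s u v w p q r h : ℂ) : ℂ :=
  2 / 9 * x ^ 2 - 719 / 162 * x * s ^ 3 - 251 / 108 * x * s ^ 2 * u - 13 / 18 * x * s * u ^ 2 + 17 / 18 * x * s * q
    + 23 / 9 * x * s * r + 1 / 12 * x * u * q - 1 / 6 * x * u * r - 1 / 4 * x * v ^ 2 + 1 / 12 * x * v * w
    + 1 / 48 * x * w ^ 2 + 53 / 27 * y ^ 2 * s + 1 / 2 * y ^ 2 * u + 176 / 27 * y * s ^ 2 * v - 35 / 27 * y * s ^ 2 * w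
    + 1 / 3 * y * s * u * v + 1 / 12 * y * s * u * w - 2 / 3 * y * s * p - 1 / 6 * y * u ^ 2 * w
    + 1 / 3 * y * u * p - 1 / 3 * y * v * q - 4 / 3 * y * v * r + 1 / 6 * y * w * q + 1 / 3 * y * w * r
    + 11425 / 1944 * s ^ 6 + 7315 / 1458 * s ^ 5 * u + 199 / 72 * s ^ 4 * u ^ 2 - 847 / 216 * s ^ 4 * q
    - 3533 / 324 * s ^ 4 * r - 113 / 432 * s ^ 3 * u ^ 3 - 19 / 324 * s ^ 3 * u * q + 179 / 81 * s ^ 3 * u * r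
    + 205 / 216 * s ^ 3 * v ^ 2 - 65 / 648 * s ^ 3 * v * w - 377 / 2592 * s ^ 3 * w ^ 2 - 167 / 864 * s ^ 2 * u ^ 4
    - 1 / 24 * s ^ 2 * u ^ 2 * q + 1 / 4 * s ^ 2 * u ^ 2 * r - 155 / 72 * s ^ 2 * u * v ^ 2 - 143 / 288 * s ^ 2 * u * w ^ 2
    + 35 / 27 * s ^ 2 * w * p + 167 / 216 * s ^ 2 * q ^ 2 + 1 / 6 * s ^ 2 * q * r + 137 / 18 * s ^ 2 * r ^ 2
    - 5 / 96 * s * u ^ 5 + 1 / 48 * s * u ^ 3 * q + 11 / 24 * s * u ^ 3 * r - 13 / 48 * s * u ^ 2 * v ^ 2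
    + 1 / 48 * s * u ^ 2 * v * w - 5 / 192 * s * u ^ 2 * w ^ 2 - 1 / 12 * s * u * w * p + 1 / 12 * s * u * q ^ 2
    - 1 / 6 * s * u * q * r - 2 / 3 * s * u * r ^ 2 - 1 / 24 * s * v ^ 2 * q + 7 / 12 * s * v ^ 2 * r
    - 1 / 24 * s * v * w * q + 1 / 12 * s * v * w * r - 1 / 96 * s * w ^ 2 * q + 1 / 16 * s * w ^ 2 * r
    + 1 / 3 * s * p ^ 2 + 1 / 192 * u ^ 6 + 1 / 96 * u ^ 4 * q - 7 / 48 * u ^ 4 * r - 1 / 8 * u ^ 3 * v ^ 2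
    + 1 / 24 * u ^ 3 * v * w - 1 / 32 * u ^ 3 * w ^ 2 + 1 / 6 * u ^ 2 * w * p + u ^ 2 * r ^ 2 + 1 / 8 * u * v ^ 2 * q
    + 3 / 4 * u * v ^ 2 * r - 1 / 8 * u * v * w * q - 1 / 4 * u * v * w * r + 5 / 96 * u * w ^ 2 * q
    + 1 / 16 * u * w ^ 2 * r - 1 / 6 * u * p ^ 2 - 7 / 48 * v ^ 4 + 1 / 24 * v ^ 3 * w - 1 / 96 * v ^ 2 * w ^ 2
    + 1 / 96 * v * w ^ 3 + 1 / 3 * v * p * q + 1 / 768 * w ^ 4 - 1 / 6 * w * p * q - 1 / 3 * w * p * r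
    - 1 / 24 * q ^ 3 + 1 / 12 * q ^ 2 * r - 1 / 2 * q * r ^ 2 - 5 / 3 * r ^ 3 + h * (7 / 9 * y + 37 / 18 * s * v
    + 1 / 12 * s * w - 1 / 3 * u * v - 1 / 12 * u * w + 1 / 3 * p)

def kapMid12 (x y s u v w p q r : ℂ) : ℂ :=
  -1 / 9 * x ^ 2 + 94 / 27 * x * s ^ 3 + 61 / 108 * x * s ^ 2 * u - 1 / 72 * x * s * u ^ 2 + 8 / 9 * x * s * r
    + 1 / 48 * x * u ^ 3 - 1 / 6 * x * u * r - 46 / 27 * y ^ 2 * s - 1 / 6 * y ^ 2 * u - 23 / 54 * y * s ^ 2 * v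
    + 19 / 12 * y * s * u * v - 1 / 16 * y * u ^ 2 * v - 1 / 3 * y * v * r + 1 / 12 * y * w * q - 6343 / 1458 * s ^ 6
    - 1063 / 729 * s ^ 5 * u - 319 / 1728 * s ^ 4 * u ^ 2 + 101 / 27 * s ^ 4 * r + 407 / 432 * s ^ 3 * u ^ 3
    - 1007 / 162 * s ^ 3 * u * r + 133 / 36 * s ^ 3 * v ^ 2 + 407 / 1296 * s ^ 3 * w ^ 2 - 199 / 1728 * s ^ 2 * u ^ 4
    + 47 / 48 * s ^ 2 * u ^ 2 * r - 67 / 36 * s ^ 2 * u * v ^ 2 - 5 / 72 * s ^ 2 * u * w ^ 2 + 23 / 108 * s ^ 2 * w * p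
    + 35 / 54 * s ^ 2 * q ^ 2 - 14 / 9 * s ^ 2 * r ^ 2 - 19 / 192 * s * u ^ 5 + 3 / 2 * s * u ^ 3 * r
    - 47 / 96 * s * u ^ 2 * v ^ 2 + 71 / 384 * s * u ^ 2 * w ^ 2 - 31 / 24 * s * u * w * p - 17 / 3 * s * u * r ^ 2
    + 23 / 6 * s * v ^ 2 * r - 1 / 6 * s * v * w * q + 5 / 24 * s * w ^ 2 * r - 5 / 9 * s * w + 2 * s * p ^ 2
    + 13 / 768 * u ^ 6 - 5 / 24 * u ^ 4 * r + 17 / 64 * u ^ 3 * v ^ 2 + 1 / 256 * u ^ 3 * w ^ 2 + 7 / 96 * u ^ 2 * w * p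
    - 3 / 64 * u ^ 2 * q ^ 2 + 7 / 16 * u ^ 2 * r ^ 2 - 3 / 2 * u * v ^ 2 * r - 1 / 8 * u * w ^ 2 * r
    + 3 / 8 * u * w - 1 / 6 * u * p ^ 2 + 5 / 48 * v ^ 4 + 5 / 96 * v ^ 2 * w ^ 2 - 1 / 6 * v * p * q
    + 1 / 768 * w ^ 4 + 1 / 6 * w * p * r - 4 / 3 * p + 1 / 3 * q ^ 2 * r + 4 / 3 * r ^ 3

def kapSq2 (x y s u v w p q r : ℂ) : ℂ :=
  -1 / 3 * s - 1 / 4 * u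

def kapSqMid2 (x y s u v w p q r : ℂ) : ℂ :=
  2 / 3 * s + 1 / 2 * u

def kapSq3 (x y s u v w p q r : ℂ) : ℂ :=
  -1 / 2 * v + 1 / 4 * w

def kapSqMid3 (x y s u v w p q r : ℂ) : ℂ :=
  v

def kapSq4 (x y s u v w p q r : ℂ) : ℂ :=
  -11 / 18 * s ^ 2 - 1 / 2 * s * u - 1 / 4 * u ^ 2 + 1 / 2 * q + r

def kapSqMid4 (x y s u v w p q r : ℂ) : ℂ :=
  8 / 9 * s ^ 2 + 1 / 2 * s * u + 5 / 16 * u ^ 2 - 2 * r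

def kapSq5 (x y s u v w p q r : ℂ) : ℂ :=
  -1 / 3 * y - 1 / 2 * s * v - 1 / 4 * s * w + 1 / 4 * u * v + 1 / 4 * u * w - p

def kapSqMid5 (x y s u v w p q r : ℂ) : ℂ :=
  2 / 3 * y + s * v - 1 / 2 * u * v

def kapSq6 (x y s u v w p q r : ℂ) : ℂ :=
  1 / 3 * x - 8 / 27 * s ^ 3 + 7 / 72 * s ^ 2 * u + 1 / 8 * s * u ^ 2 + s * q + 3 / 16 * u ^ 3 + 1 / 8 * u * q
    - 5 / 4 * u * r + 1 / 4 * v ^ 2 - 1 / 4 * v * w + 1 / 16 * w ^ 2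

def kapSqMid6 (x y s u v w p q r : ℂ) : ℂ :=
  -2 / 3 * x + 41 / 27 * s ^ 3 + 19 / 18 * s ^ 2 * u + 1 / 2 * s * u ^ 2 - 2 * s * r - 1 / 8 * u ^ 3
    + u * r + 1 / 4 * v ^ 2 - 1 / 16 * w ^ 2

def kapSq7 (x y s u v w p q r h : ℂ) : ℂ :=
  -11 / 9 * y * s - 1 / 2 * y * u - 65 / 36 * s ^ 2 * v + 29 / 72 * s ^ 2 * w - 1 / 4 * s * u * w
    + s * p + 1 / 8 * u ^ 2 * v + 3 / 16 * u ^ 2 * w - 1 / 2 * u * p + 1 / 4 * v * q + 1 / 2 * v * r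
    - 1 / 8 * w * q - 1 / 4 * w * r - h * (1 / 3)

def kapSqMid7 (x y s u v w p q r : ℂ) : ℂ :=
  16 / 9 * y * s + 1 / 2 * y * u + 10 / 9 * s ^ 2 * v - 5 / 4 * s * u * v - 7 / 16 * u ^ 2 * v + 2 * v * r

def kapSq8 (x y s u v w p q r : ℂ) : ℂ :=
  5 / 9 * x * s - 1 / 6 * y * v - 1 / 4 * y * w - 109 / 108 * s ^ 4 - 83 / 162 * s ^ 3 * u - 11 / 36 * s ^ 2 * u ^ 2
    - 14 / 9 * s ^ 2 * q + 16 / 9 * s ^ 2 * r + 1 / 12 * s * u ^ 3 - 1 / 4 * s * u * q - 2 / 3 * s * u * r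
    + 1 / 3 * s * v ^ 2 + 1 / 4 * s * v * w + 1 / 24 * s * w ^ 2 - 5 / 96 * u ^ 4 + 1 / 8 * u ^ 2 * q
    + 1 / 2 * u ^ 2 * r - 1 / 16 * u * v ^ 2 + 1 / 4 * u * v * w + 1 / 64 * u * w ^ 2 - 1 / 2 * v * p
    - 1 / 12 * w * p + 1 / 12 * q ^ 2 - q * r - r ^ 2

def kapSqMid8 (x y s u v w p q r : ℂ) : ℂ :=
  -10 / 9 * x * s + 1 / 3 * y * v + 109 / 54 * s ^ 4 + 83 / 81 * s ^ 3 * u + 11 / 18 * s ^ 2 * u ^ 2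
    - 32 / 9 * s ^ 2 * r - 1 / 6 * s * u ^ 3 + 4 / 3 * s * u * r - 2 / 3 * s * v ^ 2 - 1 / 12 * s * w ^ 2
    + 5 / 48 * u ^ 4 - u ^ 2 * r + 1 / 8 * u * v ^ 2 - 1 / 32 * u * w ^ 2 + 1 / 6 * w * p - 1 / 6 * q ^ 2
    + 2 * r ^ 2

def kapSq9 (x y s u v w p q r h : ℂ) : ℂ :=
  1 / 6 * x * v + 1 / 12 * x * w - 37 / 54 * y * s ^ 2 + 13 / 36 * y * s * u + 5 / 24 * y * u ^ 2
    + 1 / 2 * y * q - 1 / 3 * y * r - 19 / 324 * s ^ 3 * v + 125 / 216 * s ^ 3 * w + 47 / 48 * s ^ 2 * u * v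
    - 199 / 288 * s ^ 2 * u * w + 47 / 18 * s ^ 2 * p - 1 / 24 * s * u ^ 2 * v + 1 / 8 * s * u ^ 2 * w
    - 1 / 4 * s * u * p - 1 / 4 * s * v * q - 13 / 6 * s * v * r + 7 / 24 * s * w * q - 1 / 4 * s * w * r
    - 17 / 96 * u ^ 3 * v + 1 / 64 * u ^ 3 * w + 1 / 8 * u ^ 2 * p - 3 / 16 * u * v * q + 7 / 8 * u * v * r
    - 1 / 96 * u * w * q - 1 / 16 * u * w * r + 1 / 24 * v ^ 3 + 3 / 16 * v ^ 2 * w - 5 / 96 * v * w ^ 2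
    + 1 / 64 * w ^ 3 + 1 / 6 * p * q - p * r + h * (-8 / 9 * s - 1 / 4 * u)

def kapSqMid9 (x y s u v w p q r : ℂ) : ℂ :=
  -4 / 3 * x * v + 112 / 27 * y * s ^ 2 + 16 / 9 * y * s * u + 1 / 3 * y * u ^ 2 - 4 / 3 * y * r
    + 440 / 81 * s ^ 3 * v - 1 / 6 * s * u ^ 2 * v - 2 / 3 * s * v * r + 1 / 6 * s * w * q - 1 / 3 * u ^ 3 * v
    + 2 * u * v * r - 1 / 6 * u * w * q - 1 / 3 * v ^ 3 - 1 / 12 * v * w ^ 2 + 2 / 3 * p * q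

def kapSq10 (x y s u v w p q r h : ℂ) : ℂ :=
  56 / 27 * x * s ^ 2 + 8 / 9 * x * s * u + 1 / 6 * x * u ^ 2 - 1 / 3 * x * q - 2 / 3 * x * r - 4 / 9 * y ^ 2
    - 20 / 9 * y * s * v + 5 / 9 * y * s * w - 790 / 243 * s ^ 5 - 1315 / 486 * s ^ 4 * u - 155 / 108 * s ^ 3 * u ^ 2
    + 125 / 54 * s ^ 3 * q + 155 / 27 * s ^ 3 * r + 5 / 36 * s ^ 2 * u ^ 3 - 10 / 9 * s ^ 2 * u * r
    - 5 / 18 * s ^ 2 * v ^ 2 + 5 / 72 * s ^ 2 * w ^ 2 + 5 / 72 * s * u ^ 4 + 5 / 6 * s * u * v ^ 2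
    + 5 / 24 * s * u * w ^ 2 - 5 / 9 * s * w * p - 5 / 18 * s * q ^ 2 - 10 / 3 * s * r ^ 2 - h * (2 / 3 * v)

def kapSqMid10 (x y s u v w p q r : ℂ) : ℂ :=
  -55 / 27 * x * s ^ 2 - 5 / 18 * x * s * u + 1 / 24 * x * u ^ 2 - 2 / 3 * x * r + 5 / 9 * y ^ 2
    + 1 / 9 * y * s * v - 3 / 4 * y * u * v + 449 / 162 * s ^ 5 + 485 / 486 * s ^ 4 * u + 7 / 48 * s ^ 3 * u ^ 2
    - 68 / 27 * s ^ 3 * r - 61 / 96 * s ^ 2 * u ^ 3 + 73 / 18 * s ^ 2 * u * r - 85 / 36 * s ^ 2 * v ^ 2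
    - 3 / 16 * s ^ 2 * w ^ 2 + 11 / 288 * s * u ^ 4 - 3 / 8 * s * u ^ 2 * r + 5 / 6 * s * u * v ^ 2
    + 1 / 48 * s * u * w ^ 2 - 1 / 18 * s * w * p - 5 / 18 * s * q ^ 2 + 2 / 3 * s * r ^ 2 + 7 / 128 * u ^ 5
    - 13 / 16 * u ^ 3 * r + 21 / 64 * u ^ 2 * v ^ 2 - 21 / 256 * u ^ 2 * w ^ 2 + 5 / 8 * u * w * p
    + 3 * u * r ^ 2 - 3 / 2 * v ^ 2 * r - 1 / 8 * w ^ 2 * r + 1 / 6 * w - p ^ 2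

def kapSq11 (x y s u v w p q r h : ℂ) : ℂ :=
  2 / 9 * x * y + 5 / 9 * x * s * v + 1 / 6 * x * s * w - 1 / 6 * x * u * w + 2 / 3 * x * p - 89 / 27 * y * s ^ 3
    - 34 / 27 * y * s ^ 2 * u - 5 / 9 * y * s * u ^ 2 - 10 / 9 * y * s * q + 8 / 3 * y * s * r - 1 / 12 * y * u ^ 3
    + 1 / 3 * y * u * r - 1255 / 486 * s ^ 4 * v - 125 / 108 * s ^ 4 * w + 155 / 162 * s ^ 3 * u * v
    + 125 / 108 * s ^ 3 * u * w - 125 / 27 * s ^ 3 * p + 1 / 18 * s ^ 2 * u ^ 2 * v + 2 / 9 * s ^ 2 * v * r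
    - 1 / 18 * s ^ 2 * w * q + 11 / 72 * s * u ^ 3 * v - 1 / 2 * s * u * v * r + 1 / 72 * s * u * w * q
    + 1 / 9 * s * v ^ 3 + 1 / 36 * s * v * w ^ 2 - 2 / 9 * s * p * q + 1 / 12 * u ^ 4 * v - 1 / 2 * u ^ 2 * v * r
    + 1 / 24 * u ^ 2 * w * q + 1 / 12 * u * v ^ 3 + 1 / 48 * u * v * w ^ 2 - 1 / 6 * u * p * q + h * (56 / 27 * s ^ 2
    + 8 / 9 * s * u + 1 / 6 * u ^ 2 - 1 / 3 * q - 2 / 3 * r)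

def kapSqMid11 (x y s u v w p q r : ℂ) : ℂ :=
  -4 / 9 * x * y - 10 / 9 * x * s * v + 178 / 27 * y * s ^ 3 + 68 / 27 * y * s ^ 2 * u + 10 / 9 * y * s * u ^ 2
    - 16 / 3 * y * s * r + 1 / 6 * y * u ^ 3 - 2 / 3 * y * u * r + 1255 / 243 * s ^ 4 * v - 155 / 81 * s ^ 3 * u * v
    - 1 / 9 * s ^ 2 * u ^ 2 * v - 4 / 9 * s ^ 2 * v * r + 1 / 9 * s ^ 2 * w * q - 11 / 36 * s * u ^ 3 * v
    + s * u * v * r - 1 / 36 * s * u * w * q - 2 / 9 * s * v ^ 3 - 1 / 18 * s * v * w ^ 2 + 4 / 9 * s * p * q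
    - 1 / 6 * u ^ 4 * v + u ^ 2 * v * r - 1 / 12 * u ^ 2 * w * q - 1 / 6 * u * v ^ 3 - 1 / 24 * u * v * w ^ 2
    + 1 / 3 * u * p * q + 2 / 3 * q

def kapSq12 (x y s u v w p q r h : ℂ) : ℂ :=
  -1 / 9 * x ^ 2 + 2 / 3 * x * s ^ 3 - 17 / 27 * x * s ^ 2 * u - 5 / 18 * x * s * u ^ 2 - 2 / 3 * x * s * q
    + 4 / 3 * x * s * r - 1 / 24 * x * u ^ 3 - 1 / 12 * x * u * q + 1 / 6 * x * u * r - 2 / 27 * y ^ 2 * s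
    + 2 / 9 * y ^ 2 * u + 8 / 9 * y * s ^ 2 * v + 28 / 27 * y * s ^ 2 * w + 2 / 9 * y * s * u * v
    - 19 / 36 * y * s * u * w + 20 / 9 * y * s * p - 1 / 3 * y * u ^ 2 * v + 1 / 12 * y * u ^ 2 * w
    + 1 / 6 * y * w * q - 1 / 3 * y * w * r - 43 / 108 * s ^ 6 + 937 / 729 * s ^ 5 * u + 1051 / 972 * s ^ 4 * u ^ 2
    + 125 / 27 * s ^ 4 * q - 208 / 81 * s ^ 4 * r + 749 / 1296 * s ^ 3 * u ^ 3 + 125 / 216 * s ^ 3 * u * q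
    - 1321 / 324 * s ^ 3 * u * r + 221 / 162 * s ^ 3 * v ^ 2 - 155 / 162 * s ^ 3 * v * w + 143 / 648 * s ^ 3 * w ^ 2
    - 7 / 54 * s ^ 2 * u ^ 4 + 2 / 9 * s ^ 2 * u ^ 2 * r - 43 / 24 * s ^ 2 * u * v ^ 2 - 83 / 288 * s ^ 2 * u * w ^ 2
    + 22 / 27 * s ^ 2 * w * p + 71 / 108 * s ^ 2 * q ^ 2 + 35 / 9 * s ^ 2 * r ^ 2 - 13 / 288 * s * u ^ 5
    + 2 / 3 * s * u ^ 3 * r + 1 / 24 * s * u ^ 2 * v ^ 2 - 1 / 24 * s * u ^ 2 * v * w + 7 / 96 * s * u ^ 2 * w ^ 2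
    - 17 / 36 * s * u * w * p + 1 / 72 * s * u * q ^ 2 - 5 / 2 * s * u * r ^ 2 + 2 * s * v ^ 2 * r
    - 1 / 4 * s * v * w * q - 1 / 6 * s * v * w * r + 1 / 24 * s * w ^ 2 * q + 1 / 12 * s * w ^ 2 * r
    + 2 / 3 * s * p ^ 2 + 1 / 48 * u ^ 6 - 1 / 3 * u ^ 4 * r + 5 / 24 * u ^ 3 * v ^ 2 - 1 / 12 * u ^ 3 * v * w
    - 1 / 32 * u ^ 3 * w ^ 2 + 1 / 4 * u ^ 2 * w * p - 1 / 24 * u ^ 2 * q ^ 2 + 3 / 2 * u ^ 2 * r ^ 2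
    - u * v ^ 2 * r - 1 / 12 * u * v * w * q + 1 / 2 * u * v * w * r - 1 / 24 * u * w ^ 2 * q - 1 / 3 * u * p ^ 2
    + 1 / 24 * v ^ 4 - 1 / 12 * v ^ 3 * w + 1 / 16 * v ^ 2 * w ^ 2 - 1 / 48 * v * w ^ 3 + 1 / 384 * w ^ 4
    + 1 / 6 * w * p * q - 1 / 3 * w * p * r + 1 / 3 * q ^ 2 * r - 4 / 3 * r ^ 3 + h * (-8 / 9 * y
    - 14 / 9 * s * v - 4 / 9 * s * w + 1 / 2 * u * v + 1 / 6 * u * w - 2 / 3 * p)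

def kapSqMid12 (x y s u v w p q r : ℂ) : ℂ :=
  5 / 9 * x ^ 2 - 554 / 81 * x * s ^ 3 - 83 / 27 * x * s ^ 2 * u - 17 / 18 * x * s * u ^ 2 + 8 / 3 * x * s * r
    + 1 / 6 * x * u ^ 3 - 4 / 3 * x * u * r - x * v ^ 2 + 1 / 12 * x * w ^ 2 + 70 / 27 * y ^ 2 * s
    + 5 / 9 * y ^ 2 * u + 94 / 9 * y * s ^ 2 * v + 11 / 9 * y * s * u * v + 1 / 6 * y * u ^ 2 * v
    - 2 * y * v * r + 1 / 6 * y * w * q + 24569 / 2916 * s ^ 6 + 4687 / 729 * s ^ 5 * u + 6587 / 1944 * s ^ 4 * u ^ 2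
    - 1048 / 81 * s ^ 4 * r - 259 / 324 * s ^ 3 * u ^ 3 + 536 / 81 * s ^ 3 * u * r + 461 / 162 * s ^ 3 * v ^ 2
    - 277 / 648 * s ^ 3 * w ^ 2 - 131 / 432 * s ^ 2 * u ^ 4 + 19 / 18 * s ^ 2 * u ^ 2 * r - 29 / 12 * s ^ 2 * u * v ^ 2
    - 79 / 144 * s ^ 2 * u * w ^ 2 + 37 / 27 * s ^ 2 * w * p + 101 / 108 * s ^ 2 * q ^ 2 + 65 / 9 * s ^ 2 * r ^ 2
    - 7 / 72 * s * u ^ 5 + 2 / 3 * s * u ^ 3 * r - 5 / 6 * s * u ^ 2 * v ^ 2 - 1 / 12 * s * u ^ 2 * w ^ 2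
    - 1 / 18 * s * u * w * p + 2 / 9 * s * u * q ^ 2 + s * v ^ 2 * r + 1 / 12 * s * w ^ 2 * r + 4 / 9 * s * w
    + 2 / 3 * s * p ^ 2 + 1 / 48 * u ^ 6 - 1 / 3 * u ^ 4 * r - 7 / 24 * u ^ 3 * v ^ 2 - 1 / 32 * u ^ 3 * w ^ 2
    + 1 / 4 * u ^ 2 * w * p - 1 / 24 * u ^ 2 * q ^ 2 + 3 / 2 * u ^ 2 * r ^ 2 + 2 * u * v ^ 2 * r
    - 1 / 3 * u * v * w * q - 1 / 6 * u * w - 1 / 3 * u * p ^ 2 - 11 / 24 * v ^ 4 - 1 / 16 * v ^ 2 * w ^ 2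
    + v * p * q + 1 / 384 * w ^ 4 - 1 / 3 * w * p * r + 2 / 3 * p + 1 / 3 * q ^ 2 * r - 4 / 3 * r ^ 3

/-- The first coefficients of the dressed cyclic matrix. -/
def kapCoeff (x y s u v w p q r : ℂ) : ℕ → M3
  | 0 => g1 1 1 1
  | 2 => g2 (kap2 x y s u v w p q r)
    (kap2 x y s u v (-w) (-p) (-q) r) (kapMid2 x y s u v w p q r)
  | 3 => g1 (kapMid3 x y s u v w p q r)
    (kap3 x y s u v w p q r) (kap3 x y s u v (-w) (-p) (-q) r)
  | 4 => g0 (kap4 x y s u v w p q r)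
    (kapMid4 x y s u v w p q r) (kap4 x y s u v (-w) (-p) (-q) r)
  | 5 => g2 (kap5 x y s u v w p q r)
    (kap5 x y s u v (-w) (-p) (-q) r) (kapMid5 x y s u v w p q r)
  | 6 => g1 (kapMid6 x y s u v w p q r)
    (kap6 x y s u v w p q r) (kap6 x y s u v (-w) (-p) (-q) r)
  | 7 => g0 (kap7 x y s u v w p q r 1)
    (kapMid7 x y s u v w p q r) (kap7 x y s u v (-w) (-p) (-q) r (-1))
  | 8 => g2 (kap8 x y s u v w p q r)
    (kap8 x y s u v (-w) (-p) (-q) r) (kapMid8 x y s u v w p q r)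
  | 9 => g1 (kapMid9 x y s u v w p q r)
    (kap9 x y s u v w p q r 1) (kap9 x y s u v (-w) (-p) (-q) r (-1))
  | 10 => g0 (kap10 x y s u v w p q r 1)
    (kapMid10 x y s u v w p q r) (kap10 x y s u v (-w) (-p) (-q) r (-1))
  | 11 => g2 (kap11 x y s u v w p q r 1)
    (kap11 x y s u v (-w) (-p) (-q) r (-1)) (kapMid11 x y s u v w p q r)
  | 12 => g1 (kapMid12 x y s u v w p q r)
    (kap12 x y s u v w p q r 1) (kap12 x y s u v (-w) (-p) (-q) r (-1))
  | _ => 0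

/-- The first coefficients of the square of the dressed cyclic matrix. -/
def kapSqCoeff (x y s u v w p q r : ℂ) : ℕ → M3
  | 0 => g2 1 1 1
  | 2 => g0 (kapSq2 x y s u v w p q r)
    (kapSqMid2 x y s u v w p q r) (kapSq2 x y s u v (-w) (-p) (-q) r)
  | 3 => g2 (kapSq3 x y s u v w p q r)
    (kapSq3 x y s u v (-w) (-p) (-q) r) (kapSqMid3 x y s u v w p q r)
  | 4 => g1 (kapSqMid4 x y s u v w p q r)
    (kapSq4 x y s u v w p q r) (kapSq4 x y s u v (-w) (-p) (-q) r)
  | 5 => g0 (kapSq5 x y s u v w p q r)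
    (kapSqMid5 x y s u v w p q r) (kapSq5 x y s u v (-w) (-p) (-q) r)
  | 6 => g2 (kapSq6 x y s u v w p q r)
    (kapSq6 x y s u v (-w) (-p) (-q) r) (kapSqMid6 x y s u v w p q r)
  | 7 => g1 (kapSqMid7 x y s u v w p q r)
    (kapSq7 x y s u v w p q r 1) (kapSq7 x y s u v (-w) (-p) (-q) r (-1))
  | 8 => g0 (kapSq8 x y s u v w p q r)
    (kapSqMid8 x y s u v w p q r) (kapSq8 x y s u v (-w) (-p) (-q) r)
  | 9 => g2 (kapSq9 x y s u v w p q r 1)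
    (kapSq9 x y s u v (-w) (-p) (-q) r (-1)) (kapSqMid9 x y s u v w p q r)
  | 10 => g1 (kapSqMid10 x y s u v w p q r)
    (kapSq10 x y s u v w p q r 1) (kapSq10 x y s u v (-w) (-p) (-q) r (-1))
  | 11 => g0 (kapSq11 x y s u v w p q r 1)
    (kapSqMid11 x y s u v w p q r) (kapSq11 x y s u v (-w) (-p) (-q) r (-1))
  | 12 => g2 (kapSq12 x y s u v w p q r 1)
    (kapSq12 x y s u v (-w) (-p) (-q) r (-1)) (kapSqMid12 x y s u v w p q r)
  | _ => 0

/-- The dressed cyclic matrix, up to `X ^ 13`. -/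
def kap (t Q P : Fin 3 → ℂ) : M3⟦X⟧ :=
  PowerSeries.mk (kapCoeff (t 0) (t 1) (t 2) (Q 0) (Q 1) (Q 2) (P 0) (P 1) (P 2))

lemma coeff_kap_sq (t Q P : Fin 3 → ℂ) {n : ℕ} (hn : n ≤ 12) : coeff n (kap t Q P * kap t Q P)
    = kapSqCoeff (t 0) (t 1) (t 2) (Q 0) (Q 1) (Q 2) (P 0) (P 1) (P 2) n := by
  rw [coeff_mul_range]
  simp only [kap, coeff_mk]
  generalize t 0 = x, t 1 = y, t 2 = s, Q 0 = u, Q 1 = v, Q 2 = w, P 0 = p, P 1 = q, P 2 = r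
  interval_cases n <;>
  · simp only [Finset.sum_range_succ, Finset.sum_range_zero, Nat.reduceSub, Nat.sub_zero,
      kapCoeff, kapSqCoeff, zero_mul, mul_zero, zero_add, add_zero,
      g0_mul_g0, g0_mul_g1, g0_mul_g2, g1_mul_g0, g1_mul_g1, g1_mul_g2, g2_mul_g0, g2_mul_g1,
      g2_mul_g2, g0_add, g1_add, g2_add]
    try simp only [
      kap2, kapMid2, kap3, kapMid3, kap4, kapMid4, kap5, kapMid5, kap6, kapMid6, kap7, kapMid7,
      kap8, kapMid8, kap9, kapMid9, kap10, kapMid10, kap11, kapMid11, kap12, kapMid12,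
      kapSq2, kapSqMid2, kapSq3, kapSqMid3, kapSq4, kapSqMid4, kapSq5, kapSqMid5, kapSq6,
      kapSqMid6, kapSq7, kapSqMid7, kapSq8, kapSqMid8, kapSq9, kapSqMid9, kapSq10, kapSqMid10,
      kapSq11, kapSqMid11, kapSq12, kapSqMid12]
    try (congr 1 <;> ring)

lemma coeff_kap_eq (t Q P : Fin 3 → ℂ) {n : ℕ} (hn : n ≤ 12) :
    coeff n (alpha t Q P * kap t Q P - kap t Q P * alpha t Q P + X ^ 7 * euler (kap t Q P)) = 0 := by
  rw [map_add, map_sub, coeff_mul_range, coeff_mul_range', coeff_X_pow_mul', coeff_euler]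
  have h8 : alphaCoeff t Q P 8 = 0 := rfl
  have h9 : alphaCoeff t Q P 9 = 0 := rfl
  have h10 : alphaCoeff t Q P 10 = 0 := rfl
  have h11 : alphaCoeff t Q P 11 = 0 := rfl
  have h12 : alphaCoeff t Q P 12 = 0 := rfl
  simp only [kap, alpha, coeff_mk]
  interval_cases n <;>
  · simp only [Finset.sum_range_succ, Finset.sum_range_zero, Nat.reduceSub, Nat.sub_zero,
      alphaCoeff_zero, alphaCoeff_one, alphaCoeff_two, alphaCoeff_three,
      alphaCoeff_four, alphaCoeff_five, alphaCoeff_six, alphaCoeff_seven, h8, h9, h10, h11, h12]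
    clear h8 h9 h10 h11 h12
    generalize t 0 = x, t 1 = y, t 2 = s, Q 0 = u, Q 1 = v, Q 2 = w, P 0 = p, P 1 = q, P 2 = r
    simp only [kapCoeff, zero_mul, mul_zero, zero_add, add_zero, smul_zero, sub_self,
      Nat.reduceLeDiff, if_true, if_false, Nat.cast_ofNat, Nat.cast_zero, Nat.cast_one,
      g0_mul_g0, g0_mul_g1, g0_mul_g2, g1_mul_g0, g1_mul_g1, g1_mul_g2, g2_mul_g0, g2_mul_g1,
      g2_mul_g2, g0_add, g1_add, g2_add,
      g0_sub, g1_sub, g2_sub, g0_smul, g1_smul, g2_smul]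
    try
      (simp only [
      kap2, kapMid2, kap3, kapMid3, kap4, kapMid4, kap5, kapMid5, kap6, kapMid6, kap7, kapMid7,
      kap8, kapMid8, kap9, kapMid9, kap10, kapMid10, kap11, kapMid11, kap12, kapMid12]
       first
         | (apply g0_eq_zero <;> ring) | (apply g1_eq_zero <;> ring) | (apply g2_eq_zero <;> ring))

/-! ### Differentials of the Hamiltonians -/

/-- The differential of `H1`. -/
def dH1 (x y s u v w p q r dx dy ds du dv dw dp dq dr : ℂ) : ℂ :=
  (-4 / 3 * s - u) * dx
    + (2 * v) * dy
    + (-4 / 3 * x + 82 / 27 * s ^ 3 + 19 / 9 * s ^ 2 * u + s * u ^ 2 - 4 * s * r - 1 / 4 * u ^ 3 + 2 * u * r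
      + 1 / 2 * v ^ 2 - 1 / 8 * w ^ 2) * ds
    + (-x + 19 / 27 * s ^ 3 + s ^ 2 * u - 3 / 4 * s * u ^ 2 + 2 * s * r - 1 / 2 * u ^ 3 - 3 / 2 * v ^ 2
      - 3 / 8 * w ^ 2) * du
    + (2 * y + s * v - 3 * u * v) * dv
    + (-1 / 4 * s * w - 3 / 4 * u * w + p) * dw
    + (w) * dp
    + (q) * dq
    + (-2 * s ^ 2 + 2 * s * u + 12 * r) * dr

/-- The differential of `H2`. -/
def dH2 (x y s u v w p q r dx dy ds du dv dw dp dq dr : ℂ) : ℂ :=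
  (2 * v) * dx
    + (-22 / 9 * s ^ 2 - 2 * s * u - u ^ 2 + 4 * r) * dy
    + (-44 / 9 * y * s - 2 * y * u - 65 / 9 * s ^ 2 * v + 1 / 2 * u ^ 2 * v + 2 * v * r - 1 / 2 * w * q) * ds
    + (-2 * y * s - 2 * y * u + s * u * v + 3 * u ^ 2 * v - 6 * v * r + 1 / 2 * w * q) * du
    + (2 * x - 65 / 27 * s ^ 3 + 1 / 2 * s * u ^ 2 + 2 * s * r + u ^ 3 - 6 * u * r + 3 * v ^ 2 + 1 / 4 * w ^ 2) * dv
    + (-1 / 2 * s * q + 1 / 2 * u * q + 1 / 2 * v * w) * dw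
    + (-2 * q) * dp
    + (-1 / 2 * s * w + 1 / 2 * u * w - 2 * p) * dq
    + (4 * y + 2 * s * v - 6 * u * v) * dr

/-- The differential of `H5`. -/
def dH5 (x y s u v w p q r dx dy ds du dv dw dp dq dr : ℂ) : ℂ :=
  (-4 / 3 * x + 82 / 27 * s ^ 3 + 19 / 9 * s ^ 2 * u + s * u ^ 2 - 4 * s * r - 1 / 4 * u ^ 3 + 2 * u * r
      + 1 / 2 * v ^ 2 - 1 / 8 * w ^ 2) * dx
    + (-44 / 9 * y * s - 2 * y * u - 65 / 9 * s ^ 2 * v + 1 / 2 * u ^ 2 * v + 2 * v * r - 1 / 2 * w * q) * dy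
    + (82 / 9 * x * s ^ 2 + 38 / 9 * x * s * u + x * u ^ 2 - 4 * x * r - 22 / 9 * y ^ 2 - 130 / 9 * y * s * v
      - 1112 / 81 * s ^ 5 - 10865 / 972 * s ^ 4 * u - 299 / 54 * s ^ 3 * u ^ 2 + 652 / 27 * s ^ 3 * r
      + 49 / 36 * s ^ 2 * u ^ 3 - 71 / 9 * s ^ 2 * u * r - 38 / 9 * s ^ 2 * v ^ 2 + 11 / 36 * s ^ 2 * w ^ 2
      + 7 / 9 * s * u ^ 4 - 3 * s * u ^ 2 * r + 47 / 6 * s * u * v ^ 2 + 29 / 24 * s * u * w ^ 2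
      - 29 / 9 * s * w * p - 28 / 9 * s * q ^ 2 - 40 / 3 * s * r ^ 2 + 3 / 16 * u ^ 5 - 2 * u ^ 3 * r
      + 3 / 4 * u ^ 2 * v ^ 2 - 1 / 16 * u ^ 2 * w ^ 2 + u * w * p - 1 / 4 * u * q ^ 2 + 5 * u * r ^ 2
      - 5 * v ^ 2 * r + 1 / 2 * v * w * q - 1 / 4 * w ^ 2 * r - 2 * p ^ 2) * ds
    + (19 / 9 * x * s ^ 2 + 2 * x * s * u - 3 / 4 * x * u ^ 2 + 2 * x * r - y ^ 2 + y * u * v - 2173 / 972 * s ^ 5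
      - 299 / 108 * s ^ 4 * u + 49 / 36 * s ^ 3 * u ^ 2 - 71 / 27 * s ^ 3 * r + 14 / 9 * s ^ 2 * u ^ 3
      - 3 * s ^ 2 * u * r + 47 / 12 * s ^ 2 * v ^ 2 + 29 / 48 * s ^ 2 * w ^ 2 + 15 / 16 * s * u ^ 4
      - 6 * s * u ^ 2 * r + 3 / 2 * s * u * v ^ 2 - 1 / 8 * s * u * w ^ 2 + s * w * p - 1 / 4 * s * q ^ 2
      + 5 * s * r ^ 2 - 3 / 8 * u ^ 5 + 4 * u ^ 3 * r - 3 / 8 * u ^ 2 * v ^ 2 + 9 / 32 * u ^ 2 * w ^ 2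
      - 3 / 2 * u * w * p + 1 / 4 * u * q ^ 2 - 9 * u * r ^ 2 + 1 / 2 * v * w * q + p ^ 2) * du
    + (x * v - 65 / 9 * y * s ^ 2 + 1 / 2 * y * u ^ 2 + 2 * y * r - 76 / 27 * s ^ 3 * v + 47 / 6 * s ^ 2 * u * v
      + 3 / 2 * s * u ^ 2 * v - 10 * s * v * r + 1 / 2 * s * w * q - 1 / 4 * u ^ 3 * v + 1 / 2 * u * w * q
      + 3 / 2 * v ^ 3 - 1 / 8 * v * w ^ 2 - p * q) * dv
    + (-1 / 4 * x * w - 1 / 2 * y * q + 11 / 54 * s ^ 3 * w + 29 / 24 * s ^ 2 * u * w - 29 / 18 * s ^ 2 * p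
      - 1 / 8 * s * u ^ 2 * w + s * u * p + 1 / 2 * s * v * q - 1 / 2 * s * w * r + 3 / 16 * u ^ 3 * w
      - 3 / 4 * u ^ 2 * p + 1 / 2 * u * v * q - 1 / 8 * v ^ 2 * w - 1 / 32 * w ^ 3 + p * r) * dw
    + (-29 / 18 * s ^ 2 * w + s * u * w - 4 * s * p - 3 / 4 * u ^ 2 * w + 2 * u * p - v * q + w * r) * dp
    + (-1 / 2 * y * w - 28 / 9 * s ^ 2 * q - 1 / 2 * s * u * q + 1 / 2 * s * v * w + 1 / 4 * u ^ 2 * q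
      + 1 / 2 * u * v * w - v * p - 2 * q * r) * dq
    + (-4 * x * s + 2 * x * u + 2 * y * v + 163 / 27 * s ^ 4 - 71 / 27 * s ^ 3 * u - 3 / 2 * s ^ 2 * u ^ 2
      - 40 / 3 * s ^ 2 * r - 2 * s * u ^ 3 + 10 * s * u * r - 5 * s * v ^ 2 - 1 / 4 * s * w ^ 2 + u ^ 4
      - 9 * u ^ 2 * r + w * p - q ^ 2 + 12 * r ^ 2) * dr

/-- The differentials of the Hamiltonians. -/
def dHam (k : Fin 3) (t Q P dt dQ dP : Fin 3 → ℂ) : ℂ :=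
  ![dH1 (t 0) (t 1) (t 2) (Q 0) (Q 1) (Q 2) (P 0) (P 1) (P 2)
      (dt 0) (dt 1) (dt 2) (dQ 0) (dQ 1) (dQ 2) (dP 0) (dP 1) (dP 2),
    dH2 (t 0) (t 1) (t 2) (Q 0) (Q 1) (Q 2) (P 0) (P 1) (P 2)
      (dt 0) (dt 1) (dt 2) (dQ 0) (dQ 1) (dQ 2) (dP 0) (dP 1) (dP 2),
    dH5 (t 0) (t 1) (t 2) (Q 0) (Q 1) (Q 2) (P 0) (P 1) (P 2)
      (dt 0) (dt 1) (dt 2) (dQ 0) (dQ 1) (dQ 2) (dP 0) (dP 1) (dP 2)] k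

/-- The differential of `polyG`. -/
def dPolyG (t Q P dt dQ dP : Fin 3 → ℂ) : ℂ :=
  1 / 7 * (3 * (dt 0 * ham 0 t Q P + t 0 * dHam 0 t Q P dt dQ dP)
    + 5 / 2 * (dt 1 * ham 1 t Q P + t 1 * dHam 1 t Q P dt dQ dP)
    + (dt 2 * ham 2 t Q P + t 2 * dHam 2 t Q P dt dQ dP)
    - (dP 0 * Q 0 + P 0 * dQ 0) - 3 / 2 * (dP 1 * Q 1 + P 1 * dQ 1)
    - 3 / 2 * (dP 2 * Q 2 + P 2 * dQ 2))

/-- The differentials of the coefficients of `alpha`. -/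
def dAlphaCoeff (t Q P dt dQ dP : Fin 3 → ℂ) : ℕ → M3
  | 2 => g2 (2 * dt 2 + 1 / 4 * dQ 0) (2 * dt 2 + 1 / 4 * dQ 0) (dt 2 - 1 / 2 * dQ 0)
  | 3 => g1 (-dQ 1) (1 / 2 * dQ 1 - 1 / 4 * dQ 2) (1 / 2 * dQ 1 + 1 / 4 * dQ 2)
  | 4 => g0
    (1 / 4 * Q 0 * dQ 0 - dP 2 + 1 / 2 * dP 1 - 1 / 4 * (dt 2 * Q 0 + t 2 * dQ 0)
      - 1 / 3 * t 2 * dt 2)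
    (2 * dP 2 - 1 / 2 * Q 0 * dQ 0 + 1 / 2 * (dt 2 * Q 0 + t 2 * dQ 0) + 2 / 3 * t 2 * dt 2)
    (1 / 4 * Q 0 * dQ 0 - dP 2 - 1 / 2 * dP 1 - 1 / 4 * (dt 2 * Q 0 + t 2 * dQ 0)
      - 1 / 3 * t 2 * dt 2)
  | 5 => g2
    (5 / 16 * (dQ 0 * Q 2 + Q 0 * dQ 2) - dP 0 + 1 / 4 * (dt 2 * Q 2 + t 2 * dQ 2)
      - 3 / 8 * (dQ 0 * Q 1 + Q 0 * dQ 1) - 1 / 2 * (dt 2 * Q 1 + t 2 * dQ 1) + dt 1)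
    (-(5 / 16) * (dQ 0 * Q 2 + Q 0 * dQ 2) + dP 0 - 1 / 4 * (dt 2 * Q 2 + t 2 * dQ 2)
      - 3 / 8 * (dQ 0 * Q 1 + Q 0 * dQ 1) - 1 / 2 * (dt 2 * Q 1 + t 2 * dQ 1) + dt 1)
    0
  | 6 => g1
    (1 / 8 * Q 2 * dQ 2 + 21 / 32 * Q 0 ^ 2 * dQ 0 + 3 / 2 * Q 1 * dQ 1
      - 3 / 2 * (dP 2 * Q 0 + P 2 * dQ 0) + 5 / 16 * (dt 2 * Q 0 ^ 2 + 2 * t 2 * Q 0 * dQ 0)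
      - 2 * (dt 2 * P 2 + t 2 * dP 2) + 1 / 4 * (2 * t 2 * dt 2 * Q 0 + t 2 ^ 2 * dQ 0) + dt 0
      + 8 / 9 * t 2 ^ 2 * dt 2)
    0 0
  | _ => 0

/-! ### Identification of the dressed matrix and evaluation of the residue -/

lemma kapCoeff_trace (x y s u v w p q r : ℂ) {n : ℕ} (hn : n ≤ 12) (h0 : n ≠ 0) :
    (kapCoeff x y s u v w p q r n).trace = 0 := by
  interval_cases n <;> simp only [kapCoeff, g0_trace, g1_trace, g2_trace, Matrix.trace_zero] <;>
    first | exact absurd rfl h0 | (simp only [kap4, kapMid4, kap7, kapMid7, kap10, kapMid10]; ring)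

lemma kapSqCoeff_trace (x y s u v w p q r : ℂ) {n : ℕ} (hn : n ≤ 12) (h0 : n ≠ 0) :
    (kapSqCoeff x y s u v w p q r n).trace = 0 := by
  interval_cases n <;> simp only [kapSqCoeff, g0_trace, g1_trace, g2_trace, Matrix.trace_zero] <;>
    first
    | exact absurd rfl h0
    | (simp only [kapSq2, kapSqMid2, kapSq5, kapSqMid5, kapSq8, kapSqMid8, kapSq11, kapSqMid11]
       ring)

/-- The square is already known explicitly in these degrees, so the cube needs only one further
product. -/
lemma trc_kap_cube (t Q P : Fin 3 → ℂ) {n : ℕ} (hn : n ≤ 12) (h0 : n ≠ 0) :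
    trc n (kap t Q P * (kap t Q P * kap t Q P)) = 0 := by
  have h : ∀ m ≤ 12, coeff m (kap t Q P * kap t Q P)
      = kapSqCoeff (t 0) (t 1) (t 2) (Q 0) (Q 1) (Q 2) (P 0) (P 1) (P 2) m :=
    fun m hm => coeff_kap_sq t Q P hm
  rw [trc_mul, Finset.sum_congr rfl fun m _ => by rw [h (n - m) (by omega)]]
  simp only [kap, coeff_mk]
  generalize t 0 = x, t 1 = y, t 2 = s, Q 0 = u, Q 1 = v, Q 2 = w, P 0 = p, P 1 = q, P 2 = r
  clear h
  interval_cases n <;>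
  · try exact absurd rfl h0
    try simp only [Finset.sum_range_succ, Finset.sum_range_zero, Nat.reduceSub, Nat.sub_zero,
      kapCoeff, kapSqCoeff, zero_mul, mul_zero, zero_add, add_zero, g0_mul_g0, g0_mul_g1,
      g0_mul_g2, g1_mul_g0, g1_mul_g1, g1_mul_g2, g2_mul_g0, g2_mul_g1, g2_mul_g2, g0_trace,
      g1_trace, g2_trace, Matrix.trace_zero]
    try
      (simp only [
      kap2, kapMid2, kap3, kapMid3, kap4, kapMid4, kap5, kapMid5, kap6, kapMid6, kap7, kapMid7,
      kap8, kapMid8, kap9, kapMid9, kap10, kapMid10, kap11, kapMid11, kap12, kapMid12, kapSq2,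
      kapSqMid2, kapSq3, kapSqMid3, kapSq4, kapSqMid4, kapSq5, kapSqMid5, kapSq6, kapSqMid6,
      kapSq7, kapSqMid7, kapSq8, kapSqMid8, kapSq9, kapSqMid9, kapSq10, kapSqMid10, kapSq11,
      kapSqMid11, kapSq12, kapSqMid12]
       ring)

/-- Powers of the dressed matrix are conjugates of constants, so their traces vanish in positive
degrees; the truncated polynomial model `kap` shares these traces and the equation up to degree 12.
-/
lemma coeff_dressed {t Q P : Fin 3 → ℂ} {F : M3⟦X⟧} (hF : IsSol t Q P F) :
    ∀ n ≤ 12, coeff n (dressed F) = coeff n (kap t Q P) := by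
  have e1 (n : ℕ) (hn : n ≠ 0) : trc n (dressed F) = 0 := trc_conj hF.1 cyc hn
  have e2 (n : ℕ) (hn : n ≠ 0) : trc n (dressed F * dressed F) = 0 := by
    rw [dressed_sq hF.1]; exact trc_conj hF.1 _ hn
  have e3 (n : ℕ) (hn : n ≠ 0) : trc n (dressed F * (dressed F * dressed F)) = 0 := by
    rw [dressed_cube hF.1, trc, coeff_one, if_neg hn, Matrix.trace_zero]
  refine coeff_eq_of_dressed_eq (α := alpha t Q P) (by rw [alpha, coeff_mk]; rfl) (coeff_zero_dressed hF.1)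
    (by rw [kap, coeff_mk]; rfl)
    (fun n _ => by rw [dressed_eq hF, map_zero]) (fun n hn => coeff_kap_eq t Q P hn)
    (fun n hn h0 => ?_) (fun n hn h0 => ?_) (fun n hn h0 => ?_)
  · rw [e1 n h0, trc, kap, coeff_mk, kapCoeff_trace _ _ _ _ _ _ _ _ _ hn h0]
  · rw [e2 n h0, trc, coeff_kap_sq t Q P hn, kapSqCoeff_trace _ _ _ _ _ _ _ _ _ hn h0]
  · rw [e3 n h0, trc_kap_cube t Q P hn h0]

lemma coeff_dressed_sq {t Q P : Fin 3 → ℂ} {F : M3⟦X⟧} (hF : IsSol t Q P F) {n : ℕ} (hn : n ≤ 12) :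
    coeff n (dressed F * dressed F)
      = kapSqCoeff (t 0) (t 1) (t 2) (Q 0) (Q 1) (Q 2) (P 0) (P 1) (P 2) n := by
  rw [← coeff_kap_sq t Q P hn, coeff_mul_range', coeff_mul_range']
  refine Finset.sum_congr rfl fun m hm => ?_
  have := Finset.mem_range.1 hm
  rw [coeff_dressed hF m (by omega), coeff_dressed hF (n - m) (by omega)]

/-- The residue, explicitly. -/
lemma trc_dAlpha {t Q P : Fin 3 → ℂ} {F : M3⟦X⟧} (hF : IsSol t Q P F) (dt dQ dP : Fin 3 → ℂ) :
    trc 14 (PowerSeries.mk (dAlphaCoeff t Q P dt dQ dP) * (F * thetaS t * sInv F))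
      = 1 / 2 * (∑ a, P a * dQ a - ∑ k, ham k t Q P * dt k) + dPolyG t Q P dt dQ dP := by
  have h (n : ℕ) (hn : 6 ≤ n) (hn' : n ≤ 12) : coeff n (F * thetaS t * sInv F)
      = (3 / 7 : ℂ) • kapCoeff (t 0) (t 1) (t 2) (Q 0) (Q 1) (Q 2) (P 0) (P 1) (P 2) n
      + t 2 • kapSqCoeff (t 0) (t 1) (t 2) (Q 0) (Q 1) (Q 2) (P 0) (P 1) (P 2) (n - 2)
      + t 1 • kapSqCoeff (t 0) (t 1) (t 2) (Q 0) (Q 1) (Q 2) (P 0) (P 1) (P 2) (n - 5)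
      + t 0 • kapCoeff (t 0) (t 1) (t 2) (Q 0) (Q 1) (Q 2) (P 0) (P 1) (P 2) (n - 6) := by
    rw [conj_thetaS t hF.1 hn, coeff_dressed hF n hn', coeff_dressed hF (n - 6) (by omega),
      coeff_dressed_sq hF (by omega), coeff_dressed_sq hF (by omega), kap, coeff_mk, coeff_mk]
  have hz (n : ℕ) : dAlphaCoeff t Q P dt dQ dP (n + 7) = 0 := rfl
  -- The differential of `α` lives in degrees 2 to 6, so only degrees 8 to 12 of the conjugated
  -- exponent are needed.
  have hsum : trc 14 (PowerSeries.mk (dAlphaCoeff t Q P dt dQ dP) * (F * thetaS t * sInv F))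
      = ∑ n ∈ Finset.range 5, (dAlphaCoeff t Q P dt dQ dP (n + 2)
        * coeff (12 - n) (F * thetaS t * sInv F)).trace := by
    rw [trc_mul]
    simp only [coeff_mk]
    rw [Finset.sum_range_succ', Finset.sum_range_succ', ← Finset.sum_subset
      (Finset.range_subset_range.2 (by norm_num : 5 ≤ 13))]
    · have h0 : dAlphaCoeff t Q P dt dQ dP 0 = 0 := rfl
      have h1 : dAlphaCoeff t Q P dt dQ dP (0 + 1) = 0 := rfl
      rw [h0, h1, zero_mul, zero_mul, Matrix.trace_zero, add_zero, add_zero]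
      refine Finset.sum_congr rfl fun n _ => ?_
      rw [show 14 - (n + 1 + 1) = 12 - n by omega]
    · intro n _ hn
      obtain ⟨m, rfl⟩ := Nat.exists_eq_add_of_le (not_lt.1 (mt Finset.mem_range.2 hn))
      rw [show 5 + m + 1 + 1 = m + 7 by omega, hz, zero_mul, Matrix.trace_zero]
  rw [hsum, Finset.sum_congr rfl fun n hn => by
    have := Finset.mem_range.1 hn
    rw [h (12 - n) (by omega) (by omega)]]
  simp only [Finset.sum_range_succ, Finset.sum_range_zero, Nat.reduceSub, Nat.reduceAdd,
    dAlphaCoeff, zero_add, Fin.sum_univ_three, ham, dHam, dPolyG, Matrix.cons_val]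
  generalize t 0 = x, t 1 = y, t 2 = s, Q 0 = u, Q 1 = v, Q 2 = w, P 0 = p, P 1 = q, P 2 = r,
    dt 0 = dx, dt 1 = dy, dt 2 = ds, dQ 0 = du, dQ 1 = dv, dQ 2 = dw, dP 0 = dp, dP 1 = dq,
    dP 2 = dr
  simp only [kapCoeff, kapSqCoeff, g0_add, g1_add, g2_add, g0_smul, g1_smul, g2_smul, g0_mul_g0,
    g1_mul_g2, g2_mul_g1, g0_trace, zero_mul, add_zero]
  -- What remains is a polynomial identity, linear in the nine differentials. Here the exact
  -- coefficients of the Hamiltonians, the constant `1/2` and the weights in `G` are confirmed.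
  simp only [H1, H2, H5, dH1, dH2, dH5,
      kap2, kapMid2, kap3, kapMid3, kap4, kapMid4, kap5, kapMid5, kap6, kapMid6, kap7, kapMid7,
      kap8, kapMid8, kap9, kapMid9, kap10, kapMid10, kap11, kapMid11, kap12, kapMid12, kapSq2,
      kapSqMid2, kapSq3, kapSqMid3, kapSq4, kapSqMid4, kapSq5, kapSqMid5, kapSq6, kapSqMid6,
      kapSq7, kapSqMid7, kapSq8, kapSqMid8, kapSq9, kapSqMid9, kapSq10, kapSqMid10, kapSq11,
      kapSqMid11, kapSq12, kapSqMid12]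
  ring

/-! ### Derivatives along lines -/

section Hamiltonians

variable {x y s u v w p q r : ℂ → ℂ} {dx dy ds du dv dw dp dq dr c : ℂ}

lemma hasDerivAt_H1 (hx : HasDerivAt x dx c) (hy : HasDerivAt y dy c) (hs : HasDerivAt s ds c)
    (hu : HasDerivAt u du c) (hv : HasDerivAt v dv c) (hw : HasDerivAt w dw c)
    (hp : HasDerivAt p dp c) (hq : HasDerivAt q dq c) (hr : HasDerivAt r dr c) :
    HasDerivAt (fun z => H1 (x z) (y z) (s z) (u z) (v z) (w z) (p z) (q z) (r z))
      (dH1 (x c) (y c) (s c) (u c) (v c) (w c) (p c) (q c) (r c) dx dy ds du dv dw dp dq dr) c := by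
  unfold H1
  apply HasDerivAt.congr_deriv
  · repeat' first
      | assumption
      | exact hasDerivAt_const _ _
      | with_reducible apply HasDerivAt.fun_add
      | with_reducible apply HasDerivAt.fun_sub
      | with_reducible apply HasDerivAt.fun_mul
      | with_reducible apply HasDerivAt.fun_neg
      | with_reducible apply HasDerivAt.fun_pow
  · simp only [Nat.cast_ofNat, Nat.reduceSub, pow_one, dH1]
    ring

lemma hasDerivAt_H2 (hx : HasDerivAt x dx c) (hy : HasDerivAt y dy c) (hs : HasDerivAt s ds c)
    (hu : HasDerivAt u du c) (hv : HasDerivAt v dv c) (hw : HasDerivAt w dw c)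
    (hp : HasDerivAt p dp c) (hq : HasDerivAt q dq c) (hr : HasDerivAt r dr c) :
    HasDerivAt (fun z => H2 (x z) (y z) (s z) (u z) (v z) (w z) (p z) (q z) (r z))
      (dH2 (x c) (y c) (s c) (u c) (v c) (w c) (p c) (q c) (r c) dx dy ds du dv dw dp dq dr) c := by
  unfold H2
  apply HasDerivAt.congr_deriv
  · repeat' first
      | assumption
      | exact hasDerivAt_const _ _
      | with_reducible apply HasDerivAt.fun_add
      | with_reducible apply HasDerivAt.fun_sub
      | with_reducible apply HasDerivAt.fun_mul
      | with_reducible apply HasDerivAt.fun_neg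
      | with_reducible apply HasDerivAt.fun_pow
  · simp only [Nat.cast_ofNat, Nat.reduceSub, pow_one, dH2]
    ring

lemma hasDerivAt_H5 (hx : HasDerivAt x dx c) (hy : HasDerivAt y dy c) (hs : HasDerivAt s ds c)
    (hu : HasDerivAt u du c) (hv : HasDerivAt v dv c) (hw : HasDerivAt w dw c)
    (hp : HasDerivAt p dp c) (hq : HasDerivAt q dq c) (hr : HasDerivAt r dr c) :
    HasDerivAt (fun z => H5 (x z) (y z) (s z) (u z) (v z) (w z) (p z) (q z) (r z))
      (dH5 (x c) (y c) (s c) (u c) (v c) (w c) (p c) (q c) (r c) dx dy ds du dv dw dp dq dr) c := by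
  unfold H5
  apply HasDerivAt.congr_deriv
  · repeat' first
      | assumption
      | exact hasDerivAt_const _ _
      | with_reducible apply HasDerivAt.fun_add
      | with_reducible apply HasDerivAt.fun_sub
      | with_reducible apply HasDerivAt.fun_mul
      | with_reducible apply HasDerivAt.fun_neg
      | with_reducible apply HasDerivAt.fun_pow
  · simp only [Nat.cast_ofNat, Nat.reduceSub, pow_one, dH5]
    ring

variable {t Q P : ℂ → Fin 3 → ℂ} {dt dQ dP : Fin 3 → ℂ}

lemma hasDerivAt_ham (ht : ∀ i, HasDerivAt (fun z => t z i) (dt i) c)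
    (hQ : ∀ i, HasDerivAt (fun z => Q z i) (dQ i) c)
    (hP : ∀ i, HasDerivAt (fun z => P z i) (dP i) c) (k : Fin 3) :
    HasDerivAt (fun z => ham k (t z) (Q z) (P z)) (dHam k (t c) (Q c) (P c) dt dQ dP) c := by
  fin_cases k
  · exact hasDerivAt_H1 (ht 0) (ht 1) (ht 2) (hQ 0) (hQ 1) (hQ 2) (hP 0) (hP 1) (hP 2)
  · exact hasDerivAt_H2 (ht 0) (ht 1) (ht 2) (hQ 0) (hQ 1) (hQ 2) (hP 0) (hP 1) (hP 2)
  · exact hasDerivAt_H5 (ht 0) (ht 1) (ht 2) (hQ 0) (hQ 1) (hQ 2) (hP 0) (hP 1) (hP 2)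

lemma hasDerivAt_polyG (ht : ∀ i, HasDerivAt (fun z => t z i) (dt i) c)
    (hQ : ∀ i, HasDerivAt (fun z => Q z i) (dQ i) c)
    (hP : ∀ i, HasDerivAt (fun z => P z i) (dP i) c) :
    HasDerivAt (fun z => polyG (t z) (Q z) (P z)) (dPolyG (t c) (Q c) (P c) dt dQ dP) c := by
  have h := hasDerivAt_ham ht hQ hP
  have h' := ((((((((ht 0).const_mul 3).fun_mul (h 0)).fun_add (((ht 1).const_mul (5 / 2)).fun_mul
    (h 1))).fun_add ((ht 2).fun_mul (h 2))).fun_sub ((hP 0).fun_mul (hQ 0))).fun_sub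
    (((hP 1).const_mul (3 / 2)).fun_mul (hQ 1))).fun_sub
    (((hP 2).const_mul (3 / 2)).fun_mul (hQ 2))).const_mul (1 / 7)
  refine h'.congr_deriv ?_
  rw [dPolyG]
  ring

end Hamiltonians

/-! ### Directional derivatives of scalar functions -/

section Directional

variable {E : Type*} [NormedAddCommGroup E] [NormedSpace ℂ E]

/-- Once differentiability is known, the value of `fderiv` on a vector can be computed with
one-variable calculus along a complex line. -/
lemma hasDerivAt_line {f : E → ℂ} {w : E} (hf : DifferentiableAt ℂ f w) (v : E) :
    HasDerivAt (fun z : ℂ => f (w + z • v)) (fderiv ℂ f w v) 0 :=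
  hf.hasFDerivAt.hasLineDerivAt v

lemma fderiv_eq_of_hasDerivAt {f : E → ℂ} {w v : E} {c : ℂ} (hf : DifferentiableAt ℂ f w)
    (h : HasDerivAt (fun z : ℂ => f (w + z • v)) c 0) : fderiv ℂ f w v = c :=
  (hasDerivAt_line hf v).unique h

variable {t Q P : E → Fin 3 → ℂ} {w : E}

/-- The directional derivative of a family of functions. -/
def dVec (f : E → Fin 3 → ℂ) (w v : E) : Fin 3 → ℂ := fun a => fderiv ℂ (fun w' => f w' a) w v

lemma hasDerivAt_dVec {f : E → Fin 3 → ℂ} (hf : ∀ i, DifferentiableAt ℂ (fun w => f w i) w)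
    (v : E) (i : Fin 3) : HasDerivAt (fun z : ℂ => f (w + z • v) i) (dVec f w v i) 0 :=
  hasDerivAt_line (hf i) v

lemma differentiableAt_ham (ht : ∀ i, DifferentiableAt ℂ (fun w => t w i) w)
    (hQ : ∀ i, DifferentiableAt ℂ (fun w => Q w i) w)
    (hP : ∀ i, DifferentiableAt ℂ (fun w => P w i) w) (k : Fin 3) :
    DifferentiableAt ℂ (fun w => ham k (t w) (Q w) (P w)) w := by
  fin_cases k
  · change DifferentiableAt ℂ (fun w => H1 _ _ _ _ _ _ _ _ _) w
    unfold H1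
    fun_prop
  · change DifferentiableAt ℂ (fun w => H2 _ _ _ _ _ _ _ _ _) w
    unfold H2
    fun_prop
  · change DifferentiableAt ℂ (fun w => H5 _ _ _ _ _ _ _ _ _) w
    unfold H5
    fun_prop

lemma differentiableAt_polyG (ht : ∀ i, DifferentiableAt ℂ (fun w => t w i) w)
    (hQ : ∀ i, DifferentiableAt ℂ (fun w => Q w i) w)
    (hP : ∀ i, DifferentiableAt ℂ (fun w => P w i) w) :
    DifferentiableAt ℂ (fun w => polyG (t w) (Q w) (P w)) w := by
  have h := differentiableAt_ham ht hQ hP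
  unfold polyG
  fun_prop

lemma fderiv_ham (ht : ∀ i, DifferentiableAt ℂ (fun w => t w i) w)
    (hQ : ∀ i, DifferentiableAt ℂ (fun w => Q w i) w)
    (hP : ∀ i, DifferentiableAt ℂ (fun w => P w i) w) (k : Fin 3) (v : E) :
    fderiv ℂ (fun w => ham k (t w) (Q w) (P w)) w v
      = dHam k (t w) (Q w) (P w) (dVec t w v) (dVec Q w v) (dVec P w v) := by
  refine fderiv_eq_of_hasDerivAt (differentiableAt_ham ht hQ hP k) ?_
  simpa only [zero_smul, add_zero] using hasDerivAt_ham (hasDerivAt_dVec ht v)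
    (hasDerivAt_dVec hQ v) (hasDerivAt_dVec hP v) k

lemma fderiv_polyG (ht : ∀ i, DifferentiableAt ℂ (fun w => t w i) w)
    (hQ : ∀ i, DifferentiableAt ℂ (fun w => Q w i) w)
    (hP : ∀ i, DifferentiableAt ℂ (fun w => P w i) w) (v : E) :
    fderiv ℂ (fun w => polyG (t w) (Q w) (P w)) w v
      = dPolyG (t w) (Q w) (P w) (dVec t w v) (dVec Q w v) (dVec P w v) := by
  refine fderiv_eq_of_hasDerivAt (differentiableAt_polyG ht hQ hP) ?_
  simpa only [zero_smul, add_zero] using hasDerivAt_polyG (hasDerivAt_dVec ht v)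
    (hasDerivAt_dVec hQ v) (hasDerivAt_dVec hP v)

/-! ### Derivatives of matrices and of series -/

lemma dMatrix_const (A : M3) (w v : E) : dMatrix (fun _ => A) w v = 0 := by
  ext i j; simp [dMatrix]

lemma dMatrix_g0 (a b c : E → ℂ) (w v : E) : dMatrix (fun w => g0 (a w) (b w) (c w)) w v
    = g0 (fderiv ℂ a w v) (fderiv ℂ b w v) (fderiv ℂ c w v) := by
  ext i j; fin_cases i <;> fin_cases j <;> simp [dMatrix, g0]

lemma dMatrix_g1 (a b c : E → ℂ) (w v : E) : dMatrix (fun w => g1 (a w) (b w) (c w)) w v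
    = g1 (fderiv ℂ a w v) (fderiv ℂ b w v) (fderiv ℂ c w v) := by
  ext i j; fin_cases i <;> fin_cases j <;> simp [dMatrix, g1]

lemma dMatrix_g2 (a b c : E → ℂ) (w v : E) : dMatrix (fun w => g2 (a w) (b w) (c w)) w v
    = g2 (fderiv ℂ a w v) (fderiv ℂ b w v) (fderiv ℂ c w v) := by
  ext i j; fin_cases i <;> fin_cases j <;> simp [dMatrix, g2]

/-- Differentiability at a point, entry by entry. -/
def DiffMAt (A : E → M3) (w : E) : Prop := ∀ i j, DifferentiableAt ℂ (fun w => A w i j) w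

lemma DiffM.diffMAt {A : E → M3} {W : Set E} (hA : DiffM A W) (hW : IsOpen W) (hw : w ∈ W) :
    DiffMAt A w := fun i j => (hA i j).differentiableAt (hW.mem_nhds hw)

lemma diffMAt_const (A : M3) : DiffMAt (fun _ : E => A) w := fun _ _ => differentiableAt_const _

lemma DiffMAt.mul {A B : E → M3} (hA : DiffMAt A w) (hB : DiffMAt B w) :
    DiffMAt (fun w => A w * B w) w := fun i j => by
  simp only [Matrix.mul_apply]
  exact DifferentiableAt.fun_sum fun k _ => (hA i k).fun_mul (hB k j)

lemma dMatrix_mul {A B : E → M3} (hA : DiffMAt A w) (hB : DiffMAt B w) (v : E) :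
    dMatrix (fun w => A w * B w) w v = dMatrix A w v * B w + A w * dMatrix B w v := by
  ext i j
  simp only [dMatrix, Matrix.of_apply, Matrix.add_apply, Matrix.mul_apply,
    ← Finset.sum_add_distrib]
  refine fderiv_eq_of_hasDerivAt (by have := hA.mul hB i j; simpa only [Matrix.mul_apply]) ?_
  refine HasDerivAt.fun_sum fun k _ => ?_
  simpa only [zero_smul, add_zero] using
    (hasDerivAt_line (hA i k) v).fun_mul (hasDerivAt_line (hB k j) v)

lemma dMatrix_add {A B : E → M3} (hA : DiffMAt A w) (hB : DiffMAt B w) (v : E) :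
    dMatrix (fun w => A w + B w) w v = dMatrix A w v + dMatrix B w v := by
  ext i j
  exact fderiv_eq_of_hasDerivAt ((hA i j).fun_add (hB i j))
    ((hasDerivAt_line (hA i j) v).fun_add (hasDerivAt_line (hB i j) v))

lemma dMatrix_sum {ι : Type*} {s : Finset ι} {A : ι → E → M3} (hA : ∀ l ∈ s, DiffMAt (A l) w)
    (v : E) : dMatrix (fun w => ∑ l ∈ s, A l w) w v = ∑ l ∈ s, dMatrix (A l) w v := by
  ext i j
  simp only [dMatrix, Matrix.of_apply, Matrix.sum_apply]
  exact fderiv_eq_of_hasDerivAt (DifferentiableAt.fun_sum fun l hl => hA l hl i j)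
    (HasDerivAt.fun_sum fun l hl => hasDerivAt_line (hA l hl i j) v)

lemma dMatrix_smul (c : ℂ) {A : E → M3} (hA : DiffMAt A w) (v : E) :
    dMatrix (fun w => c • A w) w v = c • dMatrix A w v := by
  ext i j
  exact fderiv_eq_of_hasDerivAt ((hA i j).const_mul c) ((hasDerivAt_line (hA i j) v).const_mul c)

lemma dMatrix_congr {A B : E → M3} (h : A =ᶠ[nhds w] B) (v : E) :
    dMatrix A w v = dMatrix B w v := by
  ext i j
  simp only [dMatrix, Matrix.of_apply]
  rw [Filter.EventuallyEq.fderiv_eq (h.mono fun w' hw' => by rw [hw'])]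

/-- The coefficientwise differential of a family of series. -/
def dSer (F : E → M3⟦X⟧) (w v : E) : M3⟦X⟧ :=
  PowerSeries.mk fun n => dMatrix (fun w' => coeff n (F w')) w v

/-- Coefficientwise differentiability at a point. -/
def DiffSAt (F : E → M3⟦X⟧) (w : E) : Prop := ∀ n, DiffMAt (fun w => coeff n (F w)) w

lemma DiffS.diffSAt {F : E → M3⟦X⟧} {W : Set E} (hF : DiffS F W) (hW : IsOpen W) (hw : w ∈ W) :
    DiffSAt F w := fun n => (hF n).diffMAt hW hw

lemma dSer_const (F : M3⟦X⟧) (w v : E) : dSer (fun _ => F) w v = 0 := by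
  ext1 n; rw [dSer, coeff_mk, dMatrix_const, map_zero]

lemma dSer_add {F G : E → M3⟦X⟧} (hF : DiffSAt F w) (hG : DiffSAt G w) (v : E) :
    dSer (fun w => F w + G w) w v = dSer F w v + dSer G w v := by
  ext1 n
  simp only [dSer, coeff_mk, map_add]
  exact dMatrix_add (hF n) (hG n) v

lemma dSer_mul {F G : E → M3⟦X⟧} (hF : DiffSAt F w) (hG : DiffSAt G w) (v : E) :
    dSer (fun w => F w * G w) w v = dSer F w v * G w + F w * dSer G w v := by
  ext1 n
  simp only [dSer, coeff_mk, map_add, coeff_mul, ← Finset.sum_add_distrib]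
  rw [dMatrix_sum fun p _ => (hF p.1).mul (hG p.2)]
  exact Finset.sum_congr rfl fun p _ => dMatrix_mul (hF p.1) (hG p.2) v

lemma dSer_euler {F : E → M3⟦X⟧} (hF : DiffSAt F w) (v : E) :
    dSer (fun w => euler (F w)) w v = euler (dSer F w v) := by
  ext1 n
  simp only [dSer, coeff_mk, coeff_euler]
  exact dMatrix_smul _ (hF n) v

end Directional

/-! ### The extended tau-differential -/

section ExtendedTau

lemma dSer_alpha {E : Type*} [NormedAddCommGroup E] [NormedSpace ℂ E] {t Q P : E → Fin 3 → ℂ}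
    {w : E} (ht : ∀ i, DifferentiableAt ℂ (fun w => t w i) w)
    (hQ : ∀ i, DifferentiableAt ℂ (fun w => Q w i) w)
    (hP : ∀ i, DifferentiableAt ℂ (fun w => P w i) w) (v : E) :
    dSer (fun w => alpha (t w) (Q w) (P w)) w v
      = PowerSeries.mk (dAlphaCoeff (t w) (Q w) (P w) (dVec t w v) (dVec Q w v) (dVec P w v)) := by
  have ht' := hasDerivAt_dVec ht v
  have hQ' := hasDerivAt_dVec hQ v
  have hP' := hasDerivAt_dVec hP v
  ext1 n
  simp only [dSer, coeff_mk, alpha]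
  match n with
  | 0 | 1 | 7 | n + 8 => exact dMatrix_const _ _ _
  | 2 | 3 | 4 | 5 | 6 =>
    simp only [alphaCoeff_two, alphaCoeff_three, alphaCoeff_four, alphaCoeff_five, alphaCoeff_six,
      dAlphaCoeff]
    first | rw [dMatrix_g0] | rw [dMatrix_g1] | rw [dMatrix_g2]
    congr 1 <;> refine fderiv_eq_of_hasDerivAt (by fun_prop) ?_ <;> apply HasDerivAt.congr_deriv <;>
    repeat' first
      | apply ht'
      | apply hQ'
      | apply hP'
      | exact hasDerivAt_const _ _
      | with_reducible apply HasDerivAt.fun_add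
      | with_reducible apply HasDerivAt.fun_sub
      | with_reducible apply HasDerivAt.fun_mul
      | with_reducible apply HasDerivAt.fun_neg
      | with_reducible apply HasDerivAt.fun_pow
    all_goals
      simp only [zero_smul, add_zero, Nat.cast_ofNat, Nat.reduceSub, pow_one]
      try ring

variable {M : Type*} [NormedAddCommGroup M] [NormedSpace ℂ M] {W : Set ((Fin 3 → ℂ) × M)}
  {Q P : (Fin 3 → ℂ) × M → Fin 3 → ℂ}

lemma differentiableOn_time (i : Fin 3) :
    DifferentiableOn ℂ (fun w : (Fin 3 → ℂ) × M => w.1 i) W := by fun_prop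

lemma dVec_fst (w v : (Fin 3 → ℂ) × M) : dVec (fun w : (Fin 3 → ℂ) × M => w.1) w v = v.1 := by
  ext i
  have h := ((ContinuousLinearMap.proj (R := ℂ) (φ := fun _ : Fin 3 => ℂ) i).comp
    (ContinuousLinearMap.fst ℂ (Fin 3 → ℂ) M)).hasFDerivAt (x := w)
  exact congrArg (fun f => f v) h.fderiv

/-- The equation of the formal solution holds identically in `(t, Q, P)`, so it may be
differentiated coefficient by coefficient. The outcome is the linearized equation required by
`residue_eq_dAlpha`. -/
lemma dSer_sol (hW : IsOpen W) (hQ : ∀ i, DifferentiableOn ℂ (fun w => Q w i) W)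
    (hP : ∀ i, DifferentiableOn ℂ (fun w => P w i) W) {w : (Fin 3 → ℂ) × M} (hw : w ∈ W)
    (v : (Fin 3 → ℂ) × M) :
    PowerSeries.mk (dAlphaCoeff w.1 (Q w) (P w) v.1 (dVec Q w v) (dVec P w v))
          * sol w.1 (Q w) (P w)
        + alpha w.1 (Q w) (P w) * dSer (fun w => sol w.1 (Q w) (P w)) w v
        + X ^ 7 * euler (dSer (fun w => sol w.1 (Q w) (P w)) w v)
      = dSer (fun w => sol w.1 (Q w) (P w)) w v * beta w.1
        + sol w.1 (Q w) (P w)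
          * PowerSeries.mk fun n => dMatrix (fun w : (Fin 3 → ℂ) × M => betaCoeff w.1 n) w v := by
  have ht := differentiableOn_time (W := W)
  have hn := hW.mem_nhds hw
  have hα := (diffS_alpha ht hQ hP).diffSAt hW hw
  have hβ : DiffSAt (fun w : (Fin 3 → ℂ) × M => beta w.1) w :=
    (diffS_mk (diffM_betaCoeff ht)).diffSAt hW hw
  have hF := (diffS_sol ht hQ hP).diffSAt hW hw
  have hE := (diffS_sol ht hQ hP).euler.diffSAt hW hw
  have hX := (diffS_const (W := W) (X ^ 7)).diffSAt hW hw
  have hXE := ((diffS_const (W := W) (X ^ 7)).mul (diffS_sol ht hQ hP).euler).diffSAt hW hw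
  have hαF := ((diffS_alpha ht hQ hP).mul (diffS_sol ht hQ hP)).diffSAt hW hw
  have h : (fun w : (Fin 3 → ℂ) × M => alpha w.1 (Q w) (P w) * sol w.1 (Q w) (P w)
      + X ^ 7 * euler (sol w.1 (Q w) (P w))) = fun w => sol w.1 (Q w) (P w) * beta w.1 :=
    funext fun w => (isSol_sol w.1 (Q w) (P w)).2
  have h' := congrArg (fun F => dSer F w v) h
  beta_reduce at h'
  rw [dSer_add hαF hXE, dSer_mul hα hF, dSer_mul hX hE, dSer_mul hF hβ, dSer_const, dSer_euler hF,
    zero_mul, zero_add, dSer_alpha (fun i => (ht i).differentiableAt hn)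
      (fun i => (hQ i).differentiableAt hn) (fun i => (hP i).differentiableAt hn), dVec_fst] at h'
  rw [h']
  simp only [dSer, beta, coeff_mk]

lemma conjU_dMatrix_solCoeff (hW : IsOpen W) (hQ : ∀ i, DifferentiableOn ℂ (fun w => Q w i) W)
    (hP : ∀ i, DifferentiableOn ℂ (fun w => P w i) W) {w : (Fin 3 → ℂ) × M} (hw : w ∈ W)
    (v : (Fin 3 → ℂ) × M) :
    conjU (fun k => dMatrix (fun w => solCoeff w.1 (Q w) (P w) k) w v)
      = dSer (fun w => sol w.1 (Q w) (P w)) w v := by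
  have hF := (diffS_sol differentiableOn_time hQ hP).diffSAt hW hw
  ext1 n
  have e : dMatrix (fun w => solCoeff w.1 (Q w) (P w) n) w v
      = matUInv * dMatrix (fun w => coeff n (sol w.1 (Q w) (P w))) w v * matU := by
    simp only [solCoeff]
    rw [dMatrix_mul ((diffMAt_const _).mul (hF n)) (diffMAt_const _),
      dMatrix_mul (diffMAt_const _) (hF n), dMatrix_const, dMatrix_const, zero_mul, zero_add,
      mul_zero, add_zero]
  rw [conjU, dSer, coeff_mul_C, coeff_C_mul, coeff_mk, coeff_mk, e, ← mul_assoc, ← mul_assoc,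
    matU_mul_inv, one_mul, mul_assoc, matU_mul_inv, mul_one]

/-- The extended tau-differential is half of the action differential, up to an exact form. -/
theorem omega0_eq (hW : IsOpen W) (hQ : ∀ i, DifferentiableOn ℂ (fun w => Q w i) W)
    (hP : ∀ i, DifferentiableOn ℂ (fun w => P w i) W)
    {Φ : (Fin 3 → ℂ) × M → ℕ → M3} (hΦ : ∀ w ∈ W, Φ w = solCoeff w.1 (Q w) (P w))
    {w : (Fin 3 → ℂ) × M} (hw : w ∈ W) (v : (Fin 3 → ℂ) × M) :
    omega0 Q P Φ w v = 1 / 2 * omegaCla Q P w v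
      + fderiv ℂ (fun w' => polyG w'.1 (Q w') (P w')) w v := by
  have hn := hW.mem_nhds hw
  have hF := isSol_sol w.1 (Q w) (P w)
  have hd : (fun k => dMatrix (fun w' => Φ w' k) w v)
      = fun k => dMatrix (fun w' => solCoeff w'.1 (Q w') (P w') k) w v :=
    funext fun k => dMatrix_congr (Filter.mem_of_superset hn fun w' hw' => by
      change Φ w' k = _
      rw [hΦ w' hw']) v
  have hG : conjU (Φ w) * sInv (sol w.1 (Q w) (P w)) = 1 := by
    rw [hΦ w hw, conjU_solCoeff, mul_sInv hF.1]
  have hb (n : ℕ) (hn : 7 ≤ n) : dMatrix (fun w : (Fin 3 → ℂ) × M => betaCoeff w.1 n) w v = 0 := by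
    obtain ⟨n, rfl⟩ := Nat.exists_eq_add_of_le' hn
    exact dMatrix_const _ _ _
  have h := residue_eq_dAlpha hF hb (dSer_sol hW hQ hP hw v)
  rw [trc_dAlpha hF] at h
  rw [fderiv_polyG (t := fun w => w.1) (fun i => (differentiableOn_time i).differentiableAt hn)
    (fun i => (hQ i).differentiableAt hn) (fun i => (hP i).differentiableAt hn), dVec_fst]
  refine Eq.trans ?_ h
  rw [trc, ← conjU_dMatrix_solCoeff hW hQ hP hw, ← hd]
  exact residue_eq _ _ _ _ _ _ hG

/-! ### Closedness -/

/-- Second derivatives of analytic functions are symmetric. -/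
lemma extD_fderiv {E : Type*} [NormedAddCommGroup E] [NormedSpace ℂ E] {f : E → ℂ} {w : E}
    (hf : AnalyticAt ℂ f w) (u v : E) : extD (fun w v => fderiv ℂ f w v) w u v = 0 := by
  have hd : DifferentiableAt ℂ (fderiv ℂ f) w := hf.fderiv.differentiableAt
  have e (a b : E) : fderiv ℂ (fun w' => fderiv ℂ f w' a) w b = fderiv ℂ (fderiv ℂ f) w b a := by
    have := (hd.hasFDerivAt.clm_apply (hasFDerivAt_const a w)).fderiv
    rw [this]
    simp
  rw [extD, e, e, sub_eq_zero]
  exact hf.contDiffAt.isSymmSndFDerivAt_of_omega u v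

/-! ### Commuting Hamiltonian flows -/

lemma dHam_eq_sum (k : Fin 3) (t Q P dt dQ dP : Fin 3 → ℂ) :
    dHam k t Q P dt dQ dP = ∑ l, dHam k t Q P (Pi.single l 1) 0 0 * dt l
      + ∑ a, dHam k t Q P 0 (Pi.single a 1) 0 * dQ a
      + ∑ a, dHam k t Q P 0 0 (Pi.single a 1) * dP a := by
  fin_cases k <;>
  · simp only [Fin.sum_univ_three, dHam, dH1, dH2, dH5, Fin.zero_eta, Fin.mk_one, Fin.reduceFinMk,
      Matrix.cons_val, Pi.single_eq_same, Pi.zero_apply, mul_zero, add_zero, zero_add, mul_one,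
      Pi.single_apply, Fin.reduceEq, if_true, if_false]
    ring

/-- The explicit time derivatives of the Hamiltonians are symmetric. -/
lemma dHam_time_symm (k l : Fin 3) (t Q P : Fin 3 → ℂ) :
    dHam k t Q P (Pi.single l 1) 0 0 = dHam l t Q P (Pi.single k 1) 0 0 := by
  fin_cases k <;> fin_cases l <;>
  · simp only [dHam, dH1, dH2, dH5, Fin.zero_eta, Fin.mk_one, Fin.reduceFinMk,
      Matrix.cons_val, Pi.zero_apply, mul_zero, add_zero, zero_add, mul_one,
      Pi.single_apply, Fin.reduceEq, if_true, if_false]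

/-- The Hamiltonians are in involution. -/
lemma dHam_involution (k l : Fin 3) (t Q P : Fin 3 → ℂ) :
    ∑ a, (dHam k t Q P 0 0 (Pi.single a 1) * dHam l t Q P 0 (Pi.single a 1) 0
      - dHam k t Q P 0 (Pi.single a 1) 0 * dHam l t Q P 0 0 (Pi.single a 1)) = 0 := by
  fin_cases k <;> fin_cases l <;>
  · simp only [Fin.sum_univ_three, dHam, dH1, dH2, dH5, Fin.zero_eta, Fin.mk_one, Fin.reduceFinMk,
      Matrix.cons_val, Pi.zero_apply, mul_zero, add_zero, zero_add, mul_one,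
      Pi.single_apply, Fin.reduceEq, if_true, if_false]
    ring

lemma dVec_const (f : Fin 3 → ℂ) (w v : Fin 3 → ℂ) :
    dVec (fun _ : Fin 3 → ℂ => f) w v = 0 := by
  ext i; simp [dVec]

lemma dVec_id (w v : Fin 3 → ℂ) : dVec (fun w : Fin 3 → ℂ => w) w v = v := by
  ext i
  have h := (ContinuousLinearMap.proj (R := ℂ) (φ := fun _ : Fin 3 => ℂ) i).hasFDerivAt (x := w)
  exact congrArg (fun f => f v) h.fderiv

lemma fderiv_ham_P (k : Fin 3) (t Q P v : Fin 3 → ℂ) :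
    fderiv ℂ (fun p => ham k t Q p) P v = dHam k t Q P 0 0 v := by
  rw [fderiv_ham (t := fun _ => t) (Q := fun _ => Q) (P := fun p => p) (by fun_prop) (by fun_prop)
    (by fun_prop), dVec_const, dVec_const, dVec_id]

lemma fderiv_ham_Q (k : Fin 3) (t Q P v : Fin 3 → ℂ) :
    fderiv ℂ (fun q => ham k t q P) Q v = dHam k t Q P 0 v 0 := by
  rw [fderiv_ham (t := fun _ => t) (Q := fun q => q) (P := fun _ => P) (by fun_prop) (by fun_prop)
    (by fun_prop), dVec_const, dVec_const, dVec_id]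

end ExtendedTau

section Closedness

variable {M : Type*} [NormedAddCommGroup M] [NormedSpace ℂ M] {W : Set ((Fin 3 → ℂ) × M)}
  {Q P : (Fin 3 → ℂ) × M → Fin 3 → ℂ} {w : (Fin 3 → ℂ) × M}

lemma differentiableAt_fderiv_apply {E : Type*} [NormedAddCommGroup E] [NormedSpace ℂ E]
    {f : E → ℂ} {w : E} (hf : AnalyticAt ℂ f w) (v : E) :
    DifferentiableAt ℂ (fun w => fderiv ℂ f w v) w :=
  hf.fderiv.differentiableAt.clm_apply (differentiableAt_const v)

lemma analyticAt_polyG (hQ : AnalyticAt ℂ Q w) (hP : AnalyticAt ℂ P w) :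
    AnalyticAt ℂ (fun w => polyG w.1 (Q w) (P w)) w := by
  have ht (i : Fin 3) : AnalyticAt ℂ (fun w : (Fin 3 → ℂ) × M => w.1 i) w :=
    ((ContinuousLinearMap.proj (R := ℂ) (φ := fun _ : Fin 3 => ℂ) i).comp
      (ContinuousLinearMap.fst ℂ (Fin 3 → ℂ) M)).analyticAt w
  rw [analyticAt_pi_iff] at hQ hP
  have h1 : AnalyticAt ℂ (fun w => ham 0 w.1 (Q w) (P w)) w := by
    change AnalyticAt ℂ (fun w => H1 _ _ _ _ _ _ _ _ _) w
    unfold H1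
    fun_prop
  have h2 : AnalyticAt ℂ (fun w => ham 1 w.1 (Q w) (P w)) w := by
    change AnalyticAt ℂ (fun w => H2 _ _ _ _ _ _ _ _ _) w
    unfold H2
    fun_prop
  have h5 : AnalyticAt ℂ (fun w => ham 2 w.1 (Q w) (P w)) w := by
    change AnalyticAt ℂ (fun w => H5 _ _ _ _ _ _ _ _ _) w
    unfold H5
    fun_prop
  unfold polyG
  fun_prop

lemma differentiableAt_omegaCla (hQ : ∀ a, AnalyticAt ℂ (fun w => Q w a) w)
    (hP : ∀ a, AnalyticAt ℂ (fun w => P w a) w) (v : (Fin 3 → ℂ) × M) :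
    DifferentiableAt ℂ (fun w => omegaCla Q P w v) w := by
  have hH (k : Fin 3) := differentiableAt_ham (t := fun w : (Fin 3 → ℂ) × M => w.1) (w := w)
    (by fun_prop) (fun a => (hQ a).differentiableAt) (fun a => (hP a).differentiableAt) k
  have hP' (a : Fin 3) := (hP a).differentiableAt
  have hQ' (a : Fin 3) := differentiableAt_fderiv_apply (hQ a) v
  unfold omegaCla
  exact (DifferentiableAt.fun_sum fun a _ => (hP' a).fun_mul (hQ' a)).fun_sub
    (DifferentiableAt.fun_sum fun k _ => (hH k).mul_const _)

lemma fderiv_omegaCla (hQ : ∀ a, AnalyticAt ℂ (fun w => Q w a) w)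
    (hP : ∀ a, AnalyticAt ℂ (fun w => P w a) w) (u v : (Fin 3 → ℂ) × M) :
    fderiv ℂ (fun w => omegaCla Q P w v) w u
      = ∑ a, (dVec P w u a * dVec Q w v a
          + P w a * fderiv ℂ (fun w' => fderiv ℂ (fun w => Q w a) w' v) w u)
        - ∑ k, dHam k w.1 (Q w) (P w) u.1 (dVec Q w u) (dVec P w u) * v.1 k := by
  refine fderiv_eq_of_hasDerivAt (differentiableAt_omegaCla hQ hP v) ?_
  have hH (k : Fin 3) := hasDerivAt_line (differentiableAt_ham
    (t := fun w : (Fin 3 → ℂ) × M => w.1) (w := w) (by fun_prop)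
    (fun a => (hQ a).differentiableAt) (fun a => (hP a).differentiableAt) k) u
  have hP' (a : Fin 3) := hasDerivAt_line (hP a).differentiableAt u
  have hQ' (a : Fin 3) := hasDerivAt_line (differentiableAt_fderiv_apply (hQ a) v) u
  have h := (HasDerivAt.fun_sum fun a (_ : a ∈ Finset.univ) => (hP' a).fun_mul (hQ' a)).fun_sub
    (HasDerivAt.fun_sum fun k (_ : k ∈ Finset.univ) => (hH k).mul_const (v.1 k))
  refine h.congr_deriv ?_
  simp only [zero_smul, add_zero]
  congr 1
  refine Finset.sum_congr rfl fun k _ => ?_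
  rw [fderiv_ham (t := fun w : (Fin 3 → ℂ) × M => w.1) (by fun_prop)
    (fun a => (hQ a).differentiableAt) (fun a => (hP a).differentiableAt), dVec_fst]

/-- The second derivatives of `Q` in `d (P dQ)` cancel by symmetry, leaving `∑ dP ∧ dQ - ∑ dH ∧ dt`.
-/
lemma extD_omegaCla (hQ : ∀ a, AnalyticAt ℂ (fun w => Q w a) w)
    (hP : ∀ a, AnalyticAt ℂ (fun w => P w a) w) (u v : (Fin 3 → ℂ) × M) :
    extD (omegaCla Q P) w u v
      = ∑ a, (dVec P w u a * dVec Q w v a - dVec P w v a * dVec Q w u a)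
        - ∑ k, (dHam k w.1 (Q w) (P w) u.1 (dVec Q w u) (dVec P w u) * v.1 k
          - dHam k w.1 (Q w) (P w) v.1 (dVec Q w v) (dVec P w v) * u.1 k) := by
  have h (a : Fin 3) := sub_eq_zero.1 (extD_fderiv (hQ a) u v)
  rw [extD, fderiv_omegaCla hQ hP, fderiv_omegaCla hQ hP]
  simp only [h, Finset.sum_sub_distrib, Finset.sum_add_distrib]
  ring

/-- A tangent vector splits into time directions, where the derivatives are prescribed by `c`, and a
parameter direction, where they remain free. -/
lemma dVec_of_solvesHamilton {f : (Fin 3 → ℂ) × M → Fin 3 → ℂ} {c : Fin 3 → Fin 3 → ℂ}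
    (h : ∀ k a, fderiv ℂ (fun w' => f w' a) w (Pi.single k 1, 0) = c k a)
    (u : (Fin 3 → ℂ) × M) (a : Fin 3) :
    dVec f w u a = ∑ k, u.1 k * c k a + dVec f w (0, u.2) a := by
  have hu : u = ∑ k, u.1 k • ((Pi.single k 1, 0) : (Fin 3 → ℂ) × M) + (0, u.2) := by
    refine Prod.ext ?_ ?_
    · ext i
      simp [Fin.sum_univ_three, Prod.fst_sum, Pi.single_apply]
      fin_cases i <;> simp
    · simp [Prod.snd_sum]
  have e : dVec f w u a = fderiv ℂ (fun w' => f w' a) w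
    (∑ k, u.1 k • ((Pi.single k 1, 0) : (Fin 3 → ℂ) × M) + (0, u.2)) := by rw [← hu, dVec]
  rw [e, map_add, map_sum]
  simp only [map_smul, h, smul_eq_mul, dVec]

/-- On solutions of Hamilton's equations, the exterior derivative of the action differential is
the symplectic form in the parameters. -/
theorem extD_omegaCla_of_solvesHamilton (hH : SolvesHamilton W Q P) (hw : w ∈ W)
    (hQ : ∀ a, AnalyticAt ℂ (fun w => Q w a) w) (hP : ∀ a, AnalyticAt ℂ (fun w => P w a) w)
    (u v : (Fin 3 → ℂ) × M) : extD (omegaCla Q P) w u v = symplecticM Q P w u v := by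
  have h1 (k a : Fin 3) := (hH w hw k a).1.trans (fderiv_ham_P k _ _ _ _)
  have h2 (k a : Fin 3) := (hH w hw k a).2.trans (congrArg (fun x => -x) (fderiv_ham_Q k _ _ _ _))
  have hs (k l : Fin 3) := dHam_time_symm k l w.1 (Q w) (P w)
  have hi (k l : Fin 3) := dHam_involution k l w.1 (Q w) (P w)
  have hu (k : Fin 3) := dHam_eq_sum k w.1 (Q w) (P w) u.1 (dVec Q w u) (dVec P w u)
  have hv (k : Fin 3) := dHam_eq_sum k w.1 (Q w) (P w) v.1 (dVec Q w v) (dVec P w v)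
  have hQu := dVec_of_solvesHamilton h1 u
  have hQv := dVec_of_solvesHamilton h1 v
  have hPu := dVec_of_solvesHamilton h2 u
  have hPv := dVec_of_solvesHamilton h2 v
  rw [extD_omegaCla hQ hP]
  simp only [hu, hv]
  simp only [hQu, hQv, hPu, hPv]
  change _ = ∑ a, (dVec P w (0, u.2) a * dVec Q w (0, v.2) a
    - dVec P w (0, v.2) a * dVec Q w (0, u.2) a)
  generalize dVec P w (0, u.2) = pu, dVec P w (0, v.2) = pv, dVec Q w (0, u.2) = qu,
    dVec Q w (0, v.2) = qv
  clear hu hv hQu hQv hPu hPv h1 h2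
  revert hs hi
  generalize hT : (fun k l => dHam k w.1 (Q w) (P w) (Pi.single l 1) 0 0) = T
  generalize hA : (fun k a => dHam k w.1 (Q w) (P w) 0 (Pi.single a 1) 0) = A
  generalize hB : (fun k a => dHam k w.1 (Q w) (P w) 0 0 (Pi.single a 1)) = B
  have hT' k l : dHam k w.1 (Q w) (P w) (Pi.single l 1) 0 0 = T k l := by rw [← hT]
  have hA' k l : dHam k w.1 (Q w) (P w) 0 (Pi.single l 1) 0 = A k l := by rw [← hA]
  have hB' k l : dHam k w.1 (Q w) (P w) 0 0 (Pi.single l 1) = B k l := by rw [← hB]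
  simp only [hT', hA', hB']
  intro hs hi
  simp only [Fin.sum_univ_three] at hi ⊢
  -- Products of a time component with a parameter component cancel identically. The coefficient of
  -- each `dt_k ∧ dt_l` is, up to sign, the Poisson bracket of `H_k` and `H_l` combined with the
  -- difference of their explicit time derivatives.
  linear_combination (u.1 1 * v.1 0 - u.1 0 * v.1 1) * (hi 0 1 - hs 0 1)
    + (u.1 2 * v.1 0 - u.1 0 * v.1 2) * (hi 0 2 - hs 0 2)
    + (u.1 2 * v.1 1 - u.1 1 * v.1 2) * (hi 1 2 - hs 1 2)

end Closedness

end String34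

end

theorem proposition1p5 :
    (∀ t Q P : Fin 3 → ℂ, ∃! Φ : ℕ → Matrix (Fin 3) (Fin 3) ℂ,
      String34.IsFormalSolution t Q P Φ) ∧
    ∀ (M : Type*) [NormedAddCommGroup M] [NormedSpace ℂ M]
      (W : Set ((Fin 3 → ℂ) × M)) (Q P : (Fin 3 → ℂ) × M → Fin 3 → ℂ)
      (Φ : (Fin 3 → ℂ) × M → ℕ → Matrix (Fin 3) (Fin 3) ℂ),
      IsOpen W → AnalyticOnNhd ℂ Q W → AnalyticOnNhd ℂ P W →
      (∀ w ∈ W, String34.IsFormalSolution w.1 (Q w) (P w) (Φ w)) →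
        (∀ k i j, DifferentiableOn ℂ (fun w => Φ w k i j) W) ∧
        (∀ v, DifferentiableOn ℂ (fun w => String34.omega0 Q P Φ w v) W) ∧
        (∀ w ∈ W, ∀ v,
          String34.omega0 Q P Φ w v = 1 / 2 * String34.omegaCla Q P w v
            + fderiv ℂ (fun w' => String34.polyG w'.1 (Q w') (P w')) w v) ∧
        (String34.SolvesHamilton W Q P → ∀ w ∈ W, ∀ u v,
          String34.extD (String34.omega0 Q P Φ) w u v
            = 1 / 2 * String34.symplecticM Q P w u v) := by
  refine ⟨fun t Q P => ⟨String34.solCoeff t Q P, (String34.isFormalSolution_iff_eq t Q P _).2 rfl,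
    fun Φ hΦ => (String34.isFormalSolution_iff_eq t Q P Φ).1 hΦ⟩, ?_⟩
  intro M _ _ W Q P Φ hW hQ hP hΦ
  have hQa (w) (hw : w ∈ W) (a : Fin 3) : AnalyticAt ℂ (fun w => Q w a) w :=
    analyticAt_pi_iff.1 (hQ w hw) a
  have hPa (w) (hw : w ∈ W) (a : Fin 3) : AnalyticAt ℂ (fun w => P w a) w :=
    analyticAt_pi_iff.1 (hP w hw) a
  have hQd (a : Fin 3) : DifferentiableOn ℂ (fun w => Q w a) W :=
    fun w hw => (hQa w hw a).differentiableAt.differentiableWithinAt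
  have hPd (a : Fin 3) : DifferentiableOn ℂ (fun w => P w a) W :=
    fun w hw => (hPa w hw a).differentiableAt.differentiableWithinAt
  -- Uniqueness identifies the given coefficients with the constructed ones, whose dependence on the
  -- point is known to be holomorphic.
  have hΦ' (w) (hw : w ∈ W) : Φ w = String34.solCoeff w.1 (Q w) (P w) :=
    (String34.isFormalSolution_iff_eq _ _ _ _).1 (hΦ w hw)
  have h0 (w) (hw : w ∈ W) (v) := String34.omega0_eq hW hQd hPd hΦ' hw v
  have hG (w) (hw : w ∈ W) := String34.analyticAt_polyG (hQ w hw) (hP w hw)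
  have hc (w) (hw : w ∈ W) (v) := String34.differentiableAt_omegaCla (hQa w hw) (hPa w hw) v
  refine ⟨fun k i j => ?_, fun v w hw => ?_, h0, fun hH w hw u v => ?_⟩
  · exact (String34.diffM_solCoeff String34.differentiableOn_time hQd hPd k i j).congr
      fun w hw => by rw [hΦ' w hw]
  · refine DifferentiableWithinAt.congr (DifferentiableAt.differentiableWithinAt ?_)
      (fun w hw => h0 w hw v) (h0 w hw v)
    exact ((hc w hw v).const_mul _).fun_add
      (String34.differentiableAt_fderiv_apply (hG w hw) v)
  -- The formula for the tau-differential holds on a neighbourhood of `w`, so it may be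
  -- differentiated; the exact part then drops out by symmetry of second derivatives.
  · have e (v) : fderiv ℂ (fun w => String34.omega0 Q P Φ w v) w
        = (1 / 2 : ℂ) • fderiv ℂ (fun w => String34.omegaCla Q P w v) w
          + fderiv ℂ (fun w => fderiv ℂ (fun w => String34.polyG w.1 (Q w) (P w)) w v) w := by
      have hn : (fun w => String34.omega0 Q P Φ w v) =ᶠ[nhds w] _ :=
        Filter.mem_of_superset (hW.mem_nhds hw) fun w hw => h0 w hw v
      rw [hn.fderiv_eq, fderiv_fun_add ((hc w hw v).const_mul _)
        (String34.differentiableAt_fderiv_apply (hG w hw) v), fderiv_const_mul (hc w hw v)]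
    rw [← String34.extD_omegaCla_of_solvesHamilton hH hw (hQa w hw) (hPa w hw),
      String34.extD, String34.extD, e, e]
    have := String34.extD_fderiv (hG w hw) u v
    rw [String34.extD] at this
    simp only [add_apply, smul_apply, smul_eq_mul]
    linear_combination this
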